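/- **Setting.** Let $\Bbbk$ be a field of characteristic $e$ ($e=0$ or a prime) and $I=\mathbb Z/e\mathbb Z\subseteq\Bbbk$. Let $(a_{rs})_{1\le r,s\le n}$ be a Cartan matrix of finite type, not necessarily connected, with finite Weyl group $\mathcal W$ generated as a Coxeter group by $\sigma_1,\dots,\sigma_n$. Write $r - s$ if $a_{rs}=a_{sr}=-1$, $r\Rightarrow s$ if $(a_{rs},a_{sr})=(-2,-1)$, and $r\Rrightarrow s$ if $(a_{rs},a_{sr})=(-3,-1)$. The group $\mathcal W$ acts on $I^n$ by $\sigma_r(\mathbf i)_s=i_s-a_{sr}i_r$ and on polynomial rings by $\sigma_r(x_s)=x_s-a_{sr}x_r$; put $\partial_r(f)=(\sigma_r(f)-f)/x_r$, so $\partial_r(x_s)=-a_{sr}$ (likewise for the variables $y$). Fix a $\mathcal W$-orbit $\mathcal C\subseteq I^n$. *The Lusztig extension.* The degenerate affine Hecke algebra $\mathcal H$ is the $\Bbbk$-algebra generated by $x_r,t_r$ ($1\le r\le n$) with relations (H) $x_rx_s=x_sx_r$; $t_rx_s=\sigma_r(x_s)t_r+\partial_r(x_s)$; $t_r^2=1$;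 $t_rt_s=t_st_r$ if $a_{rs}=0$; $t_rt_st_r=t_st_rt_s$ if $r-s$; $(t_rt_s)^2=(t_st_r)^2$ if $r\Rightarrow s$; $(t_rt_s)^3=(t_st_r)^3$ if $r\Rrightarrow s$. Let $Z=\Bbbk[x]^{\mathcal W}$ (which is central in $\mathcal H$), $F=\operatorname{Frac}Z$, $\mathcal H_F=\mathcal H\otimes_ZF$ and $\phi_r=t_r+x_r^{-1}\in\mathcal H_F$. The Lusztig extension $\mathcal L$ is the $\Bbbk$-algebra generated by the algebra $\mathcal H_F$ and elements $\epsilon(\mathbf i)$ ($\mathbf i\in\mathcal C$) subject to (E) $\epsilon(\mathbf i)\epsilon(\mathbf j)=\delta_{\mathbf i\mathbf j}\epsilon(\mathbf i)$, $\sum_{\mathbf i\in\mathcal C}\epsilon(\mathbf i)=1$, and $x_r\epsilon(\mathbf i)=\epsilon(\mathbf i)x_r$, $\phi_r\epsilon(\mathbf i)=\epsilon(\sigma_r(\mathbf i))\phi_r$. In $\mathcal L$ put $$y_r=\sum_{\mathbf i}(x_r-i_r)\epsilon(\mathbf i),\qquad \theta_r=\phi_r\sum_{\mathbf i}q_r(\mathbf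 i)^{-1}\epsilon(\mathbf i),\qquad \psi_r=\sum_{\mathbf i}(\theta_r-\delta_{i_r,0}\,y_r^{-1})\epsilon(\mathbf i),$$ where $q_r(\mathbf i)$ is $1-y_r$ if $i_r=0$; $1$ if $i_r=1,e\ne2$; $(y_r-2)(1-y_r)^{-2}$ if $i_r=-1,e\neq2$; $(1-y_r)^{-1}$ if $i_r=1,e=2$; $1-(y_r+i_r)^{-1}$ if $i_r\ne0,\pm1$. *The BK algebra.* $\tilde{\mathcal L}$ is the $\Bbbk$-algebra with generators $y_r,\psi_r$ ($1\le r\le n$), $\epsilon(\mathbf i)$ ($\mathbf i\in\mathcal C$) and $f^{-1}$ ($f\in\Bbbk[y]$, $f(0)\ne0$) and the following relations. (1) The relations (E). (2) $y_r\epsilon(\mathbf i)=\epsilon(\mathbf i)y_r$, $y_ry_s=y_sy_r$. (3) $ff^{-1}=f^{-1}f=1$. (4) $\psi_r\epsilon(\mathbf i)=\epsilon(\sigma_r(\mathbf i))\psi_r$. (5) $\psi_ry_s\epsilon(\mathbf i)=(\sigma_r(y_s)\psi_r+\delta_{i_r,0}\,\partial_r(y_s))\epsilon(\mathbf i)$.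 (6) $\psi_r^2\epsilon(\mathbf i)=c\,\epsilon(\mathbf i)$ with $c=0$ if $i_r=0$; $-y_r$ if $i_r=1,e\ne2$; $y_r$ if $i_r=-1,e\neq 2$; $-y_r^2$ if $i_r=1,e=2$; $1$ if $i_r\ne0,\pm1$. (7) $\psi_r\psi_s=\psi_s\psi_r$ if $a_{rs}=0$. (8) If $r-s$: $(\psi_r\psi_s\psi_r-\psi_s\psi_r\psi_s)\epsilon(\mathbf i)=c\,\epsilon(\mathbf i)$ with $c=1$ if $i_r=-i_s=1,e\ne2$; $-1$ if $i_r=-i_s=-1,e\ne2$; $y_r-y_s$ if $i_r=i_s=1,e=2$; $0$ otherwise. (9) If $r\Rightarrow s$: $[(\psi_r\psi_s)^2-(\psi_s\psi_r)^2]\epsilon(\mathbf i)=c\,\epsilon(\mathbf i)$ with, for $e\ne2$: $c=\psi_r$ if $(i_r,i_s)=(-2,1)$; $-\psi_r$ if $(2,-1)$; $-2\psi_s$ if $(1,-1)$; $2\psi_s$ if $(-1,1)$; for $e=2$: $c=y_r\psi_r+1$ if $(0,1)$; and $c=0$ in all other cases. (10) If $r\Rrightarrow s$: $[(\psi_r\psi_s)^3-(\psi_s\psi_r)^3]\epsilon(\mathbf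 i)=c\,\epsilon(\mathbf i)$, where for $e=2$: $c=(y_r+y_s)\psi_r\psi_s\psi_r-3(y_r+3y_s)\psi_s\psi_r\psi_s-y_r^2+3y_s^2$ if $(i_r,i_s)=(1,1)$; for $e=3$: $c=\psi_r\psi_s\psi_r$ if $(0,1)$; $-\psi_r\psi_s\psi_r$ if $(0,-1)$; $-2y_r\psi_r$ if $(-2,1)$ or $(2,-1)$; for $e\ne2,3$: $c=\psi_r\psi_s\psi_r$ if $(-3,1)$; $-\psi_r\psi_s\psi_r$ if $(3,-1)$; $-3\psi_s\psi_r\psi_s$ if $(1,-1)$; $3\psi_s\psi_r\psi_s$ if $(-1,1)$; $-2y_r\psi_r$ if $(-2,1)$ or $(2,-1)$; $-\psi_s$ if ($i_r=1$ and $3i_s=-2$) or $(i_r,i_s)=(3,-2)$; $\psi_s$ if ($i_r=-1$ and $3i_s=2$) or $(i_r,i_s)=(-3,2)$; and $c=0$ in all other cases. **Corollary.** The map $\bigoplus_{\mathbf i\in\mathcal C}\mathcal H_F\to\mathcal L$, $(h_{\mathbf i})\mapsto\sum h_{\mathbf i}\epsilon(\mathbf i)$, is bijective (so $\mathcal L=\mathcal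 H_F\otimes\mathcal E$ as a space, with $\mathcal E=\bigoplus_{\mathbf i\in\mathcal C}\Bbbk\,\epsilon(\mathbf i)$), and for every nonzero polynomial $f$ the elements $f(x)\in\mathcal H_F$ and $f(y)\in\mathcal L$ are invertible. There is an injective algebra homomorphism $\alpha:\tilde{\mathcal L}\to\mathcal L$ sending $y_r,\psi_r,\epsilon(\mathbf i),f^{-1}$ to $y_r,\psi_r,\epsilon(\mathbf i),f(y)^{-1}$. Thus $\tilde{\mathcal L}$ is a subalgebra of $\mathcal L$, and as such it has the following presentation: it contains and is generated by the elements $x_r$, $t_r$ ($1\le r\le n$) and $f(x)^{-1}\epsilon(\mathbf i)$ ($\mathbf i\in\mathcal C$, $f\in\Bbbk[x]$, $f(\mathbf i)\ne0$) of $\mathcal L$, where $1^{-1}\epsilon(\mathbf i)=\epsilon(\mathbf i)$, and all relations between them follow from (H), (E), $x_r\epsilon(\mathbf i)=\epsilon(\mathbf i)x_r$, $$t_r\epsilon(\mathbf i)=\epsilon(\sigma_r(\mathbf i))t_r+x_r^{-1}\epsilon(\sigma_r(\mathbf i))-x_r^{-1}\epsilon(\mathbf i)$$ (the last two terms being omitted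 when $i_r=0$, in which case $\sigma_r(\mathbf i)=\mathbf i$), and, for $f(\mathbf i)\neq0$, $$\epsilon(\mathbf j)\cdot f^{-1}\epsilon(\mathbf i)=\delta_{\mathbf i\mathbf j}f^{-1}\epsilon(\mathbf i)=f^{-1}\epsilon(\mathbf i)\cdot\epsilon(\mathbf j),\qquad f\cdot f^{-1}\epsilon(\mathbf i)=\epsilon(\mathbf i)=f^{-1}\epsilon(\mathbf i)\cdot f .$$ -/

import Mathlib

noncomputable section

namespace DegBK

/-! ### Cartan matrices, the Weyl group and its action on tuples -/

/-- The order of `σ_r σ_s` in terms of `a_{rs} a_{sr}` (`0` encodes infinite order). -/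
def coxeterOrder (p : ℤ) : ℕ :=
  if p = 0 then 2 else if p = 1 then 3 else if p = 2 then 4 else if p = 3 then 6 else 0

/-- The Coxeter matrix attached to an integer matrix `a`. -/
def coxeterMatrixOf {n : ℕ} (a : Fin n → Fin n → ℤ) : CoxeterMatrix (Fin n) where
  M := fun r s => if r = s then 1 else coxeterOrder (a r s * a s r)
  isSymm := Matrix.IsSymm.ext fun r s => by
    simp only [eq_comm (a := s) (b := r), mul_comm (a s r)]
  diagonal := fun r => by simp
  off_diagonal := fun r s h => by
    simp only [if_neg h, coxeterOrder]
    split_ifs <;> decide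

/-- A Cartan matrix of finite type with vertex set `Fin n`: a Cartan matrix all of whose
edges are single, double or triple and whose Weyl group (the associated Coxeter group) is finite.
The diagram may be disconnected. -/
structure FiniteCartan (n : ℕ) where
  a : Fin n → Fin n → ℤ
  diag : ∀ r, a r r = 2
  nonpos : ∀ r s, r ≠ s → a r s ≤ 0
  zero_symm : ∀ r s, a r s = 0 → a s r = 0
  prod_le : ∀ r s, r ≠ s → a r s * a s r ≤ 3
  finite : Finite (coxeterMatrixOf a).Group

variable {n : ℕ} (A : FiniteCartan n)

/-- The Weyl group, viewed as a Coxeter group. -/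
abbrev FiniteCartan.W : Type := (coxeterMatrixOf A.a).Group

instance : Finite A.W := A.finite

/-- `r` and `s` are joined by a single edge. -/
def FiniteCartan.Single (r s : Fin n) : Prop := A.a r s = -1 ∧ A.a s r = -1

/-- `r` and `s` are joined by a double edge with an arrow from `r` to `s`. -/
def FiniteCartan.Double (r s : Fin n) : Prop := A.a r s = -2 ∧ A.a s r = -1

/-- `r` and `s` are joined by a triple edge with an arrow from `r` to `s`. -/
def FiniteCartan.Triple (r s : Fin n) : Prop := A.a r s = -3 ∧ A.a s r = -1

section Action

variable {V : Type*} [AddCommGroup V]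

/-- `σ_r(v)_s = v_s - a_{sr} v_r`. -/
def reflect (r : Fin n) (v : Fin n → V) : Fin n → V := fun s => v s - A.a s r • v r

theorem reflect_reflect (r : Fin n) (v : Fin n → V) : reflect A r (reflect A r v) = v := by
  funext t
  simp only [reflect, A.diag]
  module

/-- `σ_r` as a permutation. -/
def reflectPerm (V : Type*) [AddCommGroup V] (r : Fin n) : Equiv.Perm (Fin n → V) where
  toFun := reflect A r
  invFun := reflect A r
  left_inv := reflect_reflect A r
  right_inv := reflect_reflect A r

theorem reflect_liftable (V : Type*) [AddCommGroup V] :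
    (coxeterMatrixOf A.a).IsLiftable (reflectPerm A V) := by
  intro r s
  change (reflectPerm A V r * reflectPerm A V s) ^
    (if r = s then 1 else coxeterOrder (A.a r s * A.a s r)) = 1
  by_cases h : r = s
  · subst h
    rw [if_pos rfl, pow_one]
    ext v t
    exact congrFun (reflect_reflect A r v) t
  rw [if_neg h]
  have hr := A.diag r
  have hs := A.diag s
  have n1 := A.nonpos r s h
  have n2 := A.nonpos s r (fun q => h q.symm)
  have z1 := A.zero_symm r s
  have z2 := A.zero_symm s r
  have le := A.prod_le r s h
  have cases6 : (A.a r s = 0 ∧ A.a s r = 0) ∨ (A.a r s = -1 ∧ A.a s r = -1) ∨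
      (A.a r s = -2 ∧ A.a s r = -1) ∨ (A.a r s = -1 ∧ A.a s r = -2) ∨
      (A.a r s = -3 ∧ A.a s r = -1) ∨ (A.a r s = -1 ∧ A.a s r = -3) := by
    by_cases e1 : A.a r s = 0
    · exact Or.inl ⟨e1, z1 e1⟩
    have e2 : A.a s r ≠ 0 := fun q => e1 (z2 q)
    have l1 : -3 ≤ A.a r s := by
      have : A.a r s ≤ -1 := by omega
      have : A.a s r ≤ -1 := by omega
      nlinarith
    have l2 : -3 ≤ A.a s r := by
      have : A.a r s ≤ -1 := by omega
      have : A.a s r ≤ -1 := by omega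
      nlinarith
    generalize A.a r s = p at *
    generalize A.a s r = q at *
    interval_cases p <;> interval_cases q <;> simp_all
  set T := reflectPerm A V r * reflectPerm A V s with hT
  have T1 : ∀ v t, T v t = v t - A.a t s • v s - A.a t r • (v r - A.a r s • v s) := by
    intro v t; rfl
  rcases cases6 with ⟨h1, h2⟩ | ⟨h1, h2⟩ | ⟨h1, h2⟩ | ⟨h1, h2⟩ | ⟨h1, h2⟩ | ⟨h1, h2⟩
  · rw [h1, h2]
    change T ^ 2 = 1
    ext v t
    simp only [pow_succ, pow_zero, one_mul, Equiv.Perm.mul_apply, Equiv.Perm.one_apply,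
      T1, hr, hs, h1, h2]
    module
  · rw [h1, h2]
    change T ^ 3 = 1
    ext v t
    simp only [pow_succ, pow_zero, one_mul, Equiv.Perm.mul_apply, Equiv.Perm.one_apply,
      T1, hr, hs, h1, h2]
    module
  · rw [h1, h2]
    change T ^ 4 = 1
    ext v t
    simp only [pow_succ, pow_zero, one_mul, Equiv.Perm.mul_apply, Equiv.Perm.one_apply,
      T1, hr, hs, h1, h2]
    module
  · rw [h1, h2]
    change T ^ 4 = 1
    ext v t
    simp only [pow_succ, pow_zero, one_mul, Equiv.Perm.mul_apply, Equiv.Perm.one_apply,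
      T1, hr, hs, h1, h2]
    module
  · rw [h1, h2]
    change T ^ 6 = 1
    have T3 : ∀ v t, (T ^ 3) v t = v t - A.a t s • ((2 : ℤ) • v r + (4 : ℤ) • v s)
        - A.a t r • ((4 : ℤ) • v r + (6 : ℤ) • v s) := by
      intro v t
      simp only [pow_succ, pow_zero, one_mul, Equiv.Perm.mul_apply, T1, hr, hs, h1, h2]
      module
    rw [show 6 = 3 + 3 from rfl, pow_add]
    ext v t
    simp only [Equiv.Perm.mul_apply, Equiv.Perm.one_apply, T3, hr, hs, h1, h2]
    module
  · rw [h1, h2]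
    change T ^ 6 = 1
    have T3 : ∀ v t, (T ^ 3) v t = v t - A.a t s • ((6 : ℤ) • v r + (4 : ℤ) • v s)
        - A.a t r • ((4 : ℤ) • v r + (2 : ℤ) • v s) := by
      intro v t
      simp only [pow_succ, pow_zero, one_mul, Equiv.Perm.mul_apply, T1, hr, hs, h1, h2]
      module
    rw [show 6 = 3 + 3 from rfl, pow_add]
    ext v t
    simp only [Equiv.Perm.mul_apply, Equiv.Perm.one_apply, T3, hr, hs, h1, h2]
    module

end Action

/-- The action of the Weyl group on tuples, with `σ_r` acting by `reflect A r`. -/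
def weylAct (V : Type*) [AddCommGroup V] : A.W →* Equiv.Perm (Fin n → V) :=
  (coxeterMatrixOf A.a).toCoxeterSystem.lift ⟨reflectPerm A V, reflect_liftable A V⟩

theorem weylAct_simple (V : Type*) [AddCommGroup V] (r : Fin n) (v : Fin n → V) :
    weylAct A V ((coxeterMatrixOf A.a).toCoxeterSystem.simple r) v = reflect A r v :=
  congrArg (fun p : Equiv.Perm (Fin n → V) => p v)
    ((coxeterMatrixOf A.a).toCoxeterSystem.lift_apply_simple (reflect_liftable A V) r)

/-- The Weyl group orbit of the tuple `i₀` of elements of `ℤ/eℤ`. -/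
abbrev Orbit {e : ℕ} (i₀ : Fin n → ZMod e) : Type :=
  {i : Fin n → ZMod e // ∃ w : A.W, weylAct A (ZMod e) w i₀ = i}

instance {e : ℕ} (i₀ : Fin n → ZMod e) : Finite (Orbit A i₀) :=
  inferInstanceAs (Finite (Set.range fun w : A.W => weylAct A (ZMod e) w i₀))

instance {e : ℕ} (i₀ : Fin n → ZMod e) : Fintype (Orbit A i₀) := Fintype.ofFinite _

variable {A} in
/-- `σ_r` acting on the orbit. -/
def Orbit.refl {e : ℕ} {i₀ : Fin n → ZMod e} (r : Fin n) (i : Orbit A i₀) : Orbit A i₀ :=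
  ⟨reflect A r i.1, by
    obtain ⟨w, hw⟩ := i.2
    refine ⟨(coxeterMatrixOf A.a).toCoxeterSystem.simple r * w, ?_⟩
    rw [map_mul, Equiv.Perm.mul_apply, hw, weylAct_simple]⟩

/-! ### Polynomials -/

/-- The value `f(z_1, …, z_n)` of a polynomial at elements of an algebra (monomials are evaluated
in the order `z_1^{m_1} ⋯ z_n^{m_n}`; the order is immaterial when the `z_r` commute). -/
def ev {k R : Type*} [Field k] [Ring R] [Algebra k R] (z : Fin n → R)
    (f : MvPolynomial (Fin n) k) : R :=
  ∑ m ∈ f.support, f.coeff m • (List.ofFn fun r => z r ^ m r).prod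

/-- The automorphism `σ_r` of `k[x]`: `σ_r(x_s) = x_s - a_{sr} x_r`. -/
def polyRefl (k : Type*) [Field k] (r : Fin n) :
    MvPolynomial (Fin n) k →ₐ[k] MvPolynomial (Fin n) k :=
  MvPolynomial.aeval (reflect A r MvPolynomial.X)

/-- The algebra `Z` of Weyl group invariants in `k[x]` (the `σ_r` generate the Weyl group). -/
def invariants (k : Type*) [Field k] : Subalgebra k (MvPolynomial (Fin n) k) :=
  ⨅ r : Fin n, AlgHom.equalizer (polyRefl A k r) (AlgHom.id k _)

theorem mem_invariants {k : Type*} [Field k] {f : MvPolynomial (Fin n) k} :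
    f ∈ invariants A k ↔ ∀ r, polyRefl A k r f = f := by
  simp [invariants, Algebra.mem_iInf, AlgHom.mem_equalizer]

/-- The field `F` of fractions of `Z`. -/
abbrev InvField (k : Type*) [Field k] : Type _ := FractionRing (invariants A k)

/-- The point of `k^n` given by a tuple of elements of `ℤ/eℤ`, `e` the characteristic of `k`. -/
def point (k : Type*) [Field k] {e : ℕ} [CharP k e] (i : Fin n → ZMod e) : Fin n → k :=
  fun r => ZMod.castHom (dvd_refl e) k (i r)

/-! ### The degenerate affine Hecke algebra -/

/-- The defining relations of the degenerate affine Hecke algebra for elements `x_r`, `t_r` of a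
ring. Here `σ_r(x_s) = x_s - a_{sr} x_r` and `∂_r(x_s) = (σ_r(x_s) - x_s) / x_r = -a_{sr}`. -/
inductive HeckeRel {R : Type*} [Ring R] (x t : Fin n → R) : R → R → Prop
  | x_comm (r s) : HeckeRel x t (x r * x s) (x s * x r)
  | t_x (r s) : HeckeRel x t (t r * x s) (reflect A r x s * t r + ((-A.a s r : ℤ) : R))
  | t_sq (r) : HeckeRel x t (t r ^ 2) 1
  | t_comm (r s) (h : A.a r s = 0) : HeckeRel x t (t r * t s) (t s * t r)
  | t_single (r s) (h : A.Single r s) : HeckeRel x t (t r * t s * t r) (t s * t r * t s)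
  | t_double (r s) (h : A.Double r s) : HeckeRel x t ((t r * t s) ^ 2) ((t s * t r) ^ 2)
  | t_triple (r s) (h : A.Triple r s) : HeckeRel x t ((t r * t s) ^ 3) ((t s * t r) ^ 3)

/-- Generators of the degenerate affine Hecke algebra. -/
inductive HeckeGen (n : ℕ) : Type
  | x (r : Fin n)
  | t (r : Fin n)

/-- The degenerate affine Hecke algebra `H`. -/
def Hecke (k : Type*) [Field k] : Type _ :=
  RingQuot (HeckeRel A (fun r => FreeAlgebra.ι k (HeckeGen.x r))
    (fun r => FreeAlgebra.ι k (HeckeGen.t r)))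

namespace Hecke

variable (k : Type*) [Field k]

instance : Ring (Hecke A k) := inferInstanceAs (Ring (RingQuot _))
instance : Algebra k (Hecke A k) := inferInstanceAs (Algebra k (RingQuot _))

/-- The quotient map from the free algebra. -/
def mk : FreeAlgebra k (HeckeGen n) →ₐ[k] Hecke A k := RingQuot.mkAlgHom k _

def x (r : Fin n) : Hecke A k := mk A k (FreeAlgebra.ι k (HeckeGen.x r))
def t (r : Fin n) : Hecke A k := mk A k (FreeAlgebra.ι k (HeckeGen.t r))

theorem x_comm (r s : Fin n) : x A k r * x A k s = x A k s * x A k r := by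
  have := RingQuot.mkAlgHom_rel k (HeckeRel.x_comm (A := A)
    (x := fun r => FreeAlgebra.ι k (HeckeGen.x r)) (t := fun r => FreeAlgebra.ι k (HeckeGen.t r))
    r s)
  simp only [map_mul] at this
  exact this

theorem t_x (r s : Fin n) :
    t A k r * x A k s = reflect A r (x A k) s * t A k r + ((-A.a s r : ℤ) : Hecke A k) := by
  have := RingQuot.mkAlgHom_rel k (HeckeRel.t_x (A := A)
    (x := fun r => FreeAlgebra.ι k (HeckeGen.x r)) (t := fun r => FreeAlgebra.ι k (HeckeGen.t r))
    r s)
  simp only [map_mul, map_add, reflect, map_sub, map_zsmul, map_intCast] at this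
  exact this

/-- The homomorphism `k[x] → H`. -/
def poly : MvPolynomial (Fin n) k →ₐ[k] Hecke A k :=
  letI : CommRing (Algebra.adjoin k (Set.range (x A k))) :=
    { (Algebra.adjoin k (Set.range (x A k))).toRing with
      mul_comm := (Algebra.isMulCommutative_adjoin k (by
        rintro _ ⟨r, rfl⟩ _ ⟨s, rfl⟩
        exact x_comm A k r s)).is_comm.comm }
  (Algebra.adjoin k (Set.range (x A k))).val.comp
    (MvPolynomial.aeval fun r => (⟨x A k r, Algebra.subset_adjoin ⟨r, rfl⟩⟩ :
      Algebra.adjoin k (Set.range (x A k))))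

theorem poly_X (r : Fin n) : poly A k (MvPolynomial.X r) = x A k r := by
  simp [poly]

theorem t_poly (r : Fin n) (f : MvPolynomial (Fin n) k) :
    ∃ g : MvPolynomial (Fin n) k, MvPolynomial.X r * g = polyRefl A k r f - f ∧
      t A k r * poly A k f = poly A k (polyRefl A k r f) * t A k r + poly A k g := by
  induction f using MvPolynomial.induction_on with
  | C c =>
    refine ⟨0, by simp [polyRefl, MvPolynomial.algebraMap_eq], ?_⟩
    have h : (MvPolynomial.C c : MvPolynomial (Fin n) k) = algebraMap k _ c := rfl
    rw [h, AlgHom.commutes, AlgHom.commutes, AlgHom.commutes, map_zero, add_zero,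
      Algebra.commutes]
  | add p q hp hq =>
    obtain ⟨g, h1, h2⟩ := hp
    obtain ⟨g', h1', h2'⟩ := hq
    refine ⟨g + g', ?_, ?_⟩
    · rw [mul_add, h1, h1', map_add]; ring
    · simp only [map_add, mul_add, add_mul, h2, h2']; abel
  | mul_X p s hp =>
    obtain ⟨g, h1, h2⟩ := hp
    have hX : polyRefl A k r (MvPolynomial.X s) =
        MvPolynomial.X s - A.a s r • MvPolynomial.X r := by
      simp [polyRefl, reflect]
    refine ⟨polyRefl A k r p * ((-A.a s r : ℤ) : MvPolynomial (Fin n) k)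
      + g * MvPolynomial.X s, ?_, ?_⟩
    · rw [mul_add, ← mul_assoc, ← mul_assoc, h1, map_mul, hX, zsmul_eq_mul]
      push_cast
      ring
    · have e1 : poly A k (MvPolynomial.X s - A.a s r • MvPolynomial.X r) =
          reflect A r (x A k) s := by
        rw [map_sub, map_zsmul, poly_X, poly_X]; rfl
      rw [map_mul, map_mul, ← mul_assoc, h2, add_mul, mul_assoc, poly_X, t_x, hX, map_mul, e1,
        map_add, map_mul, map_mul, poly_X, map_intCast, mul_add, mul_assoc, add_assoc]

theorem invariants_central (z : invariants A k) (h : Hecke A k) :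
    poly A k z * h = h * poly A k z := by
  suffices H : ∀ a : FreeAlgebra k (HeckeGen n), poly A k z * mk A k a = mk A k a * poly A k z by
    obtain ⟨a, rfl⟩ := RingQuot.mkAlgHom_surjective k _ h
    exact H a
  intro a
  induction a using FreeAlgebra.induction with
  | grade0 c => rw [AlgHom.commutes, Algebra.commutes]
  | grade1 g =>
    cases g with
    | x r =>
      change poly A k z * x A k r = x A k r * poly A k z
      rw [← poly_X, ← map_mul, ← map_mul, mul_comm]
    | t r =>
      change poly A k z * t A k r = t A k r * poly A k z
      obtain ⟨g, h1, h2⟩ := t_poly A k r z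
      rw [(mem_invariants A).1 z.2 r] at h1 h2
      rw [sub_self, mul_eq_zero] at h1
      rw [h2, h1.resolve_left (MvPolynomial.X_ne_zero r), map_zero, add_zero]
  | mul a b ha hb => rw [map_mul, ← mul_assoc, ha, mul_assoc, hb, mul_assoc]
  | add a b ha hb => rw [map_add, mul_add, add_mul, ha, hb]

/-- `H` is an algebra over the central subalgebra `Z`. -/
instance : Algebra (invariants A k) (Hecke A k) :=
  ((poly A k).comp (invariants A k).val).toRingHom.toAlgebra' fun z h =>
    invariants_central A k z h

instance : IsScalarTower k (invariants A k) (Hecke A k) :=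
  IsScalarTower.of_algebraMap_eq fun c =>
    (((poly A k).comp (invariants A k).val).commutes c).symm

end Hecke

/-! ### The rationalization and the Lusztig extension -/

/-- The rationalization `H_F = H ⊗_Z F`. -/
abbrev HeckeF (k : Type*) [Field k] : Type _ :=
  TensorProduct (invariants A k) (Hecke A k) (InvField A k)

namespace HeckeF

variable (k : Type*) [Field k]

def x (r : Fin n) : HeckeF A k := TensorProduct.tmul _ (Hecke.x A k r) 1
def t (r : Fin n) : HeckeF A k := TensorProduct.tmul _ (Hecke.t A k r) 1

/-- The intertwining element `φ_r = t_r + x_r⁻¹`. -/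
def phi (r : Fin n) : HeckeF A k := t A k r + Ring.inverse (x A k r)

end HeckeF

section

variable (k : Type*) [Field k] {e : ℕ} (i₀ : Fin n → ZMod e)

/-- The relations of the Lusztig extension in the free algebra on the set `H_F ⊔ C`: `H_F` and
`E = ⊕ k ε(i)` are unital algebras, and `x_r ε(i) = ε(i) x_r`, `φ_r ε(i) = ε(σ_r(i)) φ_r`. -/
inductive LusztigRel :
    FreeAlgebra k (HeckeF A k ⊕ Orbit A i₀) → FreeAlgebra k (HeckeF A k ⊕ Orbit A i₀) → Prop
  | scalar (c : k) : LusztigRel (FreeAlgebra.ι k (.inl (algebraMap k (HeckeF A k) c)))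
      (algebraMap k _ c)
  | add (a b : HeckeF A k) : LusztigRel (FreeAlgebra.ι k (.inl (a + b)))
      (FreeAlgebra.ι k (.inl a) + FreeAlgebra.ι k (.inl b))
  | mul (a b : HeckeF A k) : LusztigRel (FreeAlgebra.ι k (.inl (a * b)))
      (FreeAlgebra.ι k (.inl a) * FreeAlgebra.ι k (.inl b))
  | eps_idem (i : Orbit A i₀) :
      LusztigRel (FreeAlgebra.ι k (.inr i) * FreeAlgebra.ι k (.inr i)) (FreeAlgebra.ι k (.inr i))
  | eps_orth (i j : Orbit A i₀) (h : i ≠ j) :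
      LusztigRel (FreeAlgebra.ι k (.inr i) * FreeAlgebra.ι k (.inr j)) 0
  | eps_sum : LusztigRel (∑ i : Orbit A i₀, FreeAlgebra.ι k (.inr i)) 1
  | x_eps (r : Fin n) (i : Orbit A i₀) :
      LusztigRel (FreeAlgebra.ι k (.inl (HeckeF.x A k r)) * FreeAlgebra.ι k (.inr i))
        (FreeAlgebra.ι k (.inr i) * FreeAlgebra.ι k (.inl (HeckeF.x A k r)))
  | phi_eps (r : Fin n) (i : Orbit A i₀) :
      LusztigRel (FreeAlgebra.ι k (.inl (HeckeF.phi A k r)) * FreeAlgebra.ι k (.inr i))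
        (FreeAlgebra.ι k (.inr (i.refl r)) * FreeAlgebra.ι k (.inl (HeckeF.phi A k r)))

/-- The Lusztig extension `L` of `H` with respect to `E`. -/
def Lusztig : Type _ := RingQuot (LusztigRel A k i₀)

namespace Lusztig

instance : Ring (Lusztig A k i₀) := inferInstanceAs (Ring (RingQuot _))
instance : Algebra k (Lusztig A k i₀) := inferInstanceAs (Algebra k (RingQuot _))

/-- The quotient map from the free algebra. -/
def mk : FreeAlgebra k (HeckeF A k ⊕ Orbit A i₀) →ₐ[k] Lusztig A k i₀ := RingQuot.mkAlgHom k _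

/-- The map `H_F → L`. -/
def ofHF (h : HeckeF A k) : Lusztig A k i₀ := mk A k i₀ (FreeAlgebra.ι k (.inl h))

/-- The idempotent `ε(i)`. -/
def eps (i : Orbit A i₀) : Lusztig A k i₀ := mk A k i₀ (FreeAlgebra.ι k (.inr i))

def x (r : Fin n) : Lusztig A k i₀ := ofHF A k i₀ (HeckeF.x A k r)
def t (r : Fin n) : Lusztig A k i₀ := ofHF A k i₀ (HeckeF.t A k r)
def phi (r : Fin n) : Lusztig A k i₀ := ofHF A k i₀ (HeckeF.phi A k r)

variable [CharP k e]

/-- `y_r = ∑_i (x_r - i_r) ε(i)`. -/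
def y (r : Fin n) : Lusztig A k i₀ :=
  ∑ i : Orbit A i₀, (x A k i₀ r - algebraMap k _ (point k i.1 r)) * eps A k i₀ i

/-- The Brundan-Kleshchev auxiliary element `q_r(i)`. -/
def q (r : Fin n) (i : Orbit A i₀) : Lusztig A k i₀ :=
  if i.1 r = 0 then 1 - y A k i₀ r
  else if i.1 r = 1 then (if e = 2 then Ring.inverse (1 - y A k i₀ r) else 1)
  else if i.1 r = -1 then (y A k i₀ r - 2) * Ring.inverse (1 - y A k i₀ r) ^ 2
  else 1 - Ring.inverse (y A k i₀ r + algebraMap k _ (point k i.1 r))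

/-- `θ_r = φ_r ∑_i q_r(i)⁻¹ ε(i)`. -/
def theta (r : Fin n) : Lusztig A k i₀ :=
  phi A k i₀ r * ∑ i : Orbit A i₀, Ring.inverse (q A k i₀ r i) * eps A k i₀ i

/-- `ψ_r = ∑_i (θ_r - δ_{i_r,0} y_r⁻¹) ε(i)`. -/
def psi (r : Fin n) : Lusztig A k i₀ :=
  ∑ i : Orbit A i₀,
    (theta A k i₀ r - if i.1 r = 0 then Ring.inverse (y A k i₀ r) else 0) * eps A k i₀ i

end Lusztig

/-! ### The BK algebra -/

/-- Generators of the BK algebra: `y_r`, `ψ_r`, `ε(i)` and `f⁻¹` for polynomials `f` with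
`f(0) ≠ 0`. -/
inductive BKGen (k : Type*) [Field k] (n : ℕ) (C : Type) : Type _
  | y (r : Fin n)
  | psi (r : Fin n)
  | eps (i : C)
  | inv (f : MvPolynomial (Fin n) k) (hf : MvPolynomial.eval 0 f ≠ 0)

/-- `ψ_r² ε(i) = sqCoeff · ε(i)`. -/
def sqCoeff {R : Type*} [Ring R] {e : ℕ} (y : Fin n → R) (r : Fin n) (i : Fin n → ZMod e) : R :=
  if i r = 0 then 0
  else if i r = 1 then (if e = 2 then -y r ^ 2 else -y r)
  else if i r = -1 then y r
  else 1

/-- Right-hand side of the deformed braid relation for a single edge. -/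
def singleRHS {R : Type*} [Ring R] {e : ℕ} (y : Fin n → R) (r s : Fin n)
    (i : Fin n → ZMod e) : R :=
  if e = 2 then (if i r = 1 ∧ i s = 1 then y r - y s else 0)
  else if i r = 1 ∧ i s = -1 then 1
  else if i r = -1 ∧ i s = 1 then -1
  else 0

/-- Right-hand side of the deformed braid relation for a double edge. -/
def doubleRHS {R : Type*} [Ring R] {e : ℕ} (y psi : Fin n → R) (r s : Fin n)
    (i : Fin n → ZMod e) : R :=
  if e = 2 then (if i r = 0 ∧ i s = 1 then y r * psi r + 1 else 0)
  else if i r = -2 ∧ i s = 1 then psi r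
  else if i r = 2 ∧ i s = -1 then -psi r
  else if i r = 1 ∧ i s = -1 then -2 * psi s
  else if i r = -1 ∧ i s = 1 then 2 * psi s
  else 0

/-- Right-hand side of the deformed braid relation for a triple edge. -/
def tripleRHS {R : Type*} [Ring R] {e : ℕ} (y psi : Fin n → R) (r s : Fin n)
    (i : Fin n → ZMod e) : R :=
  if e = 2 then
    (if i r = 1 ∧ i s = 1 then
      (y r + y s) * (psi r * psi s * psi r) - 3 * (y r + 3 * y s) * (psi s * psi r * psi s)
        - y r ^ 2 + 3 * y s ^ 2
    else 0)
  else if e = 3 then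
    (if i r = 0 ∧ i s = 1 then psi r * psi s * psi r
    else if i r = 0 ∧ i s = -1 then -(psi r * psi s * psi r)
    else if (i r = -2 ∧ i s = 1) ∨ (i r = 2 ∧ i s = -1) then -2 * y r * psi r
    else 0)
  else if i r = -3 ∧ i s = 1 then psi r * psi s * psi r
  else if i r = 3 ∧ i s = -1 then -(psi r * psi s * psi r)
  else if i r = 1 ∧ i s = -1 then -3 * (psi s * psi r * psi s)
  else if i r = -1 ∧ i s = 1 then 3 * (psi s * psi r * psi s)
  else if (i r = -2 ∧ i s = 1) ∨ (i r = 2 ∧ i s = -1) then -2 * y r * psi r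
  else if (i r = 1 ∧ 3 * i s = -2) ∨ (i r = 3 ∧ i s = -2) then -psi s
  else if (i r = -1 ∧ 3 * i s = 2) ∨ (i r = -3 ∧ i s = 2) then psi s
  else 0

/-- The KLR-type relations for elements `y_r`, `ψ_r`, `ε(i)`, `f⁻¹` of a ring. -/
inductive BKRel {R : Type*} [Ring R] [Algebra k R] (y psi : Fin n → R) (eps : Orbit A i₀ → R)
    (inv : (f : MvPolynomial (Fin n) k) → MvPolynomial.eval 0 f ≠ 0 → R) : R → R → Prop
  | eps_idem (i) : BKRel y psi eps inv (eps i * eps i) (eps i)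
  | eps_orth (i j) (h : i ≠ j) : BKRel y psi eps inv (eps i * eps j) 0
  | eps_sum : BKRel y psi eps inv (∑ i, eps i) 1
  | y_eps (r i) : BKRel y psi eps inv (y r * eps i) (eps i * y r)
  | y_comm (r s) : BKRel y psi eps inv (y r * y s) (y s * y r)
  | mul_inv (f hf) : BKRel y psi eps inv (ev y f * inv f hf) 1
  | inv_mul (f hf) : BKRel y psi eps inv (inv f hf * ev y f) 1
  | psi_eps (r) (i : Orbit A i₀) :
      BKRel y psi eps inv (psi r * eps i) (eps (i.refl r) * psi r)
  | psi_y (r s) (i : Orbit A i₀) : BKRel y psi eps inv (psi r * y s * eps i)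
      ((reflect A r y s * psi r + if i.1 r = 0 then ((-A.a s r : ℤ) : R) else 0) * eps i)
  | psi_sq (r) (i : Orbit A i₀) :
      BKRel y psi eps inv (psi r ^ 2 * eps i) (sqCoeff y r i.1 * eps i)
  | psi_comm (r s) (h : A.a r s = 0) : BKRel y psi eps inv (psi r * psi s) (psi s * psi r)
  | psi_single (r s) (h : A.Single r s) (i : Orbit A i₀) : BKRel y psi eps inv
      ((psi r * psi s * psi r - psi s * psi r * psi s) * eps i) (singleRHS y r s i.1 * eps i)
  | psi_double (r s) (h : A.Double r s) (i : Orbit A i₀) : BKRel y psi eps inv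
      (((psi r * psi s) ^ 2 - (psi s * psi r) ^ 2) * eps i) (doubleRHS y psi r s i.1 * eps i)
  | psi_triple (r s) (h : A.Triple r s) (i : Orbit A i₀) : BKRel y psi eps inv
      (((psi r * psi s) ^ 3 - (psi s * psi r) ^ 3) * eps i) (tripleRHS y psi r s i.1 * eps i)

/-- The BK algebra `L̃`, by generators and relations. -/
def BK : Type _ :=
  RingQuot (BKRel A k i₀ (fun r => FreeAlgebra.ι k (BKGen.y (k := k) (C := Orbit A i₀) r))
    (fun r => FreeAlgebra.ι k (BKGen.psi r)) (fun i => FreeAlgebra.ι k (BKGen.eps i))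
    (fun f hf => FreeAlgebra.ι k (BKGen.inv f hf)))

namespace BK

instance : Ring (BK A k i₀) := inferInstanceAs (Ring (RingQuot _))
instance : Algebra k (BK A k i₀) := inferInstanceAs (Algebra k (RingQuot _))

/-- The quotient map from the free algebra. -/
def mk : FreeAlgebra k (BKGen k n (Orbit A i₀)) →ₐ[k] BK A k i₀ := RingQuot.mkAlgHom k _

def y (r : Fin n) : BK A k i₀ := mk A k i₀ (FreeAlgebra.ι k (BKGen.y r))
def psi (r : Fin n) : BK A k i₀ := mk A k i₀ (FreeAlgebra.ι k (BKGen.psi r))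
def eps (i : Orbit A i₀) : BK A k i₀ := mk A k i₀ (FreeAlgebra.ι k (BKGen.eps i))
def inv (f : MvPolynomial (Fin n) k) (hf : MvPolynomial.eval 0 f ≠ 0) : BK A k i₀ :=
  mk A k i₀ (FreeAlgebra.ι k (BKGen.inv f hf))

end BK

/-! ### The algebra with the Hecke-type presentation -/

section

variable [CharP k e]

/-- Generators: `x_r`, `t_r` and `f⁻¹(x)ε(i)` for `i` in the orbit and polynomials `f` with
`f(i) ≠ 0`. -/
inductive HTGen : Type _
  | x (r : Fin n)
  | t (r : Fin n)
  | inv (i : Orbit A i₀) (f : MvPolynomial (Fin n) k)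
      (hf : MvPolynomial.eval (point k i.1) f ≠ 0)

variable {A k i₀} in
/-- `ε(i)` is the generator `1⁻¹ε(i)`. -/
def epsOf {R : Type*}
    (inv : (i : Orbit A i₀) → (f : MvPolynomial (Fin n) k) →
      MvPolynomial.eval (point k i.1) f ≠ 0 → R) (i : Orbit A i₀) : R :=
  inv i 1 (by simp)

/-- The Hecke-type relations for elements `x_r`, `t_r`, `f⁻¹(x)ε(i)` of a ring. If `i_r = 0` then
`σ_r(i) = i` and the last two terms of
`t_r ε(i) = ε(σ_r(i)) t_r + x_r⁻¹ε(σ_r(i)) - x_r⁻¹ε(i)` cancel. -/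
inductive HTRel {R : Type*} [Ring R] [Algebra k R] (x t : Fin n → R)
    (inv : (i : Orbit A i₀) → (f : MvPolynomial (Fin n) k) →
      MvPolynomial.eval (point k i.1) f ≠ 0 → R) : R → R → Prop
  | hecke (a b) (h : HeckeRel A x t a b) : HTRel x t inv a b
  | eps_idem (i) : HTRel x t inv (epsOf inv i * epsOf inv i) (epsOf inv i)
  | eps_orth (i j) (h : i ≠ j) : HTRel x t inv (epsOf inv i * epsOf inv j) 0
  | eps_sum : HTRel x t inv (∑ i, epsOf inv i) 1
  | x_eps (r i) : HTRel x t inv (x r * epsOf inv i) (epsOf inv i * x r)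
  | t_eps_zero (r) (i : Orbit A i₀) (h : i.1 r = 0) :
      HTRel x t inv (t r * epsOf inv i) (epsOf inv (i.refl r) * t r)
  | t_eps (r) (i : Orbit A i₀) (h : i.1 r ≠ 0)
      (hi : MvPolynomial.eval (point k i.1) (MvPolynomial.X r) ≠ 0)
      (hj : MvPolynomial.eval (point k (i.refl r).1) (MvPolynomial.X r) ≠ 0) :
      HTRel x t inv (t r * epsOf inv i)
        (epsOf inv (i.refl r) * t r + inv (i.refl r) (MvPolynomial.X r) hj
          - inv i (MvPolynomial.X r) hi)
  | eps_inv_self (i f hf) : HTRel x t inv (epsOf inv i * inv i f hf) (inv i f hf)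
  | eps_inv_ne (i j f hf) (h : j ≠ i) : HTRel x t inv (epsOf inv j * inv i f hf) 0
  | inv_eps_self (i f hf) : HTRel x t inv (inv i f hf * epsOf inv i) (inv i f hf)
  | inv_eps_ne (i j f hf) (h : j ≠ i) : HTRel x t inv (inv i f hf * epsOf inv j) 0
  | mul_inv (i f hf) : HTRel x t inv (ev x f * inv i f hf) (epsOf inv i)
  | inv_mul (i f hf) : HTRel x t inv (inv i f hf * ev x f) (epsOf inv i)

/-- The algebra with the Hecke-type generators and relations. -/
def HT : Type _ :=
  RingQuot (HTRel A k i₀ (fun r => FreeAlgebra.ι k (HTGen.x (k := k) (i₀ := i₀) (A := A) r))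
    (fun r => FreeAlgebra.ι k (HTGen.t r)) (fun i f hf => FreeAlgebra.ι k (HTGen.inv i f hf)))

namespace HT

instance : Ring (HT A k i₀) := inferInstanceAs (Ring (RingQuot _))
instance : Algebra k (HT A k i₀) := inferInstanceAs (Algebra k (RingQuot _))

/-- The quotient map from the free algebra. -/
def mk : FreeAlgebra k (HTGen A k i₀) →ₐ[k] HT A k i₀ := RingQuot.mkAlgHom k _

def x (r : Fin n) : HT A k i₀ := mk A k i₀ (FreeAlgebra.ι k (HTGen.x r))
def t (r : Fin n) : HT A k i₀ := mk A k i₀ (FreeAlgebra.ι k (HTGen.t r))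
def inv (i : Orbit A i₀) (f : MvPolynomial (Fin n) k)
    (hf : MvPolynomial.eval (point k i.1) f ≠ 0) : HT A k i₀ :=
  mk A k i₀ (FreeAlgebra.ι k (HTGen.inv i f hf))

end HT

end

end

end DegBK

end

/-! Let K be the field of rational functions in the x_r. Everything is compared inside one concrete
representation, `Model`: the K-linear operators on the space with basis δ_q, where q = (i, w) runs
over pairs of a tuple in the orbit and a Weyl group element. A pair carries the point w·(x_1, …,
x_n) of K^n. The elements x_r, y_r, ε(i) and fractions of polynomials act diagonally, while t_r, φ_r
and ψ_r act by δ_q ↦ P δ_{σ_r q} + Q δ_q, with P and Q depending only on i_r and on the r-th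
coordinate (`rootOp`). The coordinates of each point are algebraically independent over k, so no
denominator vanishes.

Relations. A braid relation involves only the orbit of δ_q under the dihedral group of σ_r and σ_s,
a cycle of 6, 8 or 12 vectors, and becomes an identity of rational functions in two variables
(`Cycle3`, `Cycle4`, `Cycle6`). The operator ψ_r is a weighted shift where i_r ≠ 0 and has a
diagonal part only where i_r = 0; the corrections in the deformed braid relations come from the
non-simple positive roots of the rank two system that vanish at the tuple.

Faithfulness. In H_F, in the BK algebra and in the algebra with the Hecke-type presentation there is
a commutative subring B which commutes with the τ_r (the t_r or the ψ_r) up to elements of B, and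
the braid relations hold up to shorter words. Matsumoto's argument then writes every element as Σ_w
τ_w c_w with c_w in B and one reduced word for each w (`exists_eq_sum_word`). In the model the τ_w
are triangular with respect to length, hence independent over the diagonal operators
(`eq_zero_of_sum_word`). So such an algebra acts faithfully as soon as B does
(`eq_zero_of_map_mul_diag`); no basis theorem for H is presupposed.

For H_F this works on the vectors over a single tuple. The relations of L bring every element to the
form Σ h_i ε(i), so the bijectivity statement and the faithfulness of L on the model follow
together. Finally t_r = ψ_r q_r + s_r on the model (`tOp_eq`), where q_r, its inverse and s_r are
regular at y = 0 over each tuple. Hence the BK algebra and the Hecke-type algebra have the same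
image (`range_model_eq`), which lies in the image of L, and injectivity converts this into the maps
α and β. -/

noncomputable section

/-! ### Coxeter groups: the exchange property and reduced alternating words. -/

namespace CoxeterSystem

open List

variable {B W : Type*} [Group W] {M : CoxeterMatrix B} (cs : CoxeterSystem M W)

local prefix:100 "s " => cs.simple
local prefix:100 "π " => cs.wordProd
local prefix:100 "ℓ " => cs.length

/-- The word of length `m` that alternates between `i` and `j`, starting with `i`. -/
def altWord (i j : B) : ℕ → List B
  | 0 => []
  | m + 1 => i :: altWord j i m

theorem length_altWord (i j : B) (m : ℕ) : (altWord i j m).length = m := by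
  induction m generalizing i j with
  | zero => rfl
  | succ m ih => simp [altWord, ih]

theorem altWord_eq_reverse (i j : B) (m : ℕ) : altWord i j m = (alternatingWord j i m).reverse := by
  induction m generalizing i j with
  | zero => rfl
  | succ m ih => simp [altWord, alternatingWord, ih]

theorem wordProd_altWord_comm (i j : B) :
    π (altWord i j (M i j)) = π (altWord j i (M i j)) := by
  have h := cs.wordProd_braidWord_eq i j
  rw [altWord_eq_reverse, altWord_eq_reverse, wordProd_reverse, wordProd_reverse]
  rw [braidWord, braidWord, M.symmetric j i] at h
  rw [h]

/-- Makes the inversions of an alternating word explicit: their periodicity in `k` yields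
`signedConj_isLiftable`, and their distinctness for `k < M i j` yields `isReduced_altWord`. -/
theorem leftInvSeq_altWord (i j : B) (m : ℕ) :
    cs.leftInvSeq (altWord i j m) = (range m).map fun k => s i * (s j * s i) ^ k := by
  induction m generalizing i j with
  | zero => rfl
  | succ m ih =>
    rw [altWord, leftInvSeq, ih, range_succ_eq_map, map_cons, map_map, map_map, pow_zero, mul_one]
    congr 1
    apply map_congr_left
    intro k hk
    clear hk
    simp only [Function.comp_apply, MulAut.conj_apply, inv_simple, pow_succ', Nat.succ_eq_add_one]
    rw [mul_assoc, mul_assoc, mul_assoc]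
    congr 2
    have h : s i * (s j * s i) ^ k = (s i * s j) ^ k * s i := by
      induction k with
      | zero => simp
      | succ k ih => rw [pow_succ', pow_succ', mul_assoc, mul_assoc, ← ih]; simp only [mul_assoc]
    rw [h]

open Classical in
/-- The action of `s_i` on pairs of a group element and a parity. -/
def signedConj (i : B) : Equiv.Perm (W × ZMod 2) :=
  Function.Involutive.toPerm
    (fun p => (s i * p.1 * s i, p.2 + if p.1 = s i then 1 else 0)) (by
      rintro ⟨t, c⟩
      have h : s i * t * s i = s i ↔ t = s i := by
        constructor
        · intro h
          have := congrArg (fun x => s i * x * s i) h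
          simpa [mul_assoc] using this
        · rintro rfl; simp
      have h2 : (1 : ZMod 2) + 1 = 0 := by decide
      simp only [h, Prod.mk.injEq]
      refine ⟨by simp [mul_assoc], ?_⟩
      split_ifs
      · rw [add_assoc, h2, add_zero]
      · simp)

open Classical in
theorem signedConj_apply (i : B) (t : W) (c : ZMod 2) :
    cs.signedConj i (t, c) = (s i * t * s i, c + if t = s i then 1 else 0) := rfl

-- Each letter conjugates the group element and flips the parity exactly when it meets the
-- corresponding simple reflection, so the second component counts `t` among the left inversions.
-- The word is reversed because the product of permutations acts with its last factor first.
open Classical in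
theorem prod_signedConj (ω : List B) (t : W) (c : ZMod 2) :
    (ω.reverse.map cs.signedConj).prod (t, c) =
      ((π ω)⁻¹ * t * π ω, c + ((cs.leftInvSeq ω).count t : ℕ)) := by
  induction ω generalizing t c with
  | nil => simp
  | cons i ω ih =>
    rw [reverse_cons, map_append, prod_append, Equiv.Perm.mul_apply, map_cons, map_nil, prod_cons,
      prod_nil, mul_one, signedConj_apply, ih, wordProd_cons, leftInvSeq]
    have h1 : ((cs.leftInvSeq ω).map (MulAut.conj (s i))).count t =
        (cs.leftInvSeq ω).count (s i * t * s i) := by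
      have : t = MulAut.conj (s i) (s i * t * s i) := by simp [mul_assoc]
      conv_lhs => rw [this]
      exact count_map_of_injective _ _ (MulAut.conj (s i)).injective _
    rw [count_cons, h1]
    simp only [Prod.mk.injEq, mul_inv_rev, inv_simple, beq_iff_eq, eq_comm (a := s i)]
    refine ⟨by simp only [mul_assoc], ?_⟩
    rw [Nat.cast_add, add_assoc, add_comm (Nat.cast _)]
    split_ifs <;> simp

/-- The word `(j i)^M` has trivial product, and its inversion sequence runs twice through the same
`M i j` reflections; every reflection thus occurs an even number of times and the parity is
unchanged. -/
theorem signedConj_isLiftable : M.IsLiftable cs.signedConj := by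
  classical
  intro i j
  have key : ∀ m : ℕ, (cs.signedConj i * cs.signedConj j) ^ m =
      ((altWord j i (2 * m)).reverse.map cs.signedConj).prod := by
    intro m
    induction m with
    | zero => rfl
    | succ m ih => simp [mul_add, altWord, pow_succ, ih]
  ext ⟨t, c⟩ : 1
  rw [key, prod_signedConj, leftInvSeq_altWord, Equiv.Perm.one_apply]
  have hrel : (s i * s j) ^ (M i j) = 1 := cs.simple_mul_simple_pow i j
  have hprod : ∀ m, π (altWord j i (2 * m)) = (s j * s i) ^ m := by
    intro m
    induction m with
    | zero => simp [altWord]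
    | succ m ih => simp [mul_add, altWord, wordProd_cons, pow_succ', ih, mul_assoc]
  have h0 : π (altWord j i (2 * M i j)) = 1 := by
    rw [hprod, M.symmetric i j, cs.simple_mul_simple_pow j i]
  rw [h0, two_mul, range_add, map_append, map_map, count_append]
  have h2 : (fun k => s j * (s i * s j) ^ k) ∘ (fun x => M i j + x) =
      fun k => s j * (s i * s j) ^ k := by
    funext k
    simp [pow_add, hrel]
  rw [h2]
  push_cast
  rw [CharTwo.add_self_eq_zero]
  simp

open Classical in
/-- The parity of the number of occurrences of `t` in a left inversion sequence depends only on
the product of the word. -/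
theorem count_leftInvSeq_eq {ω ω' : List B} (h : π ω = π ω') (t : W) :
    (((cs.leftInvSeq ω).count t : ℕ) : ZMod 2) = ((cs.leftInvSeq ω').count t : ℕ) := by
  have key : ∀ ω : List B, cs.lift ⟨cs.signedConj, cs.signedConj_isLiftable⟩ (π ω)⁻¹ (t, 0) =
      ((π ω)⁻¹ * t * π ω, (((cs.leftInvSeq ω).count t : ℕ) : ZMod 2)) := by
    intro ω
    have h1 := cs.prod_signedConj ω t 0
    rw [zero_add] at h1
    rw [← h1, ← wordProd_reverse]
    generalize ω.reverse = ρ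
    congr 1
    induction ρ with
    | nil => simp
    | cons i ρ ih => rw [wordProd_cons, map_mul, ih, cs.lift_apply_simple, map_cons, prod_cons]
  have h1 := key ω
  rw [h, key ω'] at h1
  exact (congrArg Prod.snd h1).symm

/-- The exchange property. -/
theorem exists_eraseIdx_of_isLeftDescent {i : B} {ω : List B} (h : cs.IsLeftDescent (π ω) i) :
    ∃ j < ω.length, s i * π ω = π (ω.eraseIdx j) := by
  classical
  obtain ⟨ω', hω', h'⟩ := cs.exists_isReduced (s i * π ω)
  have hred : cs.IsReduced (i :: ω') := by
    rw [IsReduced, wordProd_cons, ← h', simple_mul_simple_cancel_left, length_cons, ← hω'.eq, ← h']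
    exact (cs.isLeftDescent_iff.1 h).symm
  have hp : π ω = π (i :: ω') := by rw [wordProd_cons, ← h', simple_mul_simple_cancel_left]
  -- The reduced word `i :: ω'` has `s i` exactly once among its inversions. By invariance of the
  -- parity, `s i` is also an inversion of `ω`, and the letter at its position is the one to delete.
  have h1 : (cs.leftInvSeq (i :: ω')).count (s i) = 1 :=
    count_eq_one_of_mem hred.nodup_leftInvSeq (by simp [leftInvSeq])
  have h2 := cs.count_leftInvSeq_eq hp (s i)
  have h3 : s i ∈ cs.leftInvSeq ω := by
    by_contra h3
    rw [h1, count_eq_zero_of_not_mem h3] at h2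
    exact absurd h2 (by decide)
  obtain ⟨j, hj, hj'⟩ := mem_iff_getElem.1 h3
  refine ⟨j, by simpa using hj, ?_⟩
  rw [← getD_leftInvSeq_mul_wordProd, getD_eq_getElem _ 1 hj, hj']

/-- A word with pairwise distinct left inversions is reduced. -/
theorem isReduced_of_nodup_leftInvSeq {ω : List B} (h : (cs.leftInvSeq ω).Nodup) :
    cs.IsReduced ω := by
  classical
  obtain ⟨ω', hω', h'⟩ := cs.exists_isReduced (π ω)
  refine le_antisymm (cs.length_wordProd_le ω) ?_
  -- A multiplicity one is odd, so each inversion of `ω` also occurs for the reduced word `ω'`;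
  -- being distinct, they number at most the length of `ω'`.
  have hsub : cs.leftInvSeq ω ⊆ cs.leftInvSeq ω' := by
    intro t ht
    have h1 := cs.count_leftInvSeq_eq h' t
    rw [count_eq_one_of_mem h ht] at h1
    by_contra h3
    rw [count_eq_zero_of_not_mem h3] at h1
    exact absurd h1 (by decide)
  have := (h.subperm hsub).length_le
  rw [length_leftInvSeq, length_leftInvSeq] at this
  rw [h', hω'.eq]
  exact this

/-- The order of `s_i s_j` is finite and exactly `M i j` whenever `i ≠ j`. -/
def HasExactOrders : Prop :=
  ∀ i j, i ≠ j → M i j ≠ 0 ∧ ∀ d, 0 < d → d < M i j → (s i * s j) ^ d ≠ 1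

variable {cs}

/-- Two equal inversions at positions `x < y` would give a relation `(s j * s i) ^ (y - x) = 1` with
exponent below the exact order. -/
theorem HasExactOrders.isReduced_altWord (hM : cs.HasExactOrders) {i j : B} (hij : i ≠ j)
    {m : ℕ} (hm : m ≤ M i j) : cs.IsReduced (altWord i j m) := by
  apply isReduced_of_nodup_leftInvSeq
  rw [leftInvSeq_altWord]
  refine (nodup_range).map_on ?_
  have key : ∀ x y, x < y → y < m → s i * (s j * s i) ^ x ≠ s i * (s j * s i) ^ y := by
    intro x y hxy hy h
    obtain ⟨d, rfl⟩ := Nat.exists_eq_add_of_lt hxy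
    rw [add_assoc, pow_add, mul_right_inj, eq_comm, mul_eq_left] at h
    exact (hM j i hij.symm).2 (d + 1) (by omega) (by rw [M.symmetric]; omega) h
  intro x hx y hy h
  rw [mem_range] at hx hy
  rcases lt_trichotomy x y with hl | hl | hl
  · exact absurd h (key x y hl hy)
  · exact hl
  · exact absurd h.symm (key y x hl hx)

/-- If `i` and `j` are left descents of `w`, then `w` has a reduced word starting with the
alternating word of length `M i j` in `i` and `j`. -/
theorem HasExactOrders.exists_altWord_append (hM : cs.HasExactOrders)
    {w : W} {i j : B} (hij : i ≠ j) (hi : cs.IsLeftDescent w i) (hj : cs.IsLeftDescent w j) :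
    ∃ δ : List B, cs.IsReduced (altWord i j (M i j) ++ δ) ∧ π (altWord i j (M i j) ++ δ) = w ∧
      cs.IsReduced (altWord j i (M i j) ++ δ) ∧ π (altWord j i (M i j) ++ δ) = w := by
  -- Grow the alternating prefix one letter at a time: the letter to be prepended is a left descent
  -- of `w`, so the exchange property removes a letter elsewhere and the length stays the same.
  have step : ∀ m ≤ M i j, ∃ a b : B, (a = i ∧ b = j ∨ a = j ∧ b = i) ∧
      ∃ δ, cs.IsReduced (altWord a b m ++ δ) ∧ π (altWord a b m ++ δ) = w := by
    intro m
    induction m with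
    | zero =>
      intro _
      obtain ⟨ω, h1, h2⟩ := cs.exists_isReduced w
      exact ⟨i, j, Or.inl ⟨rfl, rfl⟩, ω, h1, h2.symm⟩
    | succ m ih =>
      intro hm
      obtain ⟨a, b, hab, δ, h1, h2⟩ := ih (by omega)
      have hb : cs.IsLeftDescent (π (altWord a b m ++ δ)) b := by
        rw [h2]; rcases hab with ⟨rfl, rfl⟩ | ⟨rfl, rfl⟩ <;> assumption
      have hne : b ≠ a := by rcases hab with ⟨rfl, rfl⟩ | ⟨rfl, rfl⟩ <;> [exact hij.symm; exact hij]
      have hMab : M b a = M i j := by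
        rcases hab with ⟨rfl, rfl⟩ | ⟨rfl, rfl⟩ <;> [exact M.symmetric _ _; rfl]
      obtain ⟨p, hp, hp'⟩ := cs.exists_eraseIdx_of_isLeftDescent hb
      have hlen : ℓ w = m + δ.length := by rw [← h2, h1.eq, length_append, length_altWord]
      refine ⟨b, a, by tauto, ?_⟩
      -- The removed letter cannot lie in the alternating prefix: the alternating word of length `m
      -- + 1` is reduced, but its product would be that of `m - 1` letters.
      by_cases hpm : p < m
      · exfalso
        rw [eraseIdx_append_of_lt_length (by rwa [length_altWord]), wordProd_append,
          wordProd_append, ← mul_assoc, mul_left_inj, ← wordProd_cons] at hp'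
        have h3 := (hM.isReduced_altWord hne (m := m + 1) (by omega)).eq
        rw [altWord, hp'] at h3
        have h4 := cs.length_wordProd_le ((altWord a b m).eraseIdx p)
        rw [h3, length_cons, length_altWord, length_eraseIdx_of_lt (by rwa [length_altWord]),
          length_altWord] at h4
        omega
      · rw [eraseIdx_append_of_length_le (by rw [length_altWord]; omega)] at hp'
        rw [length_append, length_altWord] at hp
        set δ' := δ.eraseIdx (p - (altWord a b m).length) with hδ'
        have hl : δ'.length + 1 = δ.length :=
          length_eraseIdx_add_one (by rw [length_altWord]; omega)
        have hw : π (altWord b a (m + 1) ++ δ') = w := by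
          rw [altWord, cons_append, wordProd_cons, ← hp', simple_mul_simple_cancel_left, h2]
        refine ⟨δ', ?_, hw⟩
        rw [IsReduced, hw, hlen, length_append, length_altWord]
        omega
  obtain ⟨a, b, hab, δ, h1, h2⟩ := step _ le_rfl
  have hc := cs.wordProd_altWord_comm i j
  have h3 : ℓ w = M i j + δ.length := by rw [← h2, h1.eq, length_append, length_altWord]
  refine ⟨δ, ?_⟩
  have e1 : π (altWord i j (M i j) ++ δ) = w := by
    rcases hab with ⟨rfl, rfl⟩ | ⟨rfl, rfl⟩
    · exact h2
    · rw [wordProd_append, hc, ← wordProd_append, h2]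
  have e2 : π (altWord j i (M i j) ++ δ) = w := by
    rw [wordProd_append, ← hc, ← wordProd_append, e1]
  refine ⟨?_, e1, ?_, e2⟩
  · rw [IsReduced, e1, h3, length_append, length_altWord]
  · rw [IsReduced, e2, h3, length_append, length_altWord]

end CoxeterSystem

end

/-! ### Spanning by reduced words over a subring, with braid relations that hold up to shorter
words. -/

noncomputable section

namespace CoxeterSystem

open List

section Spanning

variable {I W : Type*} [Group W] {M : CoxeterMatrix I} {cs : CoxeterSystem M W}
variable {R : Type*} [Ring R] (B : Subring R) (τ : I → R)

local prefix:100 "π " => cs.wordProd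

/-- The right `B`-span of the products of fewer than `l` elements `τ_i`. -/
def wordSpan (l : ℕ) : AddSubgroup R :=
  AddSubgroup.closure {x | ∃ ω : List I, ω.length < l ∧ ∃ b ∈ B, x = (ω.map τ).prod * b}

variable {B τ}

theorem word_mul_mem {ω : List I} {l : ℕ} (h : ω.length < l) {b : R} (hb : b ∈ B) :
    (ω.map τ).prod * b ∈ wordSpan B τ l :=
  AddSubgroup.subset_closure ⟨ω, h, b, hb, rfl⟩

theorem word_mem {ω : List I} {l : ℕ} (h : ω.length < l) : (ω.map τ).prod ∈ wordSpan B τ l := by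
  simpa using word_mul_mem (τ := τ) h B.one_mem

theorem wordSpan_mono {l l' : ℕ} (h : l ≤ l') : wordSpan B τ l ≤ wordSpan B τ l' :=
  AddSubgroup.closure_mono fun _ ⟨ω, hω, b, hb, e⟩ => ⟨ω, hω.trans_le h, b, hb, e⟩

theorem wordSpan_induction {l : ℕ} {p : (x : R) → x ∈ wordSpan B τ l → Prop}
    (word : ∀ (ω : List I) (h : ω.length < l), ∀ (b : R) (hb : b ∈ B),
      p ((ω.map τ).prod * b) (word_mul_mem h hb))
    (zero : p 0 (zero_mem _))
    (add : ∀ x y hx hy, p x hx → p y hy → p (x + y) (add_mem hx hy))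
    (neg : ∀ x hx, p x hx → p (-x) (neg_mem hx)) {x : R} (hx : x ∈ wordSpan B τ l) : p x hx := by
  induction hx using AddSubgroup.closure_induction with
  | mem x hx => obtain ⟨ω, h, b, hb, rfl⟩ := hx; exact word ω h b hb
  | zero => exact zero
  | add x y _ _ hx hy => exact add x y _ _ hx hy
  | neg x _ hx => exact neg x _ hx

theorem wordSpan_mul_right {l : ℕ} {x b : R} (hx : x ∈ wordSpan B τ l) (hb : b ∈ B) :
    x * b ∈ wordSpan B τ l := by
  induction hx using wordSpan_induction with
  | word ω h c hc => rw [mul_assoc]; exact word_mul_mem h (B.mul_mem hc hb)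
  | zero => simp
  | add x y _ _ hx hy => rw [add_mul]; exact add_mem hx hy
  | neg x _ hx => rw [neg_mul]; exact neg_mem hx

theorem word_mul_wordSpan {l : ℕ} {x : R} (ω : List I) (hx : x ∈ wordSpan B τ l) :
    (ω.map τ).prod * x ∈ wordSpan B τ (ω.length + l) := by
  induction hx using wordSpan_induction with
  | word ω' h c hc =>
    rw [← mul_assoc, ← prod_append, ← map_append]
    exact word_mul_mem (by rw [length_append]; omega) hc
  | zero => simp
  | add x y _ _ hx hy => rw [mul_add]; exact add_mem hx hy
  | neg x _ hx => rw [mul_neg]; exact neg_mem hx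

variable (B τ) in
/-- The commutation of elements of `B` past the `τ_i`, up to elements of `B`. -/
def Normalizes : Prop := ∀ i, ∀ b ∈ B, ∃ b' ∈ B, ∃ b'' ∈ B, b * τ i = τ i * b' + b''

/-- Moving `b` to the right past one `τ i` either keeps that letter or drops it, so the number of
letters never grows. -/
theorem Normalizes.mul_wordSpan (h1 : Normalizes B τ) {l : ℕ} {x b : R} (hb : b ∈ B)
    (hx : x ∈ wordSpan B τ l) : b * x ∈ wordSpan B τ l := by
  have key : ∀ (ω : List I), ∀ b ∈ B, b * (ω.map τ).prod ∈ wordSpan B τ (ω.length + 1) := by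
    intro ω
    induction ω with
    | nil =>
      intro b hb
      simpa using word_mul_mem (τ := τ) (ω := []) (l := 1) (by simp) hb
    | cons i ω ih =>
      intro b hb
      obtain ⟨b', hb', b'', hb'', e⟩ := h1 i b hb
      rw [map_cons, prod_cons, ← mul_assoc, e, add_mul, mul_assoc]
      refine add_mem ?_ (wordSpan_mono (by simp) (ih b'' hb''))
      have := word_mul_wordSpan [i] (ih b' hb')
      simpa [add_comm, add_left_comm] using this
  induction hx using wordSpan_induction with
  | word ω h c hc =>
    rw [← mul_assoc]
    exact wordSpan_mul_right (wordSpan_mono (by omega) (key ω b hb)) hc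
  | zero => simp
  | add x y _ _ hx hy => rw [mul_add]; exact add_mem hx hy
  | neg x _ hx => rw [mul_neg]; exact neg_mem hx

theorem Normalizes.wordSpan_mul_word (h1 : Normalizes B τ) {l : ℕ} {x : R}
    (hx : x ∈ wordSpan B τ l) (ω : List I) : x * (ω.map τ).prod ∈ wordSpan B τ (l + ω.length) := by
  induction hx using wordSpan_induction with
  | word ω' h c hc =>
    rw [mul_assoc]
    exact wordSpan_mono (by omega) (word_mul_wordSpan ω'
      (h1.mul_wordSpan hc (word_mem (l := ω.length + 1) (by omega))))
  | zero => simp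
  | add x y _ _ hx hy => rw [add_mul]; exact add_mem hx hy
  | neg x _ hx => rw [neg_mul]; exact neg_mem hx

theorem Normalizes.mul_mem_wordSpan (h1 : Normalizes B τ) {p q : ℕ} {x y : R}
    (hx : x ∈ wordSpan B τ p) (hy : y ∈ wordSpan B τ q) : x * y ∈ wordSpan B τ (p + q) := by
  induction hx using wordSpan_induction with
  | word ω h c hc =>
    rw [mul_assoc]
    exact wordSpan_mono (by omega) (word_mul_wordSpan ω (h1.mul_wordSpan hc hy))
  | zero => simp
  | add x y _ _ hx hy => rw [add_mul]; exact add_mem hx hy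
  | neg x _ hx => rw [neg_mul]; exact neg_mem hx

variable (B τ) in
/-- The braid relations hold up to combinations of shorter words. -/
def BraidModLower : Prop := ∀ i j, i ≠ j →
  ((altWord i j (M i j)).map τ).prod - ((altWord j i (M i j)).map τ).prod ∈ wordSpan B τ (M i j)

/-- Two reduced words with the same product give the same product of the `τ_i` up to
combinations of shorter words. -/
theorem sub_mem_wordSpan_of_isReduced (hM : cs.HasExactOrders) (h1 : Normalizes B τ)
    (h3 : BraidModLower (M := M) B τ) {ω ω' : List I} (hω : cs.IsReduced ω)
    (hω' : cs.IsReduced ω') (h : π ω = π ω') :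
    (ω.map τ).prod - (ω'.map τ).prod ∈ wordSpan B τ ω.length := by
  induction hl : ω.length using Nat.strong_induction_on generalizing ω ω' with
  | _ l ih =>
    have hl' : ω'.length = l := by rw [← hl, ← hω.eq, ← hω'.eq, h]
    -- A common first letter can be cancelled, which is where the induction on the length enters.
    have same : ∀ (i : I) (α β : List I), cs.IsReduced (i :: α) → cs.IsReduced (i :: β) →
        (i :: α).length = l → π (i :: α) = π (i :: β) →
        ((i :: α).map τ).prod - ((i :: β).map τ).prod ∈ wordSpan B τ l := by
      intro i α β hα hβ hl hp
      rw [wordProd_cons, wordProd_cons, mul_right_inj] at hp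
      have := ih α.length (by rw [← hl]; simp) (by simpa using hα.drop 1) (by simpa using hβ.drop 1)
        hp rfl
      have h2 := word_mul_wordSpan [i] this
      rw [← hl, map_cons, map_cons, prod_cons, prod_cons, ← mul_sub]
      simpa [add_comm] using h2
    match ω, ω' with
    | [], [] => simp
    | [], j :: β => simp at hl hl'; omega
    | i :: α, [] => simp at hl hl'; omega
    | i :: α, j :: β =>
      by_cases hij : i = j
      · subst hij
        exact same i α β hω hω' hl h
      · have di : cs.IsLeftDescent (π (i :: α)) i := by
          rw [IsLeftDescent, hω.eq, wordProd_cons, simple_mul_simple_cancel_left]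
          exact (cs.length_wordProd_le α).trans_lt (by simp)
        have dj : cs.IsLeftDescent (π (i :: α)) j := by
          rw [h, IsLeftDescent, hω'.eq, wordProd_cons, simple_mul_simple_cancel_left]
          exact (cs.length_wordProd_le β).trans_lt (by simp)
        -- Matsumoto's trick: for different first letters, pass through two reduced words of the
        -- same element that begin with the two alternating words and agree afterwards. The outer
        -- two comparisons have a common first letter and the middle one is a braid relation.
        obtain ⟨δ, r1, p1, r2, p2⟩ := hM.exists_altWord_append hij di dj
        have hlδ : M i j + δ.length = l := by
          rw [← hl, ← hω.eq, ← p1, r1.eq, length_append, length_altWord]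
        have hM0 : M i j ≠ 0 := (hM i j hij).1
        obtain ⟨m, hm⟩ := Nat.exists_eq_succ_of_ne_zero hM0
        have e1 : altWord i j (M i j) ++ δ = i :: (altWord j i m ++ δ) := by rw [hm]; rfl
        have e2 : altWord j i (M i j) ++ δ = j :: (altWord i j m ++ δ) := by rw [hm]; rfl
        have t1 := same i α _ hω (e1 ▸ r1) hl (by rw [← e1, p1])
        have t3 := same j _ β (e2 ▸ r2) hω' (by rw [← e2]; simp [length_altWord, hlδ])
          (by rw [← e2, p2, h])
        have t2 := h1.wordSpan_mul_word (h3 i j hij) δ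
        rw [sub_mul, ← prod_append, ← prod_append, ← map_append, ← map_append, hlδ, e1, e2] at t2
        convert add_mem (add_mem t1 t2) t3 using 1
        abel

/-- A word that is not reduced is a combination of shorter words. -/
theorem mem_wordSpan_of_not_isReduced (hM : cs.HasExactOrders) (h1 : Normalizes B τ)
    (h2 : ∀ i, ∃ b ∈ B, ∃ b' ∈ B, τ i * τ i = τ i * b + b')
    (h3 : BraidModLower (M := M) B τ) {ω : List I} (hω : ¬ cs.IsReduced ω) :
    (ω.map τ).prod ∈ wordSpan B τ ω.length := by
  induction ω with
  | nil => exact absurd (by simp [IsReduced]) hω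
  | cons i ω ih =>
    rw [map_cons, prod_cons, length_cons]
    by_cases hr : cs.IsReduced ω
    · have hd : cs.IsLeftDescent (π ω) i := by
        by_contra hd
        apply hω
        rw [IsReduced, wordProd_cons, cs.not_isLeftDescent_iff.1 hd, hr.eq, length_cons]
      obtain ⟨ρ, hρ, hρ'⟩ := cs.exists_isReduced (cs.simple i * π ω)
      have hp : π ω = π (i :: ρ) := by rw [wordProd_cons, ← hρ', simple_mul_simple_cancel_left]
      have hlen : ω.length = ρ.length + 1 := by
        rw [← hr.eq, ← hρ.eq, ← hρ', cs.isLeftDescent_iff.1 hd]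
      have hred : cs.IsReduced (i :: ρ) := by
        rw [IsReduced, ← hp, hr.eq, hlen, length_cons]
      -- The tail may be replaced by a reduced word starting with `i`, up to shorter words; the
      -- resulting square of `τ i` is then lowered by the quadratic relation.
      have key := word_mul_wordSpan [i] (sub_mem_wordSpan_of_isReduced hM h1 h3 hr hred hp)
      obtain ⟨b, hb, b', hb', e⟩ := h2 i
      have hρspan : (ρ.map τ).prod ∈ wordSpan B τ (ρ.length + 1) := word_mem (by omega)
      have key2 : τ i * ((i :: ρ).map τ).prod ∈ wordSpan B τ (ω.length + 1) := by
        rw [map_cons, prod_cons, ← mul_assoc, e, add_mul, mul_assoc]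
        refine add_mem ?_ (wordSpan_mono (by omega) (h1.mul_wordSpan hb' hρspan))
        have := word_mul_wordSpan [i] (h1.mul_wordSpan hb hρspan)
        rw [hlen]
        simpa [add_comm] using this
      have := add_mem (by simpa [add_comm, mul_sub] using key) key2
      simpa using this
    · have := word_mul_wordSpan [i] (ih hr)
      simpa [add_comm] using this

/-- If `B` and the `τ_i` generate `R`, then `R` is the sum of the `τ_ŵ B`, where `ŵ` runs over
chosen reduced words of the elements of `W`. -/
theorem exists_eq_sum_word [Fintype W] (hM : cs.HasExactOrders) (h1 : Normalizes B τ)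
    (h2 : ∀ i, ∃ b ∈ B, ∃ b' ∈ B, τ i * τ i = τ i * b + b')
    (h3 : BraidModLower (M := M) B τ) (h4 : Subring.closure (B ∪ Set.range τ) = ⊤)
    {red : W → List I} (hred : ∀ w, cs.IsReduced (red w) ∧ π (red w) = w) (a : R) :
    ∃ c : W → R, (∀ w, c w ∈ B) ∧ a = ∑ w, ((red w).map τ).prod * c w := by
  classical
  have hspan : ∃ l, a ∈ wordSpan B τ l := by
    have ha : a ∈ Subring.closure (B ∪ Set.range τ) := by rw [h4]; trivial
    induction ha using Subring.closure_induction with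
    | mem x hx =>
      rcases hx with hx | ⟨i, rfl⟩
      · exact ⟨1, by simpa using word_mul_mem (τ := τ) (ω := []) (l := 1) (by simp) hx⟩
      · exact ⟨2, by simpa using word_mem (B := B) (τ := τ) (ω := [i]) (l := 2) (by simp)⟩
    | zero => exact ⟨0, zero_mem _⟩
    | one => exact ⟨1, by simpa using word_mem (B := B) (τ := τ) (ω := []) (l := 1) (by simp)⟩
    | add x y _ _ hx hy =>
      obtain ⟨l, hl⟩ := hx
      obtain ⟨m, hm⟩ := hy
      exact ⟨max l m, add_mem (wordSpan_mono (le_max_left _ _) hl)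
        (wordSpan_mono (le_max_right _ _) hm)⟩
    | neg x _ hx => obtain ⟨l, hl⟩ := hx; exact ⟨l, neg_mem hl⟩
    | mul x y _ _ hx hy =>
      obtain ⟨l, hl⟩ := hx
      obtain ⟨m, hm⟩ := hy
      exact ⟨l + m, h1.mul_mem_wordSpan hl hm⟩
  obtain ⟨l, hl⟩ := hspan
  -- Induction on the bound for the word lengths: longest words are exchanged for the chosen reduced
  -- words or, if not reduced, disappear, and only shorter words remain.
  induction l generalizing a with
  | zero =>
    refine ⟨0, fun _ => zero_mem _, ?_⟩
    induction hl using wordSpan_induction with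
    | word ω h => simp at h
    | zero => simp
    | add x y _ _ hx hy => simp_all
    | neg x _ hx => simp_all
  | succ l ih =>
    induction hl using wordSpan_induction with
    | word ω h b hb =>
      by_cases hlt : ω.length < l
      · exact ih _ (word_mul_mem hlt hb)
      have hlen : ω.length = l := by omega
      by_cases hr : cs.IsReduced ω
      · have h5 := sub_mem_wordSpan_of_isReduced hM h1 h3 hr (hred (π ω)).1 (hred (π ω)).2.symm
        obtain ⟨c, hc, e⟩ := ih _ (hlen ▸ wordSpan_mul_right h5 hb)
        refine ⟨c + Pi.single (π ω) b, fun w => add_mem (hc w) ?_, ?_⟩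
        · by_cases hw : w = π ω
          · subst hw; simpa using hb
          · simp [hw]
        · have : ∑ w, ((red w).map τ).prod * (Pi.single (π ω) b : W → R) w =
              ((red (π ω)).map τ).prod * b := by
            rw [Finset.sum_eq_single (π ω)]
            · simp
            · intro w _ hw; simp [hw]
            · simp
          simp only [Pi.add_apply, mul_add, Finset.sum_add_distrib, this, ← e, sub_mul]
          abel
      · have h5 := mem_wordSpan_of_not_isReduced hM h1 h2 h3 hr
        exact ih _ (hlen ▸ wordSpan_mul_right h5 hb)
    | zero => exact ⟨0, fun _ => zero_mem _, by simp⟩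
    | add x y _ _ hx hy =>
      obtain ⟨c, hc, e⟩ := hx
      obtain ⟨d, hd, e'⟩ := hy
      exact ⟨c + d, fun w => add_mem (hc w) (hd w), by
        simp [e, e', mul_add, Finset.sum_add_distrib]⟩
    | neg x _ hx =>
      obtain ⟨c, hc, e⟩ := hx
      exact ⟨-c, fun w => neg_mem (hc w), by simp [e]⟩

end Spanning

end CoxeterSystem

end

noncomputable section

namespace DegBK

open MvPolynomial

variable {n : ℕ} (A : FiniteCartan n)

/-! ### Orders in the Weyl group and the action on polynomials -/

/-- The Weyl group as a Coxeter system. -/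
abbrev FiniteCartan.cs : CoxeterSystem (coxeterMatrixOf A.a) A.W :=
  (coxeterMatrixOf A.a).toCoxeterSystem

theorem FiniteCartan.cases_of_ne {r s : Fin n} (h : r ≠ s) :
    (A.a r s = 0 ∧ A.a s r = 0) ∨ A.Single r s ∨ A.Double r s ∨ A.Double s r ∨
      A.Triple r s ∨ A.Triple s r := by
  have n1 := A.nonpos r s h
  have n2 := A.nonpos s r h.symm
  have z1 := A.zero_symm r s
  have z2 := A.zero_symm s r
  have le := A.prod_le r s h
  unfold FiniteCartan.Single FiniteCartan.Double FiniteCartan.Triple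
  by_cases e1 : A.a r s = 0
  · exact Or.inl ⟨e1, z1 e1⟩
  have e2 : A.a s r ≠ 0 := fun q => e1 (z2 q)
  have l1 : -3 ≤ A.a r s := by
    have : A.a r s ≤ -1 := by omega
    have : A.a s r ≤ -1 := by omega
    nlinarith
  have l2 : -3 ≤ A.a s r := by
    have : A.a r s ≤ -1 := by omega
    have : A.a s r ≤ -1 := by omega
    nlinarith
  generalize A.a r s = p at *
  generalize A.a s r = q at *
  interval_cases p <;> interval_cases q <;> simp_all

theorem coxeterMatrixOf_apply {r s : Fin n} (h : r ≠ s) :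
    coxeterMatrixOf A.a r s = coxeterOrder (A.a r s * A.a s r) := by
  change (if r = s then 1 else coxeterOrder (A.a r s * A.a s r)) = _
  rw [if_neg h]

/-- The action on `ℤ^n` detects the order: only the coordinates `r` and `s` matter, and no power
below the Coxeter order fixes the basis vector at `r`. -/
theorem pow_ne_one_of_lt {r s : Fin n} (h : r ≠ s) {d : ℕ} (h0 : 0 < d)
    (hd : d < coxeterOrder (A.a r s * A.a s r)) :
    (A.cs.simple r * A.cs.simple s) ^ d ≠ 1 := by
  intro hw
  replace hw := congrArg (weylAct A ℤ) hw
  rw [map_pow, map_mul, map_one] at hw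
  have act : ∀ (t : Fin n) (v : Fin n → ℤ) (u : Fin n),
      weylAct A ℤ (A.cs.simple t) v u = v u - A.a u t * v t := by
    intro t v u
    rw [weylAct_simple]
    simp [reflect]
  have key : ∀ v : Fin n → ℤ, (weylAct A ℤ (A.cs.simple r) * weylAct A ℤ (A.cs.simple s)) v r =
      A.a r s * v s - v r ∧
      (weylAct A ℤ (A.cs.simple r) * weylAct A ℤ (A.cs.simple s)) v s =
      -v s - A.a s r * (v r - A.a r s * v s) := by
    intro v
    rw [Equiv.Perm.mul_apply]
    simp only [act, A.diag]
    constructor <;> ring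
  generalize weylAct A ℤ (A.cs.simple r) * weylAct A ℤ (A.cs.simple s) = T at hw key
  have h1 := congrFun (DFunLike.congr_fun hw (Pi.single r 1)) r
  have h2 := congrFun (DFunLike.congr_fun hw (Pi.single r 1)) s
  clear hw act
  rcases A.cases_of_ne h with h' | h' | h' | h' | h' | h' <;>
    obtain ⟨h3, h4⟩ := h' <;>
    simp only [h3, h4] at hd key <;>
    simp only [coxeterOrder] at hd <;>
    norm_num at hd <;>
    interval_cases d <;>
    simp [pow_succ, Equiv.Perm.mul_apply, key, h.symm] at h1 h2

theorem hasExactOrders : A.cs.HasExactOrders := by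
  intro r s h
  rw [coxeterMatrixOf_apply A h]
  refine ⟨?_, fun d h0 hd => pow_ne_one_of_lt A h h0 hd⟩
  rcases A.cases_of_ne h with h | h | h | h | h | h <;> simp [h.1, h.2, coxeterOrder]

variable {A} in
theorem weylAct_mul_simple {V : Type*} [AddCommGroup V] (w : A.W) (r : Fin n) (v : Fin n → V) :
    weylAct A V (w * A.cs.simple r) v = weylAct A V w (reflect A r v) := by
  rw [map_mul, Equiv.Perm.mul_apply, weylAct_simple]

variable {A} in
theorem weylAct_simple_mul {V : Type*} [AddCommGroup V] (w : A.W) (r : Fin n) (v : Fin n → V) :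
    weylAct A V (A.cs.simple r * w) v = reflect A r (weylAct A V w v) := by
  rw [map_mul, Equiv.Perm.mul_apply, weylAct_simple]

theorem reflect_map {V V' : Type*} [AddCommGroup V] [AddCommGroup V'] (f : V →+ V') (r : Fin n)
    (v : Fin n → V) : reflect A r (fun s => f (v s)) = fun s => f (reflect A r v s) := by
  funext s
  simp [reflect]

theorem weylAct_map {V V' : Type*} [AddCommGroup V] [AddCommGroup V'] (f : V →+ V') (w : A.W)
    (v : Fin n → V) : weylAct A V' w (fun s => f (v s)) = fun s => f (weylAct A V w v s) := by
  induction w using A.cs.simple_induction_left with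
  | one => simp
  | mul_simple_left w r ih => rw [weylAct_simple_mul, weylAct_simple_mul, ih, reflect_map]

section Poly

variable (k : Type*) [Field k]

theorem polyRefl_X (r s : Fin n) : polyRefl A k r (X s) = reflect A r X s := by simp [polyRefl]

theorem aeval_reflect {S : Type*} [CommRing S] [Algebra k S] (v : Fin n → S) (r : Fin n)
    (f : MvPolynomial (Fin n) k) : aeval (reflect A r v) f = aeval v (polyRefl A k r f) := by
  have : (aeval (reflect A r v) : MvPolynomial (Fin n) k →ₐ[k] S) =
      (aeval v).comp (polyRefl A k r) := by
    ext s
    simp [polyRefl_X, reflect]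
  rw [this]; rfl

theorem polyRefl_polyRefl (r : Fin n) (f : MvPolynomial (Fin n) k) :
    polyRefl A k r (polyRefl A k r f) = f := by
  have h : ∀ g, polyRefl A k r g = aeval (reflect A r X) g := fun _ => rfl
  rw [h (polyRefl A k r f), ← aeval_reflect, reflect_reflect, aeval_X_left_apply]

theorem polyRefl_injective (r : Fin n) : Function.Injective (polyRefl A k r) :=
  (show Function.Involutive (polyRefl A k r) from polyRefl_polyRefl A k r).injective

theorem aeval_weylAct_injective {S : Type*} [CommRing S] [Algebra k S] {v : Fin n → S}
    (hv : Function.Injective (aeval v : MvPolynomial (Fin n) k →ₐ[k] S)) (w : A.W) :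
    Function.Injective (aeval (weylAct A S w v) : MvPolynomial (Fin n) k →ₐ[k] S) := by
  induction w using A.cs.simple_induction_left with
  | one => simpa using hv
  | mul_simple_left w r ih =>
    rw [weylAct_simple_mul]
    intro f g h
    rw [aeval_reflect, aeval_reflect] at h
    exact polyRefl_injective A k r (ih h)

theorem aeval_weylAct_of_mem_invariants {S : Type*} [CommRing S] [Algebra k S] (v : Fin n → S)
    (w : A.W) {f : MvPolynomial (Fin n) k} (hf : f ∈ invariants A k) :
    aeval (weylAct A S w v) f = aeval v f := by
  induction w using A.cs.simple_induction_left with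
  | one => simp
  | mul_simple_left w r ih =>
    rw [weylAct_simple_mul, aeval_reflect, (mem_invariants A).1 hf r, ih]

/-- The norm of a polynomial: every nonzero polynomial divides a nonzero invariant. -/
theorem exists_mul_mem_invariants {f : MvPolynomial (Fin n) k} (hf : f ≠ 0) :
    ∃ g, f * g ∈ invariants A k ∧ f * g ≠ 0 := by
  classical
  have : Fintype A.W := Fintype.ofFinite _
  -- The conjugates of `f` under the Weyl group; the invariant multiple of `f` is their product, and
  -- `f` itself is the factor at `1`.
  let F : A.W → MvPolynomial (Fin n) k := fun w => aeval (weylAct A _ w X) f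
  have hF1 : F 1 = f := by simp [F]
  have hF0 : ∀ w, F w ≠ 0 := by
    intro w h
    refine hf (aeval_weylAct_injective A k (v := X) (fun f g h => by
      rwa [aeval_X_left_apply, aeval_X_left_apply] at h) w ?_)
    rw [map_zero]
    exact h
  have hprod : f * ∏ w ∈ Finset.univ.erase 1, F w = ∏ w, F w := by
    rw [← hF1, Finset.mul_prod_erase _ _ (Finset.mem_univ _)]
  refine ⟨∏ w ∈ Finset.univ.erase 1, F w, ?_, ?_⟩
  · rw [hprod, mem_invariants]
    intro r
    rw [map_prod]
    -- Applying `σ_r` permutes the factors by right translation on the group.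
    have h : ∀ w, polyRefl A k r (F w) = F (w * A.cs.simple r) := by
      intro w
      simp only [F]
      rw [weylAct_mul_simple]
      have := weylAct_map A (polyRefl A k r).toLinearMap.toAddMonoidHom w X
      simp only [LinearMap.toAddMonoidHom_coe, AlgHom.toLinearMap_apply] at this
      rw [show reflect A r X = fun s => polyRefl A k r (X s) from
        funext fun s => (polyRefl_X A k r s).symm, this, ← AlgHom.comp_apply, comp_aeval]
    simp only [h]
    exact Equiv.prod_comp (Equiv.mulRight (A.cs.simple r)) F
  · rw [hprod]
    exact Finset.prod_ne_zero_iff.2 fun w _ => hF0 w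

end Poly

/-! ### The model -/

/-- The field of rational functions. -/
abbrev RatF (k : Type*) [Field k] (n : ℕ) : Type _ := FractionRing (MvPolynomial (Fin n) k)

section Model

variable (k : Type*) [Field k] {e : ℕ} (i₀ : Fin n → ZMod e)

/-- Pairs of a tuple in the orbit and a Weyl group element. -/
abbrev Pt : Type := Orbit A i₀ × A.W

variable {A i₀} in
/-- The action of `σ_r` on pairs. -/
def Pt.refl (r : Fin n) (q : Pt A i₀) : Pt A i₀ := (q.1.refl r, A.cs.simple r * q.2)

variable {A i₀} in
theorem Orbit.refl_refl (r : Fin n) (i : Orbit A i₀) : (i.refl r).refl r = i :=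
  Subtype.ext (reflect_reflect A r i.1)

variable {A i₀} in
@[simp]
theorem Pt.refl_refl (r : Fin n) (q : Pt A i₀) : (q.refl r).refl r = q :=
  Prod.ext (Orbit.refl_refl r q.1) (A.cs.simple_mul_simple_cancel_left r)

/-- The point of `K^n` attached to a pair. -/
def xv (q : Pt A i₀) : Fin n → RatF k n :=
  weylAct A (RatF k n) q.2 fun r => algebraMap (MvPolynomial (Fin n) k) (RatF k n) (X r)

theorem xv_refl (r : Fin n) (q : Pt A i₀) : xv A k i₀ (q.refl r) = reflect A r (xv A k i₀ q) :=
  weylAct_simple_mul _ _ _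

/-- The coordinates of every point of the model are algebraically independent over `k`. All
nonvanishing of denominators rests on this. -/
theorem aeval_xv_injective (q : Pt A i₀) :
    Function.Injective (aeval (xv A k i₀ q) : MvPolynomial (Fin n) k →ₐ[k] RatF k n) := by
  refine aeval_weylAct_injective A k ?_ q.2
  have : (aeval fun r => algebraMap (MvPolynomial (Fin n) k) (RatF k n) (X r)) =
      IsScalarTower.toAlgHom k (MvPolynomial (Fin n) k) (RatF k n) := by
    ext r; simp
  rw [this]
  exact IsFractionRing.injective _ _

theorem aeval_xv_ne_zero (q : Pt A i₀) {f : MvPolynomial (Fin n) k} (hf : f ≠ 0) :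
    aeval (xv A k i₀ q) f ≠ 0 := fun h =>
  hf (aeval_xv_injective A k i₀ q (by rw [h, map_zero]))

/-- The space of finitely supported functions on pairs with values in `K`. -/
abbrev ModelSpace : Type _ := Pt A i₀ →₀ RatF k n

/-- The algebra of `K`-linear operators on the model space. -/
abbrev Model : Type _ := Module.End (RatF k n) (ModelSpace A k i₀)

variable {A i₀} in
/-- Basis vectors. -/
abbrev dl (q : Pt A i₀) : ModelSpace A k i₀ := Finsupp.single q 1

variable {A k i₀}

/-- The operator `δ_q ↦ P(q) δ_{σ_r q} + Q(q) δ_q`. -/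
def stepOp (P Q : Pt A i₀ → RatF k n) (r : Fin n) : Model A k i₀ :=
  Finsupp.linearCombination (RatF k n) fun q => P q • dl k (q.refl r) + Q q • dl k q

@[simp]
theorem stepOp_dl (P Q : Pt A i₀ → RatF k n) (r : Fin n) (q : Pt A i₀) :
    stepOp P Q r (dl k q) = P q • dl k (q.refl r) + Q q • dl k q := by
  simp [stepOp]

theorem model_ext {f g : Model A k i₀} (h : ∀ q, f (dl k q) = g (dl k q)) : f = g :=
  Finsupp.lhom_ext' fun q => LinearMap.ext_ring (h q)

/-- Diagonal operators. -/
def diag : (Pt A i₀ → RatF k n) →ₐ[RatF k n] Model A k i₀ :=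
  AlgHom.ofLinearMap
    { toFun := fun d => Finsupp.linearCombination (RatF k n) fun q => d q • dl k q
      map_add' := fun c d => model_ext fun q => by simp [add_smul]
      map_smul' := fun c d => model_ext fun q => by simp }
    (model_ext fun q => by simp)
    (fun c d => model_ext fun q => by simp [mul_comm])

@[simp]
theorem diag_dl (d : Pt A i₀ → RatF k n) (q : Pt A i₀) : diag d (dl k q) = d q • dl k q := by
  simp [diag]

theorem diag_injective : Function.Injective (diag (A := A) (k := k) (i₀ := i₀)) := by
  intro c d h
  funext q
  have := DFunLike.congr_fun (LinearMap.congr_fun h (dl k q)) q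
  simpa using this

theorem stepOp_apply (P Q : Pt A i₀ → RatF k n) (r : Fin n) (G : ModelSpace A k i₀)
    (q : Pt A i₀) :
    stepOp P Q r G q = P (q.refl r) * G (q.refl r) + Q q * G q := by
  classical
  induction G using Finsupp.induction_linear with
  | zero => simp
  | add f g hf hg => rw [map_add, Finsupp.add_apply, hf, hg]; simp; ring
  | single p c =>
    have : Finsupp.single p c = c • dl k p := by simp
    rw [this, map_smul, stepOp_dl]
    have h : p.refl r = q ↔ p = q.refl r := by
      constructor <;> rintro rfl <;> simp
    simp only [Finsupp.smul_apply, Finsupp.add_apply, Finsupp.single_apply, h, smul_eq_mul]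
    by_cases h1 : p = q.refl r
    · subst h1
      by_cases h2 : q.refl r = q
      · simp only [h2, if_true]; ring
      · simp only [if_true, if_neg h2]; simp [mul_comm]
    · by_cases h2 : p = q
      · subst h2; simp [h1, mul_comm]
      · simp [h1, h2]

theorem list_foldr_refl_snd (ω : List (Fin n)) (p : Pt A i₀) :
    (ω.foldr Pt.refl p).2 = A.cs.wordProd ω * p.2 := by
  induction ω with
  | nil => simp
  | cons r ω ih => simp [Pt.refl, CoxeterSystem.wordProd_cons, ih, mul_assoc]

section Independence

variable {P Q : Fin n → Pt A i₀ → RatF k n}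

/-- Each factor either multiplies the group component by its simple reflection or leaves it alone,
so only products of subwords of `ω` are reached. A proper subword is too short to give an element of
length at least `ω.length`. -/
theorem word_stepOp_apply_eq_zero (ω : List (Fin n)) (p q : Pt A i₀)
    (hl : ω.length ≤ A.cs.length (q.2 * p.2⁻¹)) (hq : q.2 * p.2⁻¹ ≠ A.cs.wordProd ω) :
    (ω.map fun r => stepOp (P r) (Q r) r).prod (dl k p) q = 0 := by
  induction ω generalizing q with
  | nil =>
    have : p ≠ q := by rintro rfl; simp at hq
    simp [this]
  | cons r ω ih =>
    rw [List.map_cons, List.prod_cons, Module.End.mul_apply, stepOp_apply, ih, ih]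
    · simp
    · rw [List.length_cons] at hl; omega
    · intro h
      rw [h, List.length_cons] at hl
      have := A.cs.length_wordProd_le ω
      omega
    · change _ ≤ A.cs.length (A.cs.simple r * q.2 * p.2⁻¹)
      rw [mul_assoc]
      rw [List.length_cons] at hl
      rcases A.cs.length_simple_mul (q.2 * p.2⁻¹) r with h | h <;> omega
    · change A.cs.simple r * q.2 * p.2⁻¹ ≠ _
      intro h
      apply hq
      rw [CoxeterSystem.wordProd_cons, ← h, mul_assoc, A.cs.simple_mul_simple_cancel_left]

/-- At the end point of a reduced word only the path that moves at every letter contributes, so the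
coefficient is a product of values of the `P r`; the diagonal parts drop out by
`word_stepOp_apply_eq_zero`. -/
theorem word_stepOp_apply_ne_zero (hP : ∀ r q, P r q ≠ 0) {ω : List (Fin n)}
    (hω : A.cs.IsReduced ω) (p : Pt A i₀) :
    (ω.map fun r => stepOp (P r) (Q r) r).prod (dl k p) (ω.foldr Pt.refl p) ≠ 0 := by
  induction ω with
  | nil => simp
  | cons r ω ih =>
    have hr : A.cs.IsReduced ω := by simpa using hω.drop 1
    rw [List.map_cons, List.prod_cons, Module.End.mul_apply, stepOp_apply, List.foldr_cons,
      Pt.refl_refl, word_stepOp_apply_eq_zero ω p (Pt.refl r _), mul_zero, add_zero]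
    · exact mul_ne_zero (hP _ _) (ih hr)
    · rw [← List.foldr_cons (f := Pt.refl), list_foldr_refl_snd, mul_inv_cancel_right, hω.eq]
      simp
    · rw [← List.foldr_cons (f := Pt.refl), list_foldr_refl_snd, mul_inv_cancel_right]
      intro h
      have h1 := hω.eq
      rw [h, hr.eq, List.length_cons] at h1
      omega

/-- Products of operators with invertible leading coefficients along reduced words are
independent over the diagonal operators. -/
theorem eq_zero_of_sum_word [Fintype A.W] (hP : ∀ r q, P r q ≠ 0) {red : A.W → List (Fin n)}
    (hred : ∀ w, A.cs.IsReduced (red w) ∧ A.cs.wordProd (red w) = w)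
    {c : A.W → Pt A i₀ → RatF k n}
    (h : ∑ w, ((red w).map fun r => stepOp (P r) (Q r) r).prod * diag (c w) = 0) : c = 0 := by
  classical
  by_contra hc
  have hne : (Finset.univ.filter fun w => c w ≠ 0).Nonempty := by
    obtain ⟨w, hw⟩ := Function.ne_iff.1 hc
    exact ⟨w, by simpa using hw⟩
  -- Triangularity: take `w` of maximal length with nonzero coefficient and read off the component
  -- at `w` times a point where `c w` does not vanish. No other word reaches it.
  obtain ⟨w, hw, hmax⟩ := Finset.exists_max_image _ A.cs.length hne
  obtain ⟨p, hp⟩ := Function.ne_iff.1 (Finset.mem_filter.1 hw).2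
  have h1 := DFunLike.congr_fun (LinearMap.congr_fun h (dl k p)) ((red w).foldr Pt.refl p)
  rw [LinearMap.sum_apply, Finsupp.finsetSum_apply, Finset.sum_eq_single w] at h1
  · rw [Module.End.mul_apply, diag_dl, map_smul, Finsupp.smul_apply, smul_eq_mul] at h1
    exact mul_ne_zero hp (word_stepOp_apply_ne_zero hP (hred w).1 p) h1
  · intro w' _ hw'
    rw [Module.End.mul_apply, diag_dl, map_smul, Finsupp.smul_apply, smul_eq_mul]
    by_cases h0 : c w' = 0
    · simp [h0]
    rw [word_stepOp_apply_eq_zero, mul_zero]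
    · rw [list_foldr_refl_snd, mul_inv_cancel_right, (hred w).2, ← (hred w').1.eq, (hred w').2]
      exact hmax w' (by simpa using h0)
    · rw [list_foldr_refl_snd, mul_inv_cancel_right, (hred w).2, (hred w').2]
      exact hw'.symm
  · simp

end Independence

end Model

end DegBK

end

/-! ### Rank two cycles of vectors and the braid relations of the Hecke operators. -/

noncomputable section

namespace DegBK

section Cycles

variable {K V ι : Type*} [Field K] [AddCommGroup V] [Module K V] [Neg ι]


/-- The actions of two step operators `T`, `S` and of two diagonal operators `D`, `D'` along a
cycle of length `6` of vectors, the coefficients being given by functions `P`, `Q` of the values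
of the roots at a tuple (`a`, `b`, `ab`) and at a point. -/
structure Cycle3 (P Q : ι → K → K) (T S D D' : V →ₗ[K] V) (e : Fin 6 → V)
    (a b ab : ι) (y z : K) : Prop where
  S0 : S (e 0) = P b z • e 5 + Q b z • e 0
  S1 : S (e 1) = P ab (y + z) • e 2 + Q ab (y + z) • e 1
  S4 : S (e 4) = P a y • e 3 + Q a y • e 4
  S5 : S (e 5) = P (-b) (-z) • e 0 + Q (-b) (-z) • e 5
  T0 : T (e 0) = P a y • e 1 + Q a y • e 0
  T1 : T (e 1) = P (-a) (-y) • e 0 + Q (-a) (-y) • e 1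
  T2 : T (e 2) = P b z • e 3 + Q b z • e 2
  T5 : T (e 5) = P ab (y + z) • e 4 + Q ab (y + z) • e 5
  ne_a : y ≠ 0
  ne_b : z ≠ 0
  ne_ab : (y + z) ≠ 0

/-- The actions of two step operators `T`, `S` and of two diagonal operators `D`, `D'` along a
cycle of length `8` of vectors, the coefficients being given by functions `P`, `Q` of the values
of the roots at a tuple (`a`, `b`, `ab`, `a2b`) and at a point. -/
structure Cycle4 (P Q : ι → K → K) (T S D D' : V →ₗ[K] V) (e : Fin 8 → V)
    (a b ab a2b : ι) (y z : K) : Prop where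
  S0 : S (e 0) = P b z • e 7 + Q b z • e 0
  S1 : S (e 1) = P ab (y + z) • e 2 + Q ab (y + z) • e 1
  S2 : S (e 2) = P (-ab) (-(y + z)) • e 1 + Q (-ab) (-(y + z)) • e 2
  S3 : S (e 3) = P b z • e 4 + Q b z • e 3
  S6 : S (e 6) = P ab (y + z) • e 5 + Q ab (y + z) • e 6
  S7 : S (e 7) = P (-b) (-z) • e 0 + Q (-b) (-z) • e 7
  T0 : T (e 0) = P a y • e 1 + Q a y • e 0
  T1 : T (e 1) = P (-a) (-y) • e 0 + Q (-a) (-y) • e 1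
  T2 : T (e 2) = P a2b (y + 2 * z) • e 3 + Q a2b (y + 2 * z) • e 2
  T5 : T (e 5) = P a y • e 4 + Q a y • e 5
  T6 : T (e 6) = P (-a2b) (-(y + 2 * z)) • e 7 + Q (-a2b) (-(y + 2 * z)) • e 6
  T7 : T (e 7) = P a2b (y + 2 * z) • e 6 + Q a2b (y + 2 * z) • e 7
  D0 : D (e 0) = y • e 0
  D1 : D (e 1) = (-y) • e 1
  ne_a : y ≠ 0
  ne_b : z ≠ 0
  ne_ab : (y + z) ≠ 0
  ne_a2b : (y + 2 * z) ≠ 0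

/-- The actions of two step operators `T`, `S` and of two diagonal operators `D`, `D'` along a
cycle of length `12` of vectors, the coefficients being given by functions `P`, `Q` of the values
of the roots at a tuple (`a`, `b`, `ab`, `a2b`, `a3b`, `aab`) and at a point. -/
structure Cycle6 (P Q : ι → K → K) (T S D D' : V →ₗ[K] V) (e : Fin 12 → V)
    (a b ab a2b a3b aab : ι) (y z : K) : Prop where
  S0 : S (e 0) = P b z • e 11 + Q b z • e 0
  S1 : S (e 1) = P ab (y + z) • e 2 + Q ab (y + z) • e 1
  S2 : S (e 2) = P (-ab) (-(y + z)) • e 1 + Q (-ab) (-(y + z)) • e 2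
  S3 : S (e 3) = P a2b (y + 2 * z) • e 4 + Q a2b (y + 2 * z) • e 3
  S4 : S (e 4) = P (-a2b) (-(y + 2 * z)) • e 3 + Q (-a2b) (-(y + 2 * z)) • e 4
  S5 : S (e 5) = P b z • e 6 + Q b z • e 5
  S8 : S (e 8) = P ab (y + z) • e 7 + Q ab (y + z) • e 8
  S9 : S (e 9) = P (-a2b) (-(y + 2 * z)) • e 10 + Q (-a2b) (-(y + 2 * z)) • e 9
  S10 : S (e 10) = P a2b (y + 2 * z) • e 9 + Q a2b (y + 2 * z) • e 10
  S11 : S (e 11) = P (-b) (-z) • e 0 + Q (-b) (-z) • e 11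
  T0 : T (e 0) = P a y • e 1 + Q a y • e 0
  T1 : T (e 1) = P (-a) (-y) • e 0 + Q (-a) (-y) • e 1
  T2 : T (e 2) = P aab (2 * y + 3 * z) • e 3 + Q aab (2 * y + 3 * z) • e 2
  T3 : T (e 3) = P (-aab) (-(2 * y + 3 * z)) • e 2 + Q (-aab) (-(2 * y + 3 * z)) • e 3
  T4 : T (e 4) = P a3b (y + 3 * z) • e 5 + Q a3b (y + 3 * z) • e 4
  T7 : T (e 7) = P a y • e 6 + Q a y • e 7
  T8 : T (e 8) = P (-aab) (-(2 * y + 3 * z)) • e 9 + Q (-aab) (-(2 * y + 3 * z)) • e 8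
  T9 : T (e 9) = P aab (2 * y + 3 * z) • e 8 + Q aab (2 * y + 3 * z) • e 9
  T10 : T (e 10) = P (-a3b) (-(y + 3 * z)) • e 11 + Q (-a3b) (-(y + 3 * z)) • e 10
  T11 : T (e 11) = P a3b (y + 3 * z) • e 10 + Q a3b (y + 3 * z) • e 11
  D0 : D (e 0) = y • e 0
  D'0 : D' (e 0) = z • e 0
  D1 : D (e 1) = (-y) • e 1
  D3 : D (e 3) = (-(2 * y + 3 * z)) • e 3
  D'3 : D' (e 3) = (y + 2 * z) • e 3
  D9 : D (e 9) = (2 * y + 3 * z) • e 9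
  D'9 : D' (e 9) = (-(y + 2 * z)) • e 9
  ne_a : y ≠ 0
  ne_b : z ≠ 0
  ne_ab : (y + z) ≠ 0
  ne_a2b : (y + 2 * z) ≠ 0
  ne_a3b : (y + 3 * z) ≠ 0
  ne_aab : (2 * y + 3 * z) ≠ 0

variable {P Q : ι → K → K} {T S D D' : V →ₗ[K] V}

/-- The vectors `e 0, e 1, …` run around the dihedral orbit of `e 0`, starting with `T` in one
direction and ending with `S` in the other; the middle vector is where both sides of the braid
relation meet. After expansion the relation is a list of identities between rational functions in
`y` and `z`, whose denominators are the positive roots. -/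
theorem Cycle3.hecke {e : Fin 6 → V} {a b ab : ι} {y z : K}
    (h : Cycle3 P Q T S D D' e a b ab y z) (hP : ∀ c Y, P c Y = 1 - Y⁻¹)
    (hQ : ∀ c Y, Q c Y = -Y⁻¹) : T (S (T (e 0))) = S (T (S (e 0))) := by
  have n1 := h.ne_a
  have n2 := h.ne_b
  have n3 := h.ne_ab
  -- The same root written in another order of terms, for denominators in the form that `field_simp`
  -- produces.
  have n3' : z + y ≠ 0 := by rwa [add_comm]
  simp only [h.S0, h.S1, h.S4, h.S5, h.T0, h.T1, h.T2, h.T5, hP, hQ, map_add, map_smul, smul_add, smul_smul, inv_neg]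
  clear h
  match_scalars <;> field_simp <;> ring

theorem Cycle4.hecke {e : Fin 8 → V} {a b ab a2b : ι} {y z : K}
    (h : Cycle4 P Q T S D D' e a b ab a2b y z) (hP : ∀ c Y, P c Y = 1 - Y⁻¹)
    (hQ : ∀ c Y, Q c Y = -Y⁻¹) : T (S (T (S (e 0)))) = S (T (S (T (e 0)))) := by
  have n1 := h.ne_a
  have n2 := h.ne_b
  have n3 := h.ne_ab
  have n4 := h.ne_a2b
  have n3' : z + y ≠ 0 := by rwa [add_comm]
  have n4' : y + z * 2 ≠ 0 := by rwa [mul_comm]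
  have n4'' : z * 2 + y ≠ 0 := by rwa [add_comm]
  simp only [h.S0, h.S1, h.S2, h.S3, h.S6, h.S7, h.T0, h.T1, h.T2, h.T5, h.T6, h.T7, hP, hQ, map_add, map_smul, smul_add, smul_smul, inv_neg]
  clear h
  match_scalars <;> field_simp <;> ring

set_option maxHeartbeats 1600000 in
theorem Cycle6.hecke {e : Fin 12 → V} {a b ab a2b a3b aab : ι} {y z : K}
    (h : Cycle6 P Q T S D D' e a b ab a2b a3b aab y z) (hP : ∀ c Y, P c Y = 1 - Y⁻¹)
    (hQ : ∀ c Y, Q c Y = -Y⁻¹) :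
    T (S (T (S (T (S (e 0)))))) = S (T (S (T (S (T (e 0)))))) := by
  have n1 := h.ne_a
  have n2 := h.ne_b
  have n3 := h.ne_ab
  have n4 := h.ne_a2b
  have n5 := h.ne_a3b
  have n6 := h.ne_aab
  have n3' : z + y ≠ 0 := by rwa [add_comm]
  have n4' : y + z * 2 ≠ 0 := by rwa [mul_comm]
  have n4'' : z * 2 + y ≠ 0 := by rwa [add_comm]
  have n5' : y + z * 3 ≠ 0 := by rwa [mul_comm]
  have n5'' : z * 3 + y ≠ 0 := by rwa [add_comm]
  have n6' : y * 2 + z * 3 ≠ 0 := by rwa [mul_comm, mul_comm z]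
  have n6'' : z * 3 + y * 2 ≠ 0 := by rwa [add_comm]
  simp only [h.S0, h.S1, h.S2, h.S3, h.S4, h.S5, h.S8, h.S9, h.S10, h.S11, h.T0, h.T1, h.T2, h.T3, h.T4, h.T7, h.T8, h.T9, h.T10, h.T11, hP, hQ, map_add, map_smul, smul_add, smul_smul, inv_neg]
  clear h
  match_scalars <;> field_simp <;> ring

end Cycles

end DegBK

end

/-! ### The coefficients of ψ_r and the deformed braid relation for a single edge. -/

noncomputable section

namespace DegBK

set_option linter.unusedSimpArgs false
set_option linter.unusedSectionVars false

section PsiCoefficients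

variable {K : Type*} [Field K] {p : ℕ}

open Classical in
/-- A nonzero substitute for `1 - Y`, equal to it unless `Y = 1`. -/
def oneSub (Y : K) : K := if Y = 1 then 1 else 1 - Y

/-- The quadratic and braid identities for ψ_r use nothing about this factor except that it never
vanishes, so they need no hypothesis `Y ≠ 1`. At points of the model it is `1 - Y`. -/
theorem oneSub_ne_zero (Y : K) : oneSub Y ≠ 0 := by
  rw [oneSub]
  split_ifs with h
  · exact one_ne_zero
  · exact sub_ne_zero.2 (Ne.symm h)

theorem oneSub_of_ne {Y : K} (h : Y ≠ 1) : oneSub Y = 1 - Y := if_neg h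

/-- Leading coefficients of the operators `ψ_r`, in terms of the residue `c = i_r` and `Y = y_r`. -/
def psiP (c : ZMod p) (Y : K) : K :=
  if c = 0 then -Y⁻¹
  else if c = 1 then (if p = 2 then Y else Y * (oneSub (-Y))⁻¹)
  else if c = -1 then -oneSub Y
  else 1

/-- Lower coefficients of the operators `ψ_r`. -/
def psiQ (c : ZMod p) (Y : K) : K := if c = 0 then -Y⁻¹ else 0

theorem psiP_zero (Y : K) : psiP (0 : ZMod p) Y = -Y⁻¹ := if_pos rfl

theorem psiQ_zero (Y : K) : psiQ (0 : ZMod p) Y = -Y⁻¹ := if_pos rfl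

theorem psiQ_of_ne {c : ZMod p} (h : c ≠ 0) (Y : K) : psiQ c Y = 0 := if_neg h

theorem psiP_of_ne {c : ZMod p} (h0 : c ≠ 0) (h1 : c ≠ 1) (h2 : c ≠ -1) (Y : K) :
    psiP c Y = 1 := by
  rw [psiP, if_neg h0, if_neg h1, if_neg h2]

variable (K p) in
theorem ZMod.isDomain_of_charP [CharP K p] : IsDomain (ZMod p) :=
  (ZMod.castHom_injective K : Function.Injective (ZMod.castHom (dvd_refl p) K)).isDomain _

variable (K) in
theorem ZMod.natCast_ne_zero_of_prime_ne [CharP K p] {q : ℕ} (hq : q.Prime) (h : p ≠ q) :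
    (q : ZMod p) ≠ 0 := by
  intro h0
  rw [ZMod.natCast_eq_zero_iff] at h0
  rcases (Nat.dvd_prime hq).1 h0 with h1 | h1
  · exact CharP.char_ne_one K p h1
  · exact h h1

variable [IsDomain (ZMod p)]

theorem psiP_one (h : p ≠ 2) (Y : K) : psiP (1 : ZMod p) Y = Y * (oneSub (-Y))⁻¹ := by
  rw [psiP, if_neg one_ne_zero, if_pos rfl, if_neg h]

theorem psiP_neg_one (h : (2 : ZMod p) ≠ 0) (Y : K) : psiP (-1 : ZMod p) Y = -oneSub Y := by
  have h1 : (-1 : ZMod p) ≠ 1 := by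
    intro h1
    apply h
    linear_combination -h1
  rw [psiP, if_neg (neg_ne_zero.2 one_ne_zero), if_neg h1, if_pos rfl]

end PsiCoefficients

section PsiRelations

variable {K V : Type*} [Field K] [AddCommGroup V] [Module K V] {p : ℕ} [CharP K p]
variable {T S D D' : V →ₗ[K] V}


section Single

variable {e : Fin 6 → V} {a b ab : ZMod p} {y z : K}

/-- Where all residues vanish, the operators are divided differences with `P = Q = -Y⁻¹`, and the
braid relation holds without correction. -/
theorem Cycle3.psi_of_zero_zero (h : Cycle3 psiP psiQ T S D D' e (0 : ZMod p) 0 0 y z) :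
    T (S (T (e 0))) = S (T (S (e 0))) := by
  have n1 := h.ne_a
  have n2 := h.ne_b
  have n3 := h.ne_ab
  have n3' : z + y ≠ 0 := by rwa [add_comm]
  simp only [h.S0, h.S1, h.S4, h.S5, h.T0, h.T1, h.T2, h.T5, neg_zero, psiP_zero, psiQ_zero, map_add, map_smul, smul_add, smul_smul,
    inv_neg]
  clear h
  match_scalars <;> field_simp <;> ring

/-- When a simple root alone vanishes, just one step of each word may stay in place. Both sides then
have the same terms whatever the other leading coefficients are. -/
theorem Cycle3.psi_of_zero_left (hb : b ≠ 0) (h : Cycle3 psiP psiQ T S D D' e 0 b b y z) :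
    T (S (T (e 0))) = S (T (S (e 0))) := by
  simp only [h.S0, h.S1, h.S4, h.S5, h.T0, h.T1, h.T2, h.T5, psiP_zero, psiQ_zero, psiQ_of_ne hb, psiQ_of_ne (neg_ne_zero.2 hb),
    map_add, map_smul, smul_add, smul_smul, zero_smul, add_zero, inv_neg]
  clear h
  match_scalars <;> ring

theorem Cycle3.psi_of_zero_right (ha : a ≠ 0) (h : Cycle3 psiP psiQ T S D D' e a 0 a y z) :
    T (S (T (e 0))) = S (T (S (e 0))) := by
  simp only [h.S0, h.S1, h.S4, h.S5, h.T0, h.T1, h.T2, h.T5, psiP_zero, psiQ_zero, psiQ_of_ne ha, psiQ_of_ne (neg_ne_zero.2 ha),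
    map_add, map_smul, smul_add, smul_smul, zero_smul, add_zero, inv_neg]
  clear h
  match_scalars <;> ring

/-- With no vanishing root all steps are weighted shifts, and both sides carry `e 0` to the middle
vector with the same product of coefficients over the positive roots. -/
theorem Cycle3.psi_of_ne (ha : a ≠ 0) (hb : b ≠ 0) (hab : ab ≠ 0)
    (h : Cycle3 psiP psiQ T S D D' e a b ab y z) :
    T (S (T (e 0))) = S (T (S (e 0))) := by
  simp only [h.S0, h.S1, h.S4, h.S5, h.T0, h.T1, h.T2, h.T5, psiQ_of_ne ha, psiQ_of_ne hb, psiQ_of_ne hab, map_add, map_smul, smul_add,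
    smul_smul, zero_smul, add_zero]
  clear h
  match_scalars <;> ring

/-- The step in the vanishing root `a + b` may stay in place, after which the walk returns to `e 0`.
The difference of the two sides is `-(y + z)⁻¹` times the difference of the values of ψ_r² and ψ_s²
there; for residues ±1 these are ±y and ∓z, otherwise both are 1. -/
theorem Cycle3.psi_of_sum_zero (hp : p ≠ 2) (hb : b ≠ 0)
    (h : Cycle3 psiP psiQ T S D D' e (-b) b 0 y z) :
    T (S (T (e 0))) - S (T (S (e 0))) =
      if b = -1 then e 0 else if b = 1 then -e 0 else 0 := by
  have := ZMod.isDomain_of_charP K p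
  have h2 : (2 : ZMod p) ≠ 0 := by
    simpa using ZMod.natCast_ne_zero_of_prime_ne (p := p) K Nat.prime_two hp
  have n1 := h.ne_a
  have n2 := h.ne_b
  have n3 := h.ne_ab
  have n3' : z + y ≠ 0 := by rwa [add_comm]
  have hv := oneSub_ne_zero (K := K)
  simp only [h.S0, h.S1, h.S4, h.S5, h.T0, h.T1, h.T2, h.T5, psiP_zero, psiQ_zero, psiQ_of_ne hb, psiQ_of_ne (neg_ne_zero.2 hb),
    map_add, map_smul, smul_add, smul_smul, zero_smul, add_zero, neg_neg, inv_neg]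
  have hm : (1 : ZMod p) ≠ -1 := fun q => h2 (by linear_combination q)
  by_cases c1 : b = 1
  · subst c1
    simp only [psiP_one hp, psiP_neg_one h2, if_neg hm, if_pos, neg_neg]
    clear h
    match_scalars <;> field_simp [hv] <;> ring
  by_cases c2 : b = -1
  · subst c2
    simp only [psiP_one hp, psiP_neg_one h2, neg_neg, if_pos]
    clear h
    match_scalars <;> field_simp [hv] <;> ring
  simp only [psiP_of_ne hb c1 c2, psiP_of_ne (neg_ne_zero.2 hb)
    (fun q => c2 (by rw [← q, neg_neg])) (fun q => c1 (neg_injective q)), if_neg c1, if_neg c2]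
  clear h
  match_scalars <;> field_simp [hv] <;> ring

/-- The same returning walks, now with squares `-y²` and `-z²`, give the quotient `(y² - z²) / (y +
z)`. -/
theorem Cycle3.psi_two (h : Cycle3 psiP psiQ T S D D' e (1 : ZMod 2) 1 0 y z) :
    T (S (T (e 0))) - S (T (S (e 0))) = (y - z) • e 0 := by
  have h1 : ∀ Y : K, psiP (1 : ZMod 2) Y = Y := fun Y => by simp [psiP]
  have n3 := h.ne_ab
  have n3' : z + y ≠ 0 := by rwa [add_comm]
  have hm : (-1 : ZMod 2) = 1 := by decide
  simp only [h.S0, h.S1, h.S4, h.S5, h.T0, h.T1, h.T2, h.T5, hm, psiP_zero, psiQ_zero, psiQ_of_ne one_ne_zero, h1,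
    map_add, map_smul, smul_add, smul_smul, zero_smul, add_zero, neg_neg, inv_neg]
  clear h
  match_scalars <;> field_simp <;> ring

/-- Any two of the three positive roots form a basis of the root lattice, so if not all of them
vanish at the tuple, at most one does. -/
theorem Cycle3.psi (h : Cycle3 psiP psiQ T S D D' e a b (a + b) y z) :
    T (S (T (e 0))) - S (T (S (e 0))) =
      if p = 2 then (if a = 1 ∧ b = 1 then (y - z) • e 0 else 0)
      else if a = 1 ∧ b = -1 then e 0
      else if a = -1 ∧ b = 1 then -e 0
      else 0 := by
  have := ZMod.isDomain_of_charP K p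
  by_cases hp : p = 2
  · subst hp
    have h01 : ∀ c : ZMod 2, c = 0 ∨ c = 1 := by decide
    have e11 : (1 : ZMod 2) + 1 = 0 := by decide
    rcases h01 a with rfl | rfl <;> rcases h01 b with rfl | rfl <;>
      simp only [e11, zero_add, add_zero] at h
    · simp [h.psi_of_zero_zero]
    · simp [h.psi_of_zero_left]
    · simp [h.psi_of_zero_right]
    · simp [h.psi_two]
  have h2 : (2 : ZMod p) ≠ 0 := by
    simpa using ZMod.natCast_ne_zero_of_prime_ne (p := p) K Nat.prime_two hp
  have h1 : (1 : ZMod p) ≠ 0 := one_ne_zero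
  rw [if_neg hp]
  by_cases hb : b = 0
  · subst hb
    rw [add_zero] at h
    rw [if_neg (by simp), if_neg (by simp), sub_eq_zero]
    by_cases ha : a = 0
    · subst ha
      exact h.psi_of_zero_zero
    · exact h.psi_of_zero_right ha
  by_cases ha : a = 0
  · subst ha
    rw [zero_add] at h
    rw [if_neg (by simp), if_neg (by simp), sub_eq_zero]
    exact h.psi_of_zero_left hb
  by_cases hab : a + b = 0
  · obtain rfl : a = -b := by linear_combination hab
    rw [hab] at h
    rw [h.psi_of_sum_zero hp hb]
    clear h
    split_ifs <;> grind
  rw [h.psi_of_ne ha hb hab, sub_self]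
  clear h
  split_ifs <;> grind

end Single


end PsiRelations

end DegBK

end

/-! ### The deformed braid relation of the ψ_r for a double edge. -/

noncomputable section

namespace DegBK

set_option linter.unusedSimpArgs false
set_option linter.unusedSectionVars false

section PsiRelations

variable {K V : Type*} [Field K] [AddCommGroup V] [Module K V] {p : ℕ} [CharP K p]
variable {T S D D' : V →ₗ[K] V}

section Double

variable {e : Fin 8 → V} {a b ab a2b c : ZMod p} {y z : K}

theorem Cycle4.psi_of_zero_zero (h : Cycle4 psiP psiQ T S D D' e (0 : ZMod p) 0 0 0 y z) :
    T (S (T (S (e 0)))) = S (T (S (T (e 0)))) := by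
  have n1 := h.ne_a
  have n2 := h.ne_b
  have n3 := h.ne_ab
  have n4 := h.ne_a2b
  have n3' : z + y ≠ 0 := by rwa [add_comm]
  have n4' : y + z * 2 ≠ 0 := by rwa [mul_comm]
  have n4'' : z * 2 + y ≠ 0 := by rwa [add_comm]
  simp only [h.S0, h.S1, h.S2, h.S3, h.S6, h.S7, h.T0, h.T1, h.T2, h.T5, h.T6, h.T7, psiP_zero, psiQ_zero, map_add, map_smul, smul_add,
    smul_smul, zero_smul, add_zero, neg_neg, neg_zero, inv_neg]
  clear h
  match_scalars <;> field_simp <;> ring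

theorem Cycle4.psi_of_zero_left (hb : b ≠ 0) (hc : c ≠ 0)
    (h : Cycle4 psiP psiQ T S D D' e 0 b b c y z) :
    T (S (T (S (e 0)))) = S (T (S (T (e 0)))) := by
  simp only [h.S0, h.S1, h.S2, h.S3, h.S6, h.S7, h.T0, h.T1, h.T2, h.T5, h.T6, h.T7, psiP_zero, psiQ_zero, psiQ_of_ne hb,
    psiQ_of_ne hc, psiQ_of_ne (neg_ne_zero.2 hb), psiQ_of_ne (neg_ne_zero.2 hc), map_add, map_smul, smul_add,
    smul_smul, zero_smul, add_zero, neg_neg, neg_zero, inv_neg]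
  clear h
  match_scalars <;> ring

theorem Cycle4.psi_of_zero_right (ha : a ≠ 0)
    (h : Cycle4 psiP psiQ T S D D' e a 0 a a y z) :
    T (S (T (S (e 0)))) = S (T (S (T (e 0)))) := by
  simp only [h.S0, h.S1, h.S2, h.S3, h.S6, h.S7, h.T0, h.T1, h.T2, h.T5, h.T6, h.T7, psiP_zero, psiQ_zero, psiQ_of_ne ha,
    psiQ_of_ne (neg_ne_zero.2 ha), map_add, map_smul, smul_add,
    smul_smul, zero_smul, add_zero, neg_neg, neg_zero, inv_neg]
  clear h
  match_scalars <;> ring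

theorem Cycle4.psi_of_ne (ha : a ≠ 0) (hb : b ≠ 0) (hab : ab ≠ 0) (ha2b : a2b ≠ 0)
    (h : Cycle4 psiP psiQ T S D D' e a b ab a2b y z) :
    T (S (T (S (e 0)))) = S (T (S (T (e 0)))) := by
  simp only [h.S0, h.S1, h.S2, h.S3, h.S6, h.S7, h.T0, h.T1, h.T2, h.T5, h.T6, h.T7, psiQ_of_ne ha, psiQ_of_ne hb,
    psiQ_of_ne hab, psiQ_of_ne ha2b, map_add, map_smul, smul_add,
    smul_smul, zero_smul, add_zero, neg_neg, neg_zero, inv_neg]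
  clear h
  match_scalars <;> ring

/-- The short root `a + b` vanishes. Walks that stay in place at its step turn back and end where `S
(e 0)` does; the remaining factor is `-(y + z)⁻¹` times the difference of the squares belonging to
`a + 2b` and `a`. For `c = 1` this is `((y + 2z) + y) / (y + z) = 2`. -/
theorem Cycle4.psi_of_sum_zero (hp : p ≠ 2) (hc : c ≠ 0)
    (h : Cycle4 psiP psiQ T S D D' e (-c) c 0 c y z) :
    T (S (T (S (e 0)))) - S (T (S (T (e 0)))) =
      if c = 1 then (2 : K) • S (e 0) else if c = -1 then -((2 : K) • S (e 0)) else 0 := by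
  have := ZMod.isDomain_of_charP K p
  have h2 : (2 : ZMod p) ≠ 0 := by
    simpa using ZMod.natCast_ne_zero_of_prime_ne (p := p) K Nat.prime_two hp
  have hm : (1 : ZMod p) ≠ -1 := fun q => h2 (by linear_combination q)
  have n1 := h.ne_a
  have n2 := h.ne_b
  have n3 := h.ne_ab
  have n4 := h.ne_a2b
  have n3' : z + y ≠ 0 := by rwa [add_comm]
  have n4' : y + z * 2 ≠ 0 := by rwa [mul_comm]
  have n4'' : z * 2 + y ≠ 0 := by rwa [add_comm]
  have hv := oneSub_ne_zero (K := K)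
  simp only [h.S0, h.S1, h.S2, h.S3, h.S6, h.S7, h.T0, h.T1, h.T2, h.T5, h.T6, h.T7, psiP_zero, psiQ_zero, psiQ_of_ne hc,
    psiQ_of_ne (neg_ne_zero.2 hc), map_add, map_smul, smul_add,
    smul_smul, zero_smul, add_zero, neg_neg, neg_zero, inv_neg]
  by_cases c1 : c = 1
  · subst c1
    simp only [psiP_one hp, psiP_neg_one h2, if_neg hm, if_pos, neg_neg]
    clear h
    match_scalars <;> field_simp [hv] <;> ring
  by_cases c2 : c = -1
  · subst c2
    simp only [psiP_one hp, psiP_neg_one h2, neg_neg, if_neg c1, if_pos]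
    clear h
    match_scalars <;> field_simp [hv] <;> ring
  simp only [psiP_of_ne hc c1 c2, psiP_of_ne (neg_ne_zero.2 hc)
    (fun q => c2 (by rw [← q, neg_neg])) (fun q => c1 (neg_injective q)), if_neg c1, if_neg c2]
  clear h
  match_scalars <;> field_simp [hv] <;> ring

/-- The long root `a + 2b` vanishes, and the walks that turn back end where `T (e 0)` does. The
factor compares the squares belonging to the short roots `b` and `a + b`, for instance `(z + (y +
z)) / (y + 2z) = 1` for `c = 1`. -/
theorem Cycle4.psi_of_long_zero (hp : p ≠ 2) (hc : c ≠ 0)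
    (h : Cycle4 psiP psiQ T S D D' e (-2 * c) c (-c) 0 y z) :
    T (S (T (S (e 0)))) - S (T (S (T (e 0)))) =
      if c = 1 then T (e 0) else if c = -1 then -T (e 0) else 0 := by
  have := ZMod.isDomain_of_charP K p
  have h2 : (2 : ZMod p) ≠ 0 := by
    simpa using ZMod.natCast_ne_zero_of_prime_ne (p := p) K Nat.prime_two hp
  have hm : (1 : ZMod p) ≠ -1 := fun q => h2 (by linear_combination q)
  have hd : -2 * c ≠ 0 := mul_ne_zero (neg_ne_zero.2 h2) hc
  have n1 := h.ne_a
  have n2 := h.ne_b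
  have n3 := h.ne_ab
  have n4 := h.ne_a2b
  have n3' : z + y ≠ 0 := by rwa [add_comm]
  have n4' : y + z * 2 ≠ 0 := by rwa [mul_comm]
  have n4'' : z * 2 + y ≠ 0 := by rwa [add_comm]
  have hv := oneSub_ne_zero (K := K)
  simp only [h.S0, h.S1, h.S2, h.S3, h.S6, h.S7, h.T0, h.T1, h.T2, h.T5, h.T6, h.T7, psiP_zero, psiQ_zero, psiQ_of_ne hc,
    psiQ_of_ne (neg_ne_zero.2 hc), psiQ_of_ne hd, psiQ_of_ne (neg_ne_zero.2 hd), map_add, map_smul, smul_add,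
    smul_smul, zero_smul, add_zero, neg_neg, neg_zero, inv_neg]
  -- The identity holds for arbitrary values of these coefficients, so no case distinction on `-2 *
  -- c` is needed.
  generalize psiP (-2 * c) y = g1
  generalize psiP (-(-2 * c)) (-y) = g2
  by_cases c1 : c = 1
  · subst c1
    simp only [psiP_one hp, psiP_neg_one h2, if_neg hm, if_pos, neg_neg]
    clear h
    match_scalars <;> field_simp [hv] <;> ring
  by_cases c2 : c = -1
  · subst c2
    simp only [psiP_one hp, psiP_neg_one h2, neg_neg, if_neg c1, if_pos]
    clear h
    match_scalars <;> field_simp [hv] <;> ring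
  simp only [psiP_of_ne hc c1 c2, psiP_of_ne (neg_ne_zero.2 hc)
    (fun q => c2 (by rw [← q, neg_neg])) (fun q => c1 (neg_injective q)), if_neg c1, if_neg c2]
  clear h
  match_scalars <;> field_simp [hv] <;> ring

/-- In characteristic 2 both long roots `a` and `a + 2b` vanish, so `T` has a diagonal part at `e 0`
as well. The correction acquires the two terms for `y_r ψ_r` and 1. -/
theorem Cycle4.psi_two_zero_one (h : Cycle4 psiP psiQ T S D D' e (0 : ZMod 2) 1 1 0 y z) :
    T (S (T (S (e 0)))) - S (T (S (T (e 0)))) = D (T (e 0)) + e 0 := by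
  have h1 : ∀ Y : K, psiP (1 : ZMod 2) Y = Y := fun Y => by simp [psiP]
  have hm : (-1 : ZMod 2) = 1 := by decide
  have n1 := h.ne_a
  have n2 := h.ne_b
  have n3 := h.ne_ab
  have n4 := h.ne_a2b
  have n3' : z + y ≠ 0 := by rwa [add_comm]
  have n4' : y + z * 2 ≠ 0 := by rwa [mul_comm]
  have n4'' : z * 2 + y ≠ 0 := by rwa [add_comm]
  simp only [h.S0, h.S1, h.S2, h.S3, h.S6, h.S7, h.T0, h.T1, h.T2, h.T5, h.T6, h.T7, h.D0, h.D1, hm, h1, psiP_zero, psiQ_zero,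
    psiQ_of_ne one_ne_zero, map_add, map_smul, smul_add,
    smul_smul, zero_smul, add_zero, neg_neg, neg_zero, inv_neg]
  clear h
  match_scalars <;> field_simp <;> ring

/-- The walks turning back at `a + b` cancel: the squares of `a` and `a + 2b` coincide because `y +
2z = y` in K. -/
theorem Cycle4.psi_two_one_one [CharP K 2]
    (h : Cycle4 psiP psiQ T S D D' e (1 : ZMod 2) 1 0 1 y z) :
    T (S (T (S (e 0)))) = S (T (S (T (e 0)))) := by
  have h1 : ∀ Y : K, psiP (1 : ZMod 2) Y = Y := fun Y => by simp [psiP]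
  have hm : (-1 : ZMod 2) = 1 := by decide
  have h2 : (2 : K) = 0 := CharTwo.two_eq_zero
  have hy : y + 2 * z = y := by rw [h2, zero_mul, add_zero]
  have n1 := h.ne_a
  have n2 := h.ne_b
  have n3 := h.ne_ab
  have n4 := h.ne_a2b
  have n3' : z + y ≠ 0 := by rwa [add_comm]
  have n4' : y + z * 2 ≠ 0 := by rwa [mul_comm]
  have n4'' : z * 2 + y ≠ 0 := by rwa [add_comm]
  simp only [h.S0, h.S1, h.S2, h.S3, h.S6, h.S7, h.T0, h.T1, h.T2, h.T5, h.T6, h.T7, hm, hy, h1, psiP_zero, psiQ_zero,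
    psiQ_of_ne one_ne_zero, map_add, map_smul, smul_add,
    smul_smul, zero_smul, add_zero, neg_neg, neg_zero, inv_neg]
  clear h
  match_scalars <;> field_simp <;> ring

/-- Two distinct positive roots span a sublattice of index 1 or 2. Outside characteristic 2,
therefore, at most one of them vanishes unless `a = b = 0`. -/
theorem Cycle4.psi (h : Cycle4 psiP psiQ T S D D' e a b (a + b) (a + 2 * b) y z) :
    T (S (T (S (e 0)))) - S (T (S (T (e 0)))) =
      if p = 2 then (if a = 0 ∧ b = 1 then D (T (e 0)) + e 0 else 0)
      else if a = -2 ∧ b = 1 then T (e 0)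
      else if a = 2 ∧ b = -1 then -T (e 0)
      else if a = 1 ∧ b = -1 then -((2 : K) • S (e 0))
      else if a = -1 ∧ b = 1 then (2 : K) • S (e 0)
      else 0 := by
  have := ZMod.isDomain_of_charP K p
  by_cases hp : p = 2
  · subst hp
    have h01 : ∀ c : ZMod 2, c = 0 ∨ c = 1 := by decide
    have e2 : (2 : ZMod 2) = 0 := by decide
    have e11 : (1 : ZMod 2) + 1 = 0 := by decide
    rcases h01 a with rfl | rfl <;> rcases h01 b with rfl | rfl <;>
      simp only [e2, e11, zero_add, add_zero, mul_one, mul_zero] at h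
    · simp [h.psi_of_zero_zero]
    · simp [h.psi_two_zero_one]
    · simp [h.psi_of_zero_right one_ne_zero]
    · simp [h.psi_two_one_one]
  have h2 : (2 : ZMod p) ≠ 0 := by
    simpa using ZMod.natCast_ne_zero_of_prime_ne (p := p) K Nat.prime_two hp
  rw [if_neg hp]
  by_cases hb : b = 0
  · subst hb
    simp only [mul_zero, add_zero] at h
    rw [if_neg (by simp), if_neg (by simp), if_neg (by simp), if_neg (by simp), sub_eq_zero]
    by_cases ha : a = 0
    · subst ha
      exact h.psi_of_zero_zero
    · exact h.psi_of_zero_right ha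
  by_cases ha : a = 0
  · subst ha
    simp only [zero_add] at h
    rw [if_neg (by simp [h2]), if_neg (by simp [Ne.symm h2]), if_neg (by simp), if_neg (by simp),
      sub_eq_zero]
    exact h.psi_of_zero_left hb (mul_ne_zero h2 hb)
  by_cases hab : a + b = 0
  · obtain rfl : a = -b := by linear_combination hab
    rw [hab, show -b + 2 * b = b by ring] at h
    rw [h.psi_of_sum_zero hp hb]
    clear h
    split_ifs <;> grind
  by_cases ha2b : a + 2 * b = 0
  · obtain rfl : a = -2 * b := by linear_combination ha2b
    rw [ha2b, show -2 * b + b = -b by ring] at h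
    rw [h.psi_of_long_zero hp hb]
    clear h
    split_ifs <;> grind
  rw [h.psi_of_ne ha hb hab ha2b, sub_self]
  clear h
  split_ifs <;> grind

end Double

end PsiRelations

end DegBK

end

/-! ### Triple edge: the braid identity for each set of vanishing positive roots. -/

noncomputable section

namespace DegBK

set_option linter.unusedSimpArgs false
set_option linter.unusedSectionVars false

section PsiRelations

variable {K V : Type*} [Field K] [AddCommGroup V] [Module K V] {p : ℕ} [CharP K p]
variable {T S D D' : V →ₗ[K] V}

section Triple

variable {e : Fin 12 → V} {a b ab a2b a3b aab c d : ZMod p} {y z : K}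

set_option maxHeartbeats 1600000 in
theorem Cycle6.psi_of_zero_zero (h : Cycle6 psiP psiQ T S D D' e (0 : ZMod p) 0 0 0 0 0 y z) :
    T (S (T (S (T (S (e 0)))))) = S (T (S (T (S (T (e 0)))))) := by
  have n1 := h.ne_a
  have n2 := h.ne_b
  have n3 := h.ne_ab
  have n4 := h.ne_a2b
  have n3' : z + y ≠ 0 := by rwa [add_comm]
  have n4' : y + z * 2 ≠ 0 := by rwa [mul_comm]
  have n4'' : z * 2 + y ≠ 0 := by rwa [add_comm]
  have n5 := h.ne_a3b
  have n6 := h.ne_aab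
  have n5' : y + z * 3 ≠ 0 := by rwa [mul_comm]
  have n5'' : z * 3 + y ≠ 0 := by rwa [add_comm]
  have n6' : y * 2 + z * 3 ≠ 0 := by rwa [mul_comm, mul_comm z]
  have n7 : y * 2 + 3 * z ≠ 0 := by rwa [mul_comm y]
  have n6'' : z * 3 + y * 2 ≠ 0 := by rwa [add_comm]
  simp only [h.S0, h.S1, h.S2, h.S3, h.S4, h.S5, h.S8, h.S9, h.S10, h.S11, h.T0, h.T1, h.T2, h.T3,
    h.T4, h.T7, h.T8, h.T9, h.T10, h.T11, psiP_zero, psiQ_zero, map_add, map_smul, smul_add,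
    smul_smul, zero_smul, add_zero, neg_neg, neg_zero, inv_neg]
  clear h
  match_scalars <;> field_simp <;> ring

theorem Cycle6.psi_of_zero_left (hb : b ≠ 0) (hc : c ≠ 0) (hd : d ≠ 0)
    (h : Cycle6 psiP psiQ T S D D' e 0 b b c d d y z) :
    T (S (T (S (T (S (e 0)))))) = S (T (S (T (S (T (e 0)))))) := by
  simp only [h.S0, h.S1, h.S2, h.S3, h.S4, h.S5, h.S8, h.S9, h.S10, h.S11, h.T0, h.T1, h.T2, h.T3,
    h.T4, h.T7, h.T8, h.T9, h.T10, h.T11, psiP_zero, psiQ_zero,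
    psiQ_of_ne hb, psiQ_of_ne (neg_ne_zero.2 hb), psiQ_of_ne hc, psiQ_of_ne (neg_ne_zero.2 hc), psiQ_of_ne hd, psiQ_of_ne (neg_ne_zero.2 hd), map_add, map_smul, smul_add,
    smul_smul, zero_smul, add_zero, neg_neg, neg_zero, inv_neg]
  clear h
  match_scalars <;> ring

theorem Cycle6.psi_of_zero_right (ha : a ≠ 0) (hc : c ≠ 0)
    (h : Cycle6 psiP psiQ T S D D' e a 0 a a a c y z) :
    T (S (T (S (T (S (e 0)))))) = S (T (S (T (S (T (e 0)))))) := by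
  simp only [h.S0, h.S1, h.S2, h.S3, h.S4, h.S5, h.S8, h.S9, h.S10, h.S11, h.T0, h.T1, h.T2, h.T3,
    h.T4, h.T7, h.T8, h.T9, h.T10, h.T11, psiP_zero, psiQ_zero,
    psiQ_of_ne ha, psiQ_of_ne (neg_ne_zero.2 ha), psiQ_of_ne hc, psiQ_of_ne (neg_ne_zero.2 hc), map_add, map_smul, smul_add,
    smul_smul, zero_smul, add_zero, neg_neg, neg_zero, inv_neg]
  clear h
  match_scalars <;> ring

theorem Cycle6.psi_of_ne (ha : a ≠ 0) (hb : b ≠ 0) (hab : ab ≠ 0) (ha2b : a2b ≠ 0)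
    (ha3b : a3b ≠ 0) (haab : aab ≠ 0) (h : Cycle6 psiP psiQ T S D D' e a b ab a2b a3b aab y z) :
    T (S (T (S (T (S (e 0)))))) = S (T (S (T (S (T (e 0)))))) := by
  simp only [h.S0, h.S1, h.S2, h.S3, h.S4, h.S5, h.S8, h.S9, h.S10, h.S11, h.T0, h.T1, h.T2, h.T3,
    h.T4, h.T7, h.T8, h.T9, h.T10, h.T11, psiQ_of_ne ha, psiQ_of_ne hb,
    psiQ_of_ne hab, psiQ_of_ne ha2b, psiQ_of_ne ha3b, psiQ_of_ne haab, map_add, map_smul, smul_add,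
    smul_smul, zero_smul, add_zero, neg_neg, neg_zero, inv_neg]
  clear h
  match_scalars <;> ring

/-- The short root `a + b` vanishes; the walks that stay in place at its step are, up to a common
factor, those of `S T S`. -/
theorem Cycle6.psi_of_sum_zero (hp : p ≠ 2) (hc : c ≠ 0)
    (h : Cycle6 psiP psiQ T S D D' e (-c) c 0 c (2 * c) c y z) :
    T (S (T (S (T (S (e 0)))))) - S (T (S (T (S (T (e 0)))))) =
      if c = 1 then (3 : K) • S (T (S (e 0)))
      else if c = -1 then -((3 : K) • S (T (S (e 0)))) else 0 := by
  have := ZMod.isDomain_of_charP K p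
  have h2 : (2 : ZMod p) ≠ 0 := by
    simpa using ZMod.natCast_ne_zero_of_prime_ne (p := p) K Nat.prime_two hp
  have hm : (1 : ZMod p) ≠ -1 := fun q => h2 (by linear_combination q)
  have hd : 2 * c ≠ 0 := mul_ne_zero h2 hc
  have n1 := h.ne_a
  have n2 := h.ne_b
  have n3 := h.ne_ab
  have n4 := h.ne_a2b
  have n3' : z + y ≠ 0 := by rwa [add_comm]
  have n4' : y + z * 2 ≠ 0 := by rwa [mul_comm]
  have n4'' : z * 2 + y ≠ 0 := by rwa [add_comm]
  have n5 := h.ne_a3b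
  have n6 := h.ne_aab
  have n5' : y + z * 3 ≠ 0 := by rwa [mul_comm]
  have n5'' : z * 3 + y ≠ 0 := by rwa [add_comm]
  have n6' : y * 2 + z * 3 ≠ 0 := by rwa [mul_comm, mul_comm z]
  have n7 : y * 2 + 3 * z ≠ 0 := by rwa [mul_comm y]
  have n6'' : z * 3 + y * 2 ≠ 0 := by rwa [add_comm]
  have hv := oneSub_ne_zero (K := K)
  simp only [h.S0, h.S1, h.S2, h.S3, h.S4, h.S5, h.S8, h.S9, h.S10, h.S11, h.T0, h.T1, h.T2, h.T3,
    h.T4, h.T7, h.T8, h.T9, h.T10, h.T11, psiP_zero, psiQ_zero,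
    psiQ_of_ne hc, psiQ_of_ne (neg_ne_zero.2 hc), psiQ_of_ne hd, psiQ_of_ne (neg_ne_zero.2 hd), map_add, map_smul, smul_add,
    smul_smul, zero_smul, add_zero, neg_neg, neg_zero, inv_neg]
  generalize psiP (2 * c) (y + 3 * z) = g1
  by_cases c1 : c = 1
  · subst c1
    simp only [psiP_one hp, psiP_neg_one h2, if_neg hm, if_pos, neg_neg]
    clear h
    match_scalars <;> field_simp [hv] <;> ring
  by_cases c2 : c = -1
  · subst c2
    simp only [psiP_one hp, psiP_neg_one h2, neg_neg, if_neg c1, if_pos]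
    clear h
    match_scalars <;> field_simp [hv] <;> ring
  simp only [psiP_of_ne hc c1 c2, psiP_of_ne (neg_ne_zero.2 hc)
    (fun q => c2 (by rw [← q, neg_neg])) (fun q => c1 (neg_injective q)), if_neg c1, if_neg c2]
  clear h
  match_scalars <;> field_simp [hv] <;> ring

/-- The short root `a + 2b` vanishes and the surviving walks end where `T (e 0)` does. For `c = ±1`
the two products of squares are `z (y + 3z)` and `(y + z)(2y + 3z)`, with difference `-2y (y + 2z)`;
since `D` acts by `-y` on `e 1`, this produces `-2 D T`. -/
theorem Cycle6.psi_of_short_zero (hp : p ≠ 2) (hc : c ≠ 0)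
    (h : Cycle6 psiP psiQ T S D D' e (-2 * c) c (-c) 0 c (-c) y z) :
    T (S (T (S (T (S (e 0)))))) - S (T (S (T (S (T (e 0)))))) =
      if c = 1 ∨ c = -1 then -((2 : K) • D (T (e 0))) else 0 := by
  have := ZMod.isDomain_of_charP K p
  have h2 : (2 : ZMod p) ≠ 0 := by
    simpa using ZMod.natCast_ne_zero_of_prime_ne (p := p) K Nat.prime_two hp
  have hm : (1 : ZMod p) ≠ -1 := fun q => h2 (by linear_combination q)
  have hd : -2 * c ≠ 0 := mul_ne_zero (neg_ne_zero.2 h2) hc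
  have n1 := h.ne_a
  have n2 := h.ne_b
  have n3 := h.ne_ab
  have n4 := h.ne_a2b
  have n3' : z + y ≠ 0 := by rwa [add_comm]
  have n4' : y + z * 2 ≠ 0 := by rwa [mul_comm]
  have n4'' : z * 2 + y ≠ 0 := by rwa [add_comm]
  have n5 := h.ne_a3b
  have n6 := h.ne_aab
  have n5' : y + z * 3 ≠ 0 := by rwa [mul_comm]
  have n5'' : z * 3 + y ≠ 0 := by rwa [add_comm]
  have n6' : y * 2 + z * 3 ≠ 0 := by rwa [mul_comm, mul_comm z]
  have n7 : y * 2 + 3 * z ≠ 0 := by rwa [mul_comm y]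
  have n6'' : z * 3 + y * 2 ≠ 0 := by rwa [add_comm]
  have hv := oneSub_ne_zero (K := K)
  simp only [h.S0, h.S1, h.S2, h.S3, h.S4, h.S5, h.S8, h.S9, h.S10, h.S11, h.T0, h.T1, h.T2, h.T3,
    h.T4, h.T7, h.T8, h.T9, h.T10, h.T11, h.D0, h.D1, psiP_zero, psiQ_zero,
    psiQ_of_ne hc, psiQ_of_ne (neg_ne_zero.2 hc), psiQ_of_ne hd, psiQ_of_ne (neg_ne_zero.2 hd), map_add, map_smul, smul_add,
    smul_smul, zero_smul, add_zero, neg_neg, neg_zero, inv_neg]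
  generalize psiP (-2 * c) y = g1
  by_cases c1 : c = 1
  · subst c1
    simp only [psiP_one hp, psiP_neg_one h2, if_neg hm, if_pos, neg_neg, true_or, or_true, or_self, if_true, if_false, reduceIte]
    clear h
    match_scalars <;> field_simp [hv] <;> ring
  by_cases c2 : c = -1
  · subst c2
    simp only [psiP_one hp, psiP_neg_one h2, neg_neg, if_neg c1, if_pos, true_or, or_true, or_self, if_true, if_false, reduceIte]
    clear h
    match_scalars <;> field_simp [hv] <;> ring
  simp only [psiP_of_ne hc c1 c2, psiP_of_ne (neg_ne_zero.2 hc)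
    (fun q => c2 (by rw [← q, neg_neg])) (fun q => c1 (neg_injective q)), if_neg c1, if_neg c2, true_or, or_true, or_self, if_true, if_false, reduceIte, c1, c2]
  clear h
  match_scalars <;> field_simp [hv] <;> ring

/-- The long root `a + 3b` vanishes, and the returning walks contribute a multiple of `T S T`. -/
theorem Cycle6.psi_of_long_zero (hp : p ≠ 2) (hp3 : p ≠ 3) (hc : c ≠ 0)
    (h : Cycle6 psiP psiQ T S D D' e (-3 * c) c (-2 * c) (-c) 0 (-3 * c) y z) :
    T (S (T (S (T (S (e 0)))))) - S (T (S (T (S (T (e 0)))))) =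
      if c = 1 then T (S (T (e 0))) else if c = -1 then -T (S (T (e 0))) else 0 := by
  have := ZMod.isDomain_of_charP K p
  have h2 : (2 : ZMod p) ≠ 0 := by
    simpa using ZMod.natCast_ne_zero_of_prime_ne (p := p) K Nat.prime_two hp
  have hm : (1 : ZMod p) ≠ -1 := fun q => h2 (by linear_combination q)
  have h3 : (3 : ZMod p) ≠ 0 := by
    simpa using ZMod.natCast_ne_zero_of_prime_ne (p := p) K Nat.prime_three hp3
  have hd : -2 * c ≠ 0 := mul_ne_zero (neg_ne_zero.2 h2) hc
  have hd' : -3 * c ≠ 0 := mul_ne_zero (neg_ne_zero.2 h3) hc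
  have n1 := h.ne_a
  have n2 := h.ne_b
  have n3 := h.ne_ab
  have n4 := h.ne_a2b
  have n3' : z + y ≠ 0 := by rwa [add_comm]
  have n4' : y + z * 2 ≠ 0 := by rwa [mul_comm]
  have n4'' : z * 2 + y ≠ 0 := by rwa [add_comm]
  have n5 := h.ne_a3b
  have n6 := h.ne_aab
  have n5' : y + z * 3 ≠ 0 := by rwa [mul_comm]
  have n5'' : z * 3 + y ≠ 0 := by rwa [add_comm]
  have n6' : y * 2 + z * 3 ≠ 0 := by rwa [mul_comm, mul_comm z]
  have n7 : y * 2 + 3 * z ≠ 0 := by rwa [mul_comm y]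
  have n6'' : z * 3 + y * 2 ≠ 0 := by rwa [add_comm]
  have hv := oneSub_ne_zero (K := K)
  simp only [h.S0, h.S1, h.S2, h.S3, h.S4, h.S5, h.S8, h.S9, h.S10, h.S11, h.T0, h.T1, h.T2, h.T3,
    h.T4, h.T7, h.T8, h.T9, h.T10, h.T11, psiP_zero, psiQ_zero,
    psiQ_of_ne hc, psiQ_of_ne (neg_ne_zero.2 hc), psiQ_of_ne hd, psiQ_of_ne (neg_ne_zero.2 hd), psiQ_of_ne hd', psiQ_of_ne (neg_ne_zero.2 hd'), map_add, map_smul, smul_add,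
    smul_smul, zero_smul, add_zero, neg_neg, neg_zero, inv_neg]
  generalize psiP (-2 * c) (y + z) = g1
  generalize psiP (-3 * c) y = g2
  generalize psiP (-3 * c) (2 * y + 3 * z) = g3
  by_cases c1 : c = 1
  · subst c1
    simp only [psiP_one hp, psiP_neg_one h2, if_neg hm, if_pos, neg_neg]
    clear h
    match_scalars <;> field_simp [hv] <;> ring
  by_cases c2 : c = -1
  · subst c2
    simp only [psiP_one hp, psiP_neg_one h2, neg_neg, if_neg c1, if_pos]
    clear h
    match_scalars <;> field_simp [hv] <;> ring
  simp only [psiP_of_ne hc c1 c2, psiP_of_ne (neg_ne_zero.2 hc)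
    (fun q => c2 (by rw [← q, neg_neg])) (fun q => c1 (neg_injective q)), if_neg c1, if_neg c2]
  clear h
  match_scalars <;> field_simp [hv] <;> ring

/-- The highest root `2a + 3b` vanishes. The surviving walks end where `S (e 0)` does and compare
the products of squares for `a + 2b, a + 3b` and for `a, a + b`. The short roots contribute when `c
= ±1` and the long ones when `3 * c = ±1`, giving two sources of the same correction. -/
theorem Cycle6.psi_of_highest_zero (hp : p ≠ 2) (hp3 : p ≠ 3) (hc : c ≠ 0)
    (h : Cycle6 psiP psiQ T S D D' e (-3 * c) (2 * c) (-c) c (3 * c) 0 y z) :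
    T (S (T (S (T (S (e 0)))))) - S (T (S (T (S (T (e 0)))))) =
      if c = 1 ∨ 3 * c = 1 then S (e 0) else if c = -1 ∨ 3 * c = -1 then -S (e 0) else 0 := by
  have := ZMod.isDomain_of_charP K p
  have h2 : (2 : ZMod p) ≠ 0 := by
    simpa using ZMod.natCast_ne_zero_of_prime_ne (p := p) K Nat.prime_two hp
  have hm : (1 : ZMod p) ≠ -1 := fun q => h2 (by linear_combination q)
  have h3 : (3 : ZMod p) ≠ 0 := by
    simpa using ZMod.natCast_ne_zero_of_prime_ne (p := p) K Nat.prime_three hp3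
  have hd : 2 * c ≠ 0 := mul_ne_zero h2 hc
  have hd' : 3 * c ≠ 0 := mul_ne_zero h3 hc
  have n1 := h.ne_a
  have n2 := h.ne_b
  have n3 := h.ne_ab
  have n4 := h.ne_a2b
  have n3' : z + y ≠ 0 := by rwa [add_comm]
  have n4' : y + z * 2 ≠ 0 := by rwa [mul_comm]
  have n4'' : z * 2 + y ≠ 0 := by rwa [add_comm]
  have n5 := h.ne_a3b
  have n6 := h.ne_aab
  have n5' : y + z * 3 ≠ 0 := by rwa [mul_comm]
  have n5'' : z * 3 + y ≠ 0 := by rwa [add_comm]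
  have n6' : y * 2 + z * 3 ≠ 0 := by rwa [mul_comm, mul_comm z]
  have n7 : y * 2 + 3 * z ≠ 0 := by rwa [mul_comm y]
  have n6'' : z * 3 + y * 2 ≠ 0 := by rwa [add_comm]
  have hv := oneSub_ne_zero (K := K)
  rw [show -3 * c = -(3 * c) by ring] at h
  simp only [h.S0, h.S1, h.S2, h.S3, h.S4, h.S5, h.S8, h.S9, h.S10, h.S11, h.T0, h.T1, h.T2, h.T3,
    h.T4, h.T7, h.T8, h.T9, h.T10, h.T11, psiP_zero, psiQ_zero,
    psiQ_of_ne hc, psiQ_of_ne (neg_ne_zero.2 hc), psiQ_of_ne hd, psiQ_of_ne (neg_ne_zero.2 hd), psiQ_of_ne hd', psiQ_of_ne (neg_ne_zero.2 hd'), map_add, map_smul, smul_add,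
    smul_smul, zero_smul, add_zero, neg_neg, neg_zero, inv_neg]
  generalize psiP (2 * c) z = g1
  -- The two sources exclude each other: `c = ±1` and `3 * c = ±1` together would force 2 or 4 to
  -- vanish.
  have h31 : (3 : ZMod p) ≠ 1 := fun q => h2 (by linear_combination q)
  have h31' : (3 : ZMod p) ≠ -1 := fun q => h2 (mul_self_eq_zero.1 (by linear_combination q))
  have neg : ∀ {x : ZMod p}, x ≠ 0 → x ≠ 1 → x ≠ -1 → ∀ Y : K, psiP x Y = 1 ∧ psiP (-x) Y = 1 :=
    fun x0 x1 x2 Y => ⟨psiP_of_ne x0 x1 x2 Y, psiP_of_ne (neg_ne_zero.2 x0)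
      (fun q => x2 (by rw [← q, neg_neg])) (fun q => x1 (neg_injective q)) Y⟩
  by_cases c1 : c = 1
  · subst c1
    have h3c := neg h3 h31 h31'
    simp only [mul_one, fun Y => (h3c Y).1, fun Y => (h3c Y).2, psiP_one hp, psiP_neg_one h2,
      true_or, if_true, neg_neg]
    clear h
    match_scalars <;> field_simp [hv] <;> ring
  by_cases c2 : c = -1
  · subst c2
    have h3c := neg h3 h31 h31'
    have e3 : (3 : ZMod p) * -1 = -3 := by ring
    have i1 : ¬ ((-1 : ZMod p) = 1 ∨ -3 = (1 : ZMod p)) := by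
      rintro (q | q)
      · exact hm q.symm
      · exact h31' (by linear_combination -q)
    simp only [e3, neg_neg, fun Y => (h3c Y).1, fun Y => (h3c Y).2, psiP_one hp, psiP_neg_one h2,
      if_neg i1, true_or, if_true]
    clear h
    match_scalars <;> field_simp [hv] <;> ring
  have hc' := neg hc c1 c2
  by_cases c3 : 3 * c = 1
  · simp only [c3, fun Y => (hc' Y).1, fun Y => (hc' Y).2, psiP_one hp, psiP_neg_one h2,
      or_true, if_true, neg_neg]
    clear h
    match_scalars <;> field_simp [hv] <;> ring
  by_cases c4 : 3 * c = -1
  · simp only [c4, fun Y => (hc' Y).1, fun Y => (hc' Y).2, psiP_one hp, psiP_neg_one h2,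
      or_true, if_true, neg_neg, c1, hm.symm, or_self, if_false]
    clear h
    match_scalars <;> field_simp [hv] <;> ring
  have h3c := neg hd' c3 c4
  simp only [fun Y => (hc' Y).1, fun Y => (hc' Y).2, fun Y => (h3c Y).1, fun Y => (h3c Y).2,
    c1, c2, c3, c4, or_self, if_false]
  clear h
  match_scalars <;> field_simp [hv] <;> ring

/-- Here `a` and `a + 2b` vanish together. The contributions cancel because `2 = 0` in K identifies
`y + 2z` with `y`, `y + 3z` with `y + z` and `2y + 3z` with `z`. -/
theorem Cycle6.psi_two_zero_one [CharP K 2]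
    (h : Cycle6 psiP psiQ T S D D' e (0 : ZMod 2) 1 1 0 1 1 y z) :
    T (S (T (S (T (S (e 0)))))) = S (T (S (T (S (T (e 0)))))) := by
  have h1 : ∀ Y : K, psiP (1 : ZMod 2) Y = Y := fun Y => by simp [psiP]
  have hm : (-1 : ZMod 2) = 1 := by decide
  have h2 : (2 : K) = 0 := CharTwo.two_eq_zero
  have h3 : (3 : K) = 1 := by linear_combination h2
  have hy : y + 2 * z = y := by rw [h2, zero_mul, add_zero]
  have hy' : y + 3 * z = y + z := by rw [h3, one_mul]
  have hy'' : 2 * y + 3 * z = z := by rw [h2, h3, zero_mul, zero_add, one_mul]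
  have n1 := h.ne_a
  have n2 := h.ne_b
  have n3 := h.ne_ab
  have n4 := h.ne_a2b
  have n3' : z + y ≠ 0 := by rwa [add_comm]
  have n4' : y + z * 2 ≠ 0 := by rwa [mul_comm]
  have n4'' : z * 2 + y ≠ 0 := by rwa [add_comm]
  have n5 := h.ne_a3b
  have n6 := h.ne_aab
  have n5' : y + z * 3 ≠ 0 := by rwa [mul_comm]
  have n5'' : z * 3 + y ≠ 0 := by rwa [add_comm]
  have n6' : y * 2 + z * 3 ≠ 0 := by rwa [mul_comm, mul_comm z]
  have n7 : y * 2 + 3 * z ≠ 0 := by rwa [mul_comm y]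
  have n6'' : z * 3 + y * 2 ≠ 0 := by rwa [add_comm]
  simp only [h.S0, h.S1, h.S2, h.S3, h.S4, h.S5, h.S8, h.S9, h.S10, h.S11, h.T0, h.T1, h.T2, h.T3,
    h.T4, h.T7, h.T8, h.T9, h.T10, h.T11, hm, hy, hy', hy'', h1, psiP_zero,
    psiQ_zero, psiQ_of_ne one_ne_zero, map_add, map_smul, smul_add,
    smul_smul, zero_smul, add_zero, neg_neg, neg_zero, inv_neg]
  clear h
  match_scalars <;> field_simp <;> ring

theorem Cycle6.psi_two_one_zero [CharP K 2]
    (h : Cycle6 psiP psiQ T S D D' e (1 : ZMod 2) 0 1 1 1 0 y z) :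
    T (S (T (S (T (S (e 0)))))) = S (T (S (T (S (T (e 0)))))) := by
  have h1 : ∀ Y : K, psiP (1 : ZMod 2) Y = Y := fun Y => by simp [psiP]
  have hm : (-1 : ZMod 2) = 1 := by decide
  have h2 : (2 : K) = 0 := CharTwo.two_eq_zero
  have h3 : (3 : K) = 1 := by linear_combination h2
  have hy : y + 2 * z = y := by rw [h2, zero_mul, add_zero]
  have hy' : y + 3 * z = y + z := by rw [h3, one_mul]
  have hy'' : 2 * y + 3 * z = z := by rw [h2, h3, zero_mul, zero_add, one_mul]
  have n1 := h.ne_a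
  have n2 := h.ne_b
  have n3 := h.ne_ab
  have n4 := h.ne_a2b
  have n3' : z + y ≠ 0 := by rwa [add_comm]
  have n4' : y + z * 2 ≠ 0 := by rwa [mul_comm]
  have n4'' : z * 2 + y ≠ 0 := by rwa [add_comm]
  have n5 := h.ne_a3b
  have n6 := h.ne_aab
  have n5' : y + z * 3 ≠ 0 := by rwa [mul_comm]
  have n5'' : z * 3 + y ≠ 0 := by rwa [add_comm]
  have n6' : y * 2 + z * 3 ≠ 0 := by rwa [mul_comm, mul_comm z]
  have n7 : y * 2 + 3 * z ≠ 0 := by rwa [mul_comm y]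
  have n6'' : z * 3 + y * 2 ≠ 0 := by rwa [add_comm]
  simp only [h.S0, h.S1, h.S2, h.S3, h.S4, h.S5, h.S8, h.S9, h.S10, h.S11, h.T0, h.T1, h.T2, h.T3,
    h.T4, h.T7, h.T8, h.T9, h.T10, h.T11, hm, hy, hy', hy'', h1, psiP_zero,
    psiQ_zero, psiQ_of_ne one_ne_zero, map_add, map_smul, smul_add,
    smul_smul, zero_smul, add_zero, neg_neg, neg_zero, inv_neg]
  clear h
  match_scalars <;> field_simp <;> ring

/-- The roots `a + b` and `a + 3b` vanish together: walks may stay in place at either or at both,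
which leaves terms with three letters and terms with none. -/
theorem Cycle6.psi_two_one_one
    (h : Cycle6 psiP psiQ T S D D' e (1 : ZMod 2) 1 0 1 0 1 y z) :
    T (S (T (S (T (S (e 0)))))) - S (T (S (T (S (T (e 0)))))) =
      D (T (S (T (e 0)))) + D' (T (S (T (e 0))))
        - (3 : K) • (D (S (T (S (e 0)))) + (3 : K) • D' (S (T (S (e 0)))))
        - (y ^ 2) • e 0 + (3 * z ^ 2) • e 0 := by
  have h1 : ∀ Y : K, psiP (1 : ZMod 2) Y = Y := fun Y => by simp [psiP]
  have hm : (-1 : ZMod 2) = 1 := by decide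
  have n1 := h.ne_a
  have n2 := h.ne_b
  have n3 := h.ne_ab
  have n4 := h.ne_a2b
  have n3' : z + y ≠ 0 := by rwa [add_comm]
  have n4' : y + z * 2 ≠ 0 := by rwa [mul_comm]
  have n4'' : z * 2 + y ≠ 0 := by rwa [add_comm]
  have n5 := h.ne_a3b
  have n6 := h.ne_aab
  have n5' : y + z * 3 ≠ 0 := by rwa [mul_comm]
  have n5'' : z * 3 + y ≠ 0 := by rwa [add_comm]
  have n6' : y * 2 + z * 3 ≠ 0 := by rwa [mul_comm, mul_comm z]
  have n7 : y * 2 + 3 * z ≠ 0 := by rwa [mul_comm y]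
  have n6'' : z * 3 + y * 2 ≠ 0 := by rwa [add_comm]
  simp only [h.S0, h.S1, h.S2, h.S3, h.S4, h.S5, h.S8, h.S9, h.S10, h.S11, h.T0, h.T1, h.T2, h.T3,
    h.T4, h.T7, h.T8, h.T9, h.T10, h.T11, h.D0, h.D'0, h.D1, h.D3, h.D'3,
    h.D9, h.D'9, hm, h1, psiP_zero,
    psiQ_zero, psiQ_of_ne one_ne_zero, map_add, map_smul, smul_add,
    smul_smul, zero_smul, add_zero, neg_neg, neg_zero, inv_neg]
  clear h
  match_scalars <;> field_simp <;> ring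

/-- In characteristic 3 all three long roots `a`, `a + 3b` and `2a + 3b` vanish at this tuple, while
the short ones have residue ±1. -/
theorem Cycle6.psi_three_zero_left [CharP K 3] {c : ZMod 3} (hc : c ≠ 0)
    (h : Cycle6 psiP psiQ T S D D' e (0 : ZMod 3) c c (-c) 0 0 y z) :
    T (S (T (S (T (S (e 0)))))) - S (T (S (T (S (T (e 0)))))) =
      if c = 1 then T (S (T (e 0))) else -T (S (T (e 0))) := by
  have hp : 3 ≠ 2 := by decide
  have h2 : (2 : ZMod 3) ≠ 0 := by decide
  have n1 := h.ne_a
  have n2 := h.ne_b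
  have n3 := h.ne_ab
  have n4 := h.ne_a2b
  have n3' : z + y ≠ 0 := by rwa [add_comm]
  have n4' : y + z * 2 ≠ 0 := by rwa [mul_comm]
  have n4'' : z * 2 + y ≠ 0 := by rwa [add_comm]
  have n5 := h.ne_a3b
  have n6 := h.ne_aab
  have n5' : y + z * 3 ≠ 0 := by rwa [mul_comm]
  have n5'' : z * 3 + y ≠ 0 := by rwa [add_comm]
  have n6' : y * 2 + z * 3 ≠ 0 := by rwa [mul_comm, mul_comm z]
  have n7 : y * 2 + 3 * z ≠ 0 := by rwa [mul_comm y]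
  have n6'' : z * 3 + y * 2 ≠ 0 := by rwa [add_comm]
  have hv := oneSub_ne_zero (K := K)
  simp only [h.S0, h.S1, h.S2, h.S3, h.S4, h.S5, h.S8, h.S9, h.S10, h.S11, h.T0, h.T1, h.T2, h.T3,
    h.T4, h.T7, h.T8, h.T9, h.T10, h.T11, psiP_zero, psiQ_zero,
    psiQ_of_ne hc, psiQ_of_ne (neg_ne_zero.2 hc), map_add, map_smul, smul_add,
    smul_smul, zero_smul, add_zero, neg_neg, neg_zero, inv_neg]
  have c12 : ∀ x : ZMod 3, x ≠ 0 → x = 1 ∨ x = -1 := by decide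
  rcases c12 c hc with rfl | rfl
  · simp only [psiP_one hp, psiP_neg_one h2, if_true, neg_neg]
    clear h
    match_scalars <;> field_simp [hv] <;> ring
  · simp only [psiP_one hp, psiP_neg_one h2, neg_neg, if_neg (show (-1 : ZMod 3) ≠ 1 by decide)]
    clear h
    match_scalars <;> field_simp [hv] <;> ring

end Triple

end PsiRelations

end DegBK

end

/-! ### Triple edge: assembling the cases. -/

noncomputable section

namespace DegBK

set_option linter.unusedSimpArgs false
set_option linter.unusedSectionVars false

section PsiRelations

variable {K V : Type*} [Field K] [AddCommGroup V] [Module K V] {p : ℕ} [CharP K p]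
variable {T S D D' : V →ₗ[K] V}

section Triple

variable {e : Fin 12 → V} {a b ab a2b a3b aab c d : ZMod p} {y z : K}

-- Two distinct positive roots span a sublattice of index 1, 2 or 3. Outside characteristics 2 and
-- 3, at most one root vanishes unless `a = b = 0`; those two characteristics are treated
-- separately.
set_option maxHeartbeats 1600000 in
theorem Cycle6.psi
    (h : Cycle6 psiP psiQ T S D D' e a b (a + b) (a + 2 * b) (a + 3 * b) (2 * a + 3 * b) y z) :
    T (S (T (S (T (S (e 0)))))) - S (T (S (T (S (T (e 0)))))) =
      if p = 2 then (if a = 1 ∧ b = 1 then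
        D (T (S (T (e 0)))) + D' (T (S (T (e 0))))
          - (3 : K) • (D (S (T (S (e 0)))) + (3 : K) • D' (S (T (S (e 0)))))
          - (y ^ 2) • e 0 + (3 * z ^ 2) • e 0 else 0)
      else if p = 3 then
        (if a = 0 ∧ b = 1 then T (S (T (e 0)))
        else if a = 0 ∧ b = -1 then -T (S (T (e 0)))
        else if (a = -2 ∧ b = 1) ∨ (a = 2 ∧ b = -1) then -((2 : K) • D (T (e 0)))
        else 0)
      else if a = -3 ∧ b = 1 then T (S (T (e 0)))
      else if a = 3 ∧ b = -1 then -T (S (T (e 0)))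
      else if a = 1 ∧ b = -1 then -((3 : K) • S (T (S (e 0))))
      else if a = -1 ∧ b = 1 then (3 : K) • S (T (S (e 0)))
      else if (a = -2 ∧ b = 1) ∨ (a = 2 ∧ b = -1) then -((2 : K) • D (T (e 0)))
      else if (a = 1 ∧ 3 * b = -2) ∨ (a = 3 ∧ b = -2) then -S (e 0)
      else if (a = -1 ∧ 3 * b = 2) ∨ (a = -3 ∧ b = 2) then S (e 0)
      else 0 := by
  have := ZMod.isDomain_of_charP K p
  by_cases hp : p = 2
  · subst hp
    have h01 : ∀ c : ZMod 2, c = 0 ∨ c = 1 := by decide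
    have e2 : (2 : ZMod 2) = 0 := by decide
    have e3 : (3 : ZMod 2) = 1 := by decide
    have e11 : (1 : ZMod 2) + 1 = 0 := by decide
    rcases h01 a with rfl | rfl <;> rcases h01 b with rfl | rfl <;>
      simp only [e2, e3, e11, zero_add, add_zero, mul_one, mul_zero] at h
    · simp [h.psi_of_zero_zero]
    · simp [h.psi_two_zero_one]
    · simp [h.psi_two_one_zero]
    · simp [h.psi_two_one_one]
  have h2 : (2 : ZMod p) ≠ 0 := by
    simpa using ZMod.natCast_ne_zero_of_prime_ne (p := p) K Nat.prime_two hp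
  have h4 : (4 : ZMod p) ≠ 0 := by
    rw [show (4 : ZMod p) = 2 * 2 by norm_num]
    exact mul_ne_zero h2 h2
  have h1 : (1 : ZMod p) ≠ 0 := one_ne_zero
  rw [if_neg hp]
  by_cases hb : b = 0
  · subst hb
    simp only [mul_zero, add_zero] at h
    have key : T (S (T (S (T (S (e 0)))))) = S (T (S (T (S (T (e 0)))))) := by
      by_cases ha : a = 0
      · subst ha
        simp only [mul_zero] at h
        exact h.psi_of_zero_zero
      · exact h.psi_of_zero_right ha (mul_ne_zero h2 ha)
    simp [key, h2, Ne.symm h2]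
  by_cases hab : a + b = 0
  · obtain rfl : a = -b := by linear_combination hab
    rw [hab, show -b + 2 * b = b by ring, show -b + 3 * b = 2 * b by ring,
      show 2 * -b + 3 * b = b by ring] at h
    rw [h.psi_of_sum_zero hp hb]
    by_cases hp3 : p = 3
    · subst hp3
      -- The correction for `a + b = 0` has coefficient 3 and disappears in characteristic 3.
      have h0 : (3 : K) = 0 := by exact_mod_cast CharP.cast_eq_zero K 3
      simp only [h0, zero_smul, neg_zero, ite_self]
      have key : ∀ b : ZMod 3, b ≠ 0 → ¬ (-b = 0 ∧ b = 1) ∧ ¬ (-b = 0 ∧ b = -1) ∧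
          ¬ ((-b = -2 ∧ b = 1) ∨ (-b = 2 ∧ b = -1)) := by decide
      obtain ⟨k1, k2, k3⟩ := key b hb
      rw [if_pos trivial, if_neg k1, if_neg k2, if_neg k3]
    rw [if_neg hp3]
    have h3 : (3 : ZMod p) ≠ 0 := by
      simpa using ZMod.natCast_ne_zero_of_prime_ne (p := p) K Nat.prime_three hp3
    clear h
    split_ifs <;> grind
  by_cases ha2b : a + 2 * b = 0
  · obtain rfl : a = -2 * b := by linear_combination ha2b
    rw [ha2b, show -2 * b + b = -b by ring, show -2 * b + 3 * b = b by ring,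
      show 2 * (-2 * b) + 3 * b = -b by ring] at h
    rw [h.psi_of_short_zero hp hb]
    by_cases hp3 : p = 3
    · rw [if_pos hp3]
      clear h
      split_ifs <;> grind
    rw [if_neg hp3]
    have h3 : (3 : ZMod p) ≠ 0 := by
      simpa using ZMod.natCast_ne_zero_of_prime_ne (p := p) K Nat.prime_three hp3
    clear h
    split_ifs <;> grind
  by_cases hp3 : p = 3
  · subst hp3
    have e3 : (3 : ZMod 3) = 0 := by decide
    have e2 : (2 : ZMod 3) = -1 := by decide
    rw [if_pos rfl]
    by_cases ha : a = 0
    · subst ha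
      simp only [e3, e2, zero_add, zero_mul, mul_zero, neg_one_mul] at h
      rw [h.psi_three_zero_left hb]
      have c12 : ∀ x : ZMod 3, x ≠ 0 → x = 1 ∨ x = -1 := by decide
      have h1 : (-1 : ZMod 3) ≠ 1 := by decide
      rcases c12 b hb with rfl | rfl <;> simp [h1]
    -- Two nonzero residues modulo 3 that are not opposite are equal, so that `a + 2b = 3b = 0`, a
    -- case already treated.
    · have key : ∀ a b : ZMod 3, a ≠ 0 → b ≠ 0 → a + b ≠ 0 → a + 2 * b = 0 := by decide
      exact absurd (key a b ha hb hab) ha2b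
  have h3 : (3 : ZMod p) ≠ 0 := by
    simpa using ZMod.natCast_ne_zero_of_prime_ne (p := p) K Nat.prime_three hp3
  rw [if_neg hp3]
  by_cases ha : a = 0
  · subst ha
    simp only [zero_add, mul_zero] at h
    rw [h.psi_of_zero_left hb (mul_ne_zero h2 hb) (mul_ne_zero h3 hb), sub_self]
    clear h
    split_ifs <;> grind
  by_cases ha3b : a + 3 * b = 0
  · obtain rfl : a = -3 * b := by linear_combination ha3b
    rw [ha3b, show -3 * b + b = -2 * b by ring, show -3 * b + 2 * b = -b by ring,
      show 2 * (-3 * b) + 3 * b = -3 * b by ring] at h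
    rw [h.psi_of_long_zero hp hp3 hb]
    clear h
    split_ifs <;> grind
  by_cases haab : 2 * a + 3 * b = 0
  -- The choice `c = -(a + b)` parametrizes the solutions of `2a + 3b = 0` without division.
  · obtain ⟨c, rfl, rfl⟩ : ∃ c, a = -3 * c ∧ b = 2 * c :=
      ⟨-(a + b), by linear_combination -haab, by linear_combination haab⟩
    have hc : c ≠ 0 := fun q => hb (by rw [q, mul_zero])
    rw [haab, show -3 * c + 2 * c = -c by ring, show -3 * c + 2 * (2 * c) = c by ring,
      show -3 * c + 3 * (2 * c) = 3 * c by ring] at h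
    rw [h.psi_of_highest_zero hp hp3 hc]
    have k1 : 2 * c = 2 → c = 1 := fun q => mul_left_cancel₀ h2 (by rw [q, mul_one])
    have k2 : 2 * c = -2 → c = -1 := fun q => mul_left_cancel₀ h2 (by rw [q, mul_neg_one])
    clear h ha ha2b ha3b haab hab hb
    split_ifs <;> grind
  rw [h.psi_of_ne ha hb hab ha2b ha3b haab, sub_self]
  clear h
  split_ifs <;> grind

end Triple

end PsiRelations

end DegBK

end

/-! ### Root operators in the model and their rank two cycles. -/

noncomputable section

namespace DegBK

open MvPolynomial

section RootOperators

variable {n : ℕ} {A : FiniteCartan n} {k : Type*} [Field k] {e : ℕ} {i₀ : Fin n → ZMod e}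

/-- On both components of a pair the letters act through the Weyl group, so only the product of the
word matters. This closes the rank two cycles. -/
theorem foldr_refl_eq {ω ω' : List (Fin n)} (h : A.cs.wordProd ω = A.cs.wordProd ω')
    (q : Pt A i₀) : ω.foldr Pt.refl q = ω'.foldr Pt.refl q := by
  have key : ∀ ω : List (Fin n),
      (ω.foldr Pt.refl q).1.1 = weylAct A (ZMod e) (A.cs.wordProd ω) q.1.1 := by
    intro ω
    induction ω with
    | nil => simp
    | cons r ω ih =>
      rw [CoxeterSystem.wordProd_cons, weylAct_simple_mul, ← ih]
      rfl
  refine Prod.ext (Subtype.ext ?_) ?_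
  · rw [key, key, h]
  · rw [list_foldr_refl_snd, list_foldr_refl_snd, h]

theorem foldr_refl_altWord {r s : Fin n} (h : r ≠ s) {m : ℕ}
    (hm : coxeterOrder (A.a r s * A.a s r) = m) (q : Pt A i₀) :
    (CoxeterSystem.altWord r s m).foldr Pt.refl q =
      (CoxeterSystem.altWord s r m).foldr Pt.refl q := by
  apply foldr_refl_eq
  have := A.cs.wordProd_altWord_comm r s
  rwa [coxeterMatrixOf_apply A h, hm] at this

/-- The computation behind `rootOp_mul_diag`, with `d` and `d'` for the vectors at a pair and at its
reflection. The factor `y - 2 • y` is the value of the `r`-th root at the reflected point. -/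
theorem smul_step_identity {K V : Type*} [Field K] [AddCommGroup V] [Module K V]
    (P Q y z : K) (a : ℤ) (d d' : V) :
    z • (P • d' + Q • d) = P • ((z - (a : K) • y) • d' - (a : K) • (y - ((2 : ℤ) : K) • y) • d') +
      Q • (z • d - (a : K) • y • d) + (Q * (a * y)) • d := by
  push_cast
  module

theorem ne_of_a_ne_two {r s : Fin n} (h : A.a r s ≠ 2) : r ≠ s := by
  rintro rfl
  exact h (A.diag r)

/-- The operator whose coefficients at a pair `q` are `P` and `Q`, evaluated at `i_r` and at the
value at `q` of the `r`-th root. -/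
def rootOp (P Q : ZMod e → RatF k n → RatF k n) (zv : Pt A i₀ → Fin n → RatF k n) (r : Fin n) :
    Model A k i₀ :=
  stepOp (fun q => P (q.1.1 r) (zv q r)) (fun q => Q (q.1.1 r) (zv q r)) r

variable {P Q : ZMod e → RatF k n → RatF k n} {zv : Pt A i₀ → Fin n → RatF k n}

theorem rootOp_dl {r : Fin n} {q q' : Pt A i₀} {c : ZMod e} {Y : RatF k n}
    (hq : q.refl r = q') (hc : q.1.1 r = c) (hY : zv q r = Y) :
    rootOp P Q zv r (dl k q) = P c Y • dl k q' + Q c Y • dl k q := by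
  subst hq hc hY
  simp [rootOp]

section

variable (hz : ∀ r q, zv (q.refl r) = reflect A r (zv q))
include hz

/-- At `σ_r q` the reflected coordinate has the value of the original one at `q`, so the shifting
part satisfies the commutation exactly. Only the diagonal part `Q` leaves a remainder, which is
diagonal. -/
theorem rootOp_mul_diag (r s : Fin n) :
    rootOp P Q zv r * diag (fun q => zv q s) =
      reflect A r (fun s => diag (fun q => zv q s)) s * rootOp P Q zv r +
        diag fun q => Q (q.1.1 r) (zv q r) * ((A.a s r : RatF k n) * zv q r) := by
  refine model_ext fun q => ?_
  simp only [reflect, Module.End.mul_apply, LinearMap.add_apply, LinearMap.sub_apply,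
    LinearMap.smul_apply, diag_dl, map_smul, rootOp_dl (zv := zv) rfl rfl rfl, map_add, hz, A.diag,
    ← Int.cast_smul_eq_zsmul (RatF k n)]
  exact smul_step_identity _ _ _ _ _ _ _

theorem rootOp_comm {r s : Fin n} (h : A.a r s = 0) :
    rootOp P Q zv r * rootOp P Q zv s = rootOp P Q zv s * rootOp P Q zv r := by
  have h' := A.zero_symm r s h
  refine model_ext fun q => ?_
  have hpt : (q.refl s).refl r = (q.refl r).refl s :=
    foldr_refl_altWord (ne_of_a_ne_two (A := A) (by rw [h]; decide)) (m := 2)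
      (by rw [h, h']; rfl) q
  have c1 : (q.refl s).1.1 r = q.1.1 r := by simp [Pt.refl, Orbit.refl, reflect, h]
  have c2 : (q.refl r).1.1 s = q.1.1 s := by simp [Pt.refl, Orbit.refl, reflect, h']
  have z1 : zv (q.refl s) r = zv q r := by simp [hz, reflect, h]
  have z2 : zv (q.refl r) s = zv q s := by simp [hz, reflect, h']
  simp only [Module.End.mul_apply, rootOp_dl (q := q) rfl rfl rfl, map_add, map_smul,
    rootOp_dl (q := q.refl s) hpt c1 z1, rootOp_dl (q := q.refl r) rfl c2 z2]
  simp only [smul_add, smul_smul, mul_comm]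
  abel

variable (h0 : ∀ q r, zv q r ≠ 0)
include h0

-- The vectors starting with `q.refl r` go to the longest element of the dihedral group, and the
-- remaining ones come back through `q.refl s`. The braid relation of the Weyl group, `hpt`,
-- identifies the two routes to the middle.
variable (P Q) in
theorem cycle3 {r s : Fin n} (h : A.Single r s) (q : Pt A i₀) :
    Cycle3 P Q (rootOp P Q zv r) (rootOp P Q zv s) (diag fun q => zv q r) (diag fun q => zv q s)
      ![dl k q, dl k (q.refl r), dl k ((q.refl r).refl s), dl k (((q.refl r).refl s).refl r),
        dl k ((q.refl s).refl r), dl k (q.refl s)]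
      (q.1.1 r) (q.1.1 s) (q.1.1 r + q.1.1 s) (zv q r) (zv q s) := by
  obtain ⟨h1, h2⟩ := h
  have hpt : ((q.refl s).refl r).refl s = ((q.refl r).refl s).refl r :=
    foldr_refl_altWord (ne_of_a_ne_two (A := A) (by rw [h2]; decide)) (m := 3)
      (by rw [h1, h2]; rfl) q
  have c1 : ∀ q : Pt A i₀, (q.refl r).1.1 r = -q.1.1 r := fun q => by
    simp [Pt.refl, Orbit.refl, reflect, A.diag]; ring
  have c2 : ∀ q : Pt A i₀, (q.refl r).1.1 s = q.1.1 s + q.1.1 r := fun q => by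
    simp [Pt.refl, Orbit.refl, reflect, h2]
  have c3 : ∀ q : Pt A i₀, (q.refl s).1.1 s = -q.1.1 s := fun q => by
    simp [Pt.refl, Orbit.refl, reflect, A.diag]; ring
  have c4 : ∀ q : Pt A i₀, (q.refl s).1.1 r = q.1.1 r + q.1.1 s := fun q => by
    simp [Pt.refl, Orbit.refl, reflect, h1]
  have z1 : ∀ q : Pt A i₀, zv (q.refl r) r = -zv q r := fun q => by
    simp [hz, reflect, A.diag]; ring
  have z2 : ∀ q : Pt A i₀, zv (q.refl r) s = zv q s + zv q r := fun q => by
    simp [hz, reflect, h2]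
  have z3 : ∀ q : Pt A i₀, zv (q.refl s) s = -zv q s := fun q => by
    simp [hz, reflect, A.diag]; ring
  have z4 : ∀ q : Pt A i₀, zv (q.refl s) r = zv q r + zv q s := fun q => by
    simp [hz, reflect, h1]
  have n1 := h0 (q.refl s) r
  rw [z4] at n1
  constructor
  case ne_a => exact h0 q r
  case ne_b => exact h0 q s
  case ne_ab => exact n1
  all_goals
    refine rootOp_dl ?_ ?_ ?_
    · first | rfl | exact Pt.refl_refl _ _ | exact hpt
    · simp only [c1, c2, c3, c4]; try ring
    · simp only [z1, z2, z3, z4]; try ring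

variable (P Q) in
theorem cycle4 {r s : Fin n} (h : A.Double r s) (q : Pt A i₀) :
    Cycle4 P Q (rootOp P Q zv r) (rootOp P Q zv s) (diag fun q => zv q r) (diag fun q => zv q s)
      ![dl k q, dl k (q.refl r), dl k ((q.refl r).refl s), dl k (((q.refl r).refl s).refl r), dl k ((((q.refl r).refl s).refl r).refl s), dl k (((q.refl s).refl r).refl s), dl k ((q.refl s).refl r), dl k (q.refl s)]
      (q.1.1 r) (q.1.1 s) (q.1.1 r + q.1.1 s) (q.1.1 r + 2 * q.1.1 s) (zv q r) (zv q s) := by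
  obtain ⟨h1, h2⟩ := h
  have hpt : (((q.refl s).refl r).refl s).refl r = (((q.refl r).refl s).refl r).refl s :=
    foldr_refl_altWord (ne_of_a_ne_two (A := A) (by rw [h1]; decide)) (m := 4)
      (by rw [h1, h2]; rfl) q
  have c1 : ∀ q : Pt A i₀, (q.refl r).1.1 r = -q.1.1 r := fun q => by
    simp [Pt.refl, Orbit.refl, reflect, A.diag]; ring
  have c2 : ∀ q : Pt A i₀, (q.refl r).1.1 s = q.1.1 s + q.1.1 r := fun q => by
    simp [Pt.refl, Orbit.refl, reflect, h2]
  have c3 : ∀ q : Pt A i₀, (q.refl s).1.1 s = -q.1.1 s := fun q => by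
    simp [Pt.refl, Orbit.refl, reflect, A.diag]; ring
  have c4 : ∀ q : Pt A i₀, (q.refl s).1.1 r = q.1.1 r + 2 * q.1.1 s := fun q => by
    simp [Pt.refl, Orbit.refl, reflect, h1]
  have z1 : ∀ q : Pt A i₀, zv (q.refl r) r = -zv q r := fun q => by
    simp [hz, reflect, A.diag]; ring
  have z2 : ∀ q : Pt A i₀, zv (q.refl r) s = zv q s + zv q r := fun q => by
    simp [hz, reflect, h2]
  have z3 : ∀ q : Pt A i₀, zv (q.refl s) s = -zv q s := fun q => by
    simp [hz, reflect, A.diag]; ring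
  have z4 : ∀ q : Pt A i₀, zv (q.refl s) r = zv q r + 2 * zv q s := fun q => by
    simp [hz, reflect, h1]
  constructor
  case ne_a => exact h0 q r
  case ne_b => exact h0 q s
  case ne_ab =>
    convert h0 (q.refl r) s using 1
    simp only [z1, z2, z3, z4]
    try ring
  case ne_a2b =>
    convert h0 (q.refl s) r using 1
    simp only [z1, z2, z3, z4]
    try ring
  case D0 | D1 =>
    refine (diag_dl _ _).trans (congrArg (· • _) ?_)
    simp only [z1, z2, z3, z4]
    try ring
  all_goals
    refine rootOp_dl ?_ ?_ ?_
    · first | rfl | exact Pt.refl_refl _ _ | exact hpt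
    · simp only [c1, c2, c3, c4]; try ring
    · simp only [z1, z2, z3, z4]; try ring

variable (P Q) in
theorem cycle6 {r s : Fin n} (h : A.Triple r s) (q : Pt A i₀) :
    Cycle6 P Q (rootOp P Q zv r) (rootOp P Q zv s) (diag fun q => zv q r) (diag fun q => zv q s)
      ![dl k q, dl k (q.refl r), dl k ((q.refl r).refl s), dl k (((q.refl r).refl s).refl r), dl k ((((q.refl r).refl s).refl r).refl s), dl k (((((q.refl r).refl s).refl r).refl s).refl r), dl k ((((((q.refl r).refl s).refl r).refl s).refl r).refl s), dl k (((((q.refl s).refl r).refl s).refl r).refl s), dl k ((((q.refl s).refl r).refl s).refl r), dl k (((q.refl s).refl r).refl s), dl k ((q.refl s).refl r), dl k (q.refl s)]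
      (q.1.1 r) (q.1.1 s) (q.1.1 r + q.1.1 s) (q.1.1 r + 2 * q.1.1 s) (q.1.1 r + 3 * q.1.1 s)
      (2 * q.1.1 r + 3 * q.1.1 s) (zv q r) (zv q s) := by
  obtain ⟨h1, h2⟩ := h
  have hpt : (((((q.refl s).refl r).refl s).refl r).refl s).refl r = (((((q.refl r).refl s).refl r).refl s).refl r).refl s :=
    foldr_refl_altWord (ne_of_a_ne_two (A := A) (by rw [h1]; decide)) (m := 6)
      (by rw [h1, h2]; rfl) q
  have c1 : ∀ q : Pt A i₀, (q.refl r).1.1 r = -q.1.1 r := fun q => by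
    simp [Pt.refl, Orbit.refl, reflect, A.diag]; ring
  have c2 : ∀ q : Pt A i₀, (q.refl r).1.1 s = q.1.1 s + q.1.1 r := fun q => by
    simp [Pt.refl, Orbit.refl, reflect, h2]
  have c3 : ∀ q : Pt A i₀, (q.refl s).1.1 s = -q.1.1 s := fun q => by
    simp [Pt.refl, Orbit.refl, reflect, A.diag]; ring
  have c4 : ∀ q : Pt A i₀, (q.refl s).1.1 r = q.1.1 r + 3 * q.1.1 s := fun q => by
    simp [Pt.refl, Orbit.refl, reflect, h1]
  have z1 : ∀ q : Pt A i₀, zv (q.refl r) r = -zv q r := fun q => by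
    simp [hz, reflect, A.diag]; ring
  have z2 : ∀ q : Pt A i₀, zv (q.refl r) s = zv q s + zv q r := fun q => by
    simp [hz, reflect, h2]
  have z3 : ∀ q : Pt A i₀, zv (q.refl s) s = -zv q s := fun q => by
    simp [hz, reflect, A.diag]; ring
  have z4 : ∀ q : Pt A i₀, zv (q.refl s) r = zv q r + 3 * zv q s := fun q => by
    simp [hz, reflect, h1]
  constructor
  case ne_a => exact h0 q r
  case ne_b => exact h0 q s
  case ne_ab =>
    convert h0 (q.refl r) s using 1
    simp only [z1, z2, z3, z4]
    try ring
  case ne_a3b =>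
    convert h0 (q.refl s) r using 1
    simp only [z1, z2, z3, z4]
    try ring
  case ne_a2b =>
    convert h0 ((q.refl s).refl r) s using 1
    simp only [z1, z2, z3, z4]
    try ring
  case ne_aab =>
    convert h0 ((q.refl r).refl s) r using 1
    simp only [z1, z2, z3, z4]
    try ring
  case D0 | D'0 | D1 | D3 | D'3 | D9 | D'9 =>
    refine (diag_dl _ _).trans (congrArg (· • _) ?_)
    simp only [z1, z2, z3, z4]
    try ring
  all_goals
    refine rootOp_dl ?_ ?_ ?_
    · first | rfl | exact Pt.refl_refl _ _ | exact hpt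
    · simp only [c1, c2, c3, c4]; try ring
    · simp only [z1, z2, z3, z4]; try ring

end

end RootOperators

end DegBK

end

/-! ### The operators of the generators and their relations. -/

noncomputable section

namespace DegBK

open MvPolynomial

section Operators

variable {n : ℕ} (A : FiniteCartan n) (k : Type*) [Field k] {e : ℕ}
variable (i₀ : Fin n → ZMod e)

/-- Coordinates are transcendental, hence different from all constants; this keeps `x_r - c` and the
factors `1 - y_r` invertible. -/
theorem xv_ne_algebraMap (q : Pt A i₀) (r : Fin n) (c : k) :
    xv A k i₀ q r ≠ algebraMap k (RatF k n) c := by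
  intro h
  have h1 : X r ≠ C (σ := Fin n) c := fun h => by
    have := congrArg (eval fun _ => c + 1) h
    simp at this
  refine h1 (aeval_xv_injective A k i₀ q ?_)
  rw [aeval_X, h, ← algebraMap_eq, AlgHom.commutes]

theorem xv_ne_zero (q : Pt A i₀) (r : Fin n) : xv A k i₀ q r ≠ 0 := fun h =>
  xv_ne_algebraMap A k i₀ q r 0 (by rw [h, map_zero])

/-- The operators `x_r`. -/
def xOp (r : Fin n) : Model A k i₀ := diag fun q => xv A k i₀ q r

/-- The operators `t_r`. -/
def tOp (r : Fin n) : Model A k i₀ :=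
  rootOp (fun _ Y => 1 - Y⁻¹) (fun _ Y => -Y⁻¹) (xv A k i₀) r

open Classical in
/-- The projections `ε(i)`. -/
def epsOp (i : Orbit A i₀) : Model A k i₀ := diag fun q => if q.1 = i then 1 else 0

variable {A k i₀}

theorem epsOp_dl_self (q : Pt A i₀) : epsOp A k i₀ q.1 (dl k q) = dl k q := by
  simp [epsOp]

theorem epsOp_dl_of_ne {q : Pt A i₀} {i : Orbit A i₀} (h : q.1 ≠ i) :
    epsOp A k i₀ i (dl k q) = 0 := by
  simp [epsOp, h]

theorem mul_epsOp_ext {f g : Model A k i₀} {i : Orbit A i₀}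
    (h : ∀ q : Pt A i₀, q.1 = i → f (dl k q) = g (dl k q)) :
    f * epsOp A k i₀ i = g * epsOp A k i₀ i := by
  refine model_ext fun q => ?_
  rw [Module.End.mul_apply, Module.End.mul_apply]
  by_cases hq : q.1 = i
  · subst hq
    rw [epsOp_dl_self, h q rfl]
  · rw [epsOp_dl_of_ne hq, map_zero, map_zero]

theorem epsOp_mul_self (i : Orbit A i₀) : epsOp A k i₀ i * epsOp A k i₀ i = epsOp A k i₀ i := by
  rw [epsOp, ← map_mul]
  congr 1
  funext q
  simp

theorem epsOp_mul_of_ne {i j : Orbit A i₀} (h : i ≠ j) : epsOp A k i₀ i * epsOp A k i₀ j = 0 := by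
  rw [epsOp, epsOp, ← map_mul, ← map_zero diag]
  congr 1
  funext q
  by_cases h1 : q.1 = i
  · subst h1; simp [h]
  · simp [h1]

theorem sum_epsOp : ∑ i : Orbit A i₀, epsOp A k i₀ i = 1 := by
  simp only [epsOp]
  rw [← map_sum, ← map_one diag]
  congr 1
  funext q
  simp

theorem diag_comm (c d : Pt A i₀ → RatF k n) : diag c * diag d = diag d * diag c := by
  rw [← map_mul, mul_comm, map_mul]

/-- The diagonal part preserves the tuple, whereas the relation demands passage to `σ_r(i)`. It is
harmless when `i_r = 0`, where `σ_r(i) = i`, and has to vanish otherwise, at `i` as well as at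
`σ_r(i)`. -/
theorem rootOp_mul_epsOp {P Q : ZMod e → RatF k n → RatF k n} {zv : Pt A i₀ → Fin n → RatF k n}
    (r : Fin n) (i : Orbit A i₀) (hQ : i.1 r ≠ 0 → ∀ Y, Q (i.1 r) Y = 0)
    (hQ' : i.1 r ≠ 0 → ∀ Y, Q ((i.refl r).1 r) Y = 0) :
    rootOp P Q zv r * epsOp A k i₀ i = epsOp A k i₀ (i.refl r) * rootOp P Q zv r := by
  refine model_ext fun q => ?_
  have h1 : q.1 = i ↔ (q.refl r).1 = i.refl r := by
    constructor
    · rintro rfl; rfl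
    · intro h
      have := congrArg (Orbit.refl r) h
      rwa [Orbit.refl_refl, show (q.refl r).1 = q.1.refl r from rfl, Orbit.refl_refl] at this
  have h2 : i.1 r = 0 → i.refl r = i := fun h => Subtype.ext (funext fun s => by
    simp [Orbit.refl, reflect, h])
  simp only [Module.End.mul_apply, rootOp_dl (zv := zv) rfl rfl rfl, map_add, map_smul]
  by_cases hq : q.1 = i
  · subst hq
    have h3 : epsOp A k i₀ (q.1.refl r) (dl k (q.refl r)) = dl k (q.refl r) :=
      epsOp_dl_self (q.refl r)
    rw [epsOp_dl_self, h3, rootOp_dl (zv := zv) rfl rfl rfl]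
    by_cases h : q.1.1 r = 0
    · rw [h2 h, epsOp_dl_self]
    · rw [hQ h, zero_smul, zero_smul]
  · rw [epsOp_dl_of_ne hq, map_zero, epsOp_dl_of_ne (fun h => hq (h1.2 h)), smul_zero, zero_add]
    by_cases hq2 : q.1 = i.refl r
    · rw [hq2]
      by_cases h : i.1 r = 0
      · rw [h2 h] at hq2
        exact absurd hq2 hq
      · rw [hQ' h, zero_smul]
    · rw [epsOp_dl_of_ne hq2, smul_zero]

theorem diag_intCast (z : ℤ) : diag (fun _ => (z : RatF k n)) = (z : Model A k i₀) :=
  model_ext fun q => by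
    rw [diag_dl, Module.End.intCast_apply, Int.cast_smul_eq_zsmul]

theorem rootOp_sq_dl {P Q : ZMod e → RatF k n → RatF k n} {zv : Pt A i₀ → Fin n → RatF k n}
    (hz : ∀ r q, zv (q.refl r) = reflect A r (zv q)) (r : Fin n) (q : Pt A i₀) :
    (rootOp P Q zv r ^ 2) (dl k q) =
      (P (q.1.1 r) (zv q r) * P (-q.1.1 r) (-zv q r) + Q (q.1.1 r) (zv q r) ^ 2) • dl k q +
      (P (q.1.1 r) (zv q r) * (Q (-q.1.1 r) (-zv q r) + Q (q.1.1 r) (zv q r))) •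
        dl k (q.refl r) := by
  have h : zv (q.refl r) r = -zv q r := by
    simp [hz, reflect, A.diag]; ring
  have h' : (q.refl r).1.1 r = -q.1.1 r := by
    simp [Pt.refl, Orbit.refl, reflect, A.diag]; ring
  simp only [pow_two, Module.End.mul_apply, rootOp_dl (q := q) rfl rfl rfl, map_add, map_smul,
    rootOp_dl (q := q.refl r) (Pt.refl_refl r q) h' h, smul_add, add_smul, mul_smul, mul_add,
    smul_comm (Q (q.1.1 r) (zv q r)) (P (q.1.1 r) (zv q r))]
  abel

theorem tOp_sq (r : Fin n) : tOp A k i₀ r ^ 2 = 1 := by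
  refine model_ext fun q => ?_
  rw [tOp, rootOp_sq_dl (xv_refl A k i₀), inv_neg, neg_neg, add_neg_cancel, mul_zero, zero_smul,
    add_zero, Module.End.one_apply]
  convert one_smul (RatF k n) (dl k q)
  ring

theorem tOp_comm {r s : Fin n} (h : A.a r s = 0) :
    tOp A k i₀ r * tOp A k i₀ s = tOp A k i₀ s * tOp A k i₀ r :=
  rootOp_comm (xv_refl A k i₀) h

theorem tOp_single {r s : Fin n} (h : A.Single r s) :
    tOp A k i₀ r * tOp A k i₀ s * tOp A k i₀ r = tOp A k i₀ s * tOp A k i₀ r * tOp A k i₀ s := by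
  refine model_ext fun q => ?_
  have key := (cycle3 (fun _ Y => 1 - Y⁻¹) (fun _ Y => -Y⁻¹) (xv_refl A k i₀)
    (xv_ne_zero A k i₀) h q).hecke (fun _ _ => rfl) fun _ _ => rfl
  simpa only [tOp, Matrix.cons_val_zero, Module.End.mul_apply] using key

theorem tOp_double {r s : Fin n} (h : A.Double r s) :
    (tOp A k i₀ r * tOp A k i₀ s) ^ 2 = (tOp A k i₀ s * tOp A k i₀ r) ^ 2 := by
  refine model_ext fun q => ?_
  have key := (cycle4 (fun _ Y => 1 - Y⁻¹) (fun _ Y => -Y⁻¹) (xv_refl A k i₀)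
    (xv_ne_zero A k i₀) h q).hecke (fun _ _ => rfl) fun _ _ => rfl
  simpa only [tOp, Matrix.cons_val_zero, pow_two, Module.End.mul_apply] using key

theorem tOp_triple {r s : Fin n} (h : A.Triple r s) :
    (tOp A k i₀ r * tOp A k i₀ s) ^ 3 = (tOp A k i₀ s * tOp A k i₀ r) ^ 3 := by
  refine model_ext fun q => ?_
  have key := (cycle6 (fun _ Y => 1 - Y⁻¹) (fun _ Y => -Y⁻¹) (xv_refl A k i₀)
    (xv_ne_zero A k i₀) h q).hecke (fun _ _ => rfl) fun _ _ => rfl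
  simpa only [tOp, Matrix.cons_val_zero, pow_three, Module.End.mul_apply] using key

theorem tOp_mul_xOp (r s : Fin n) :
    tOp A k i₀ r * xOp A k i₀ s =
      reflect A r (xOp A k i₀) s * tOp A k i₀ r + ((-A.a s r : ℤ) : Model A k i₀) := by
  refine (rootOp_mul_diag (xv_refl A k i₀) r s).trans ?_
  congr 1
  rw [← diag_intCast]
  congr 1
  funext q
  have := xv_ne_zero A k i₀ q r
  rw [Int.cast_neg]
  field_simp

/-- The operators `x_r` and `t_r` satisfy the relations of the degenerate affine Hecke algebra. -/
theorem heckeRel_model {a b : Model A k i₀} (h : HeckeRel A (xOp A k i₀) (tOp A k i₀) a b) :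
    a = b := by
  cases h with
  | x_comm r s => exact diag_comm _ _
  | t_x r s => exact tOp_mul_xOp r s
  | t_sq r => exact tOp_sq r
  | t_comm r s h => exact tOp_comm h
  | t_single r s h => exact tOp_single h
  | t_double r s h => exact tOp_double h
  | t_triple r s h => exact tOp_triple h

/-- Matches a case distinction between vectors, as in the cycle identities, with one between
operators, branch by branch and for any decision procedures. -/
theorem ite_eq_ite_apply {R V : Type*} [Semiring R] [AddCommMonoid V] [Module R V] {c : Prop}
    {i i' : Decidable c} {a b v : V} {f g : Module.End R V} (h1 : a = f v) (h2 : b = g v) :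
    @ite V c i a b = @ite (Module.End R V) c i' f g v := by
  split_ifs <;> assumption

section Psi

variable [CharP k e]

variable (A k i₀)

/-- The values of the `y_r`. -/
def yv (q : Pt A i₀) (r : Fin n) : RatF k n :=
  xv A k i₀ q r - algebraMap k (RatF k n) (point k q.1.1 r)

theorem reflect_sub {V : Type*} [AddCommGroup V] (r : Fin n) (v w : Fin n → V) (s : Fin n) :
    reflect A r (fun s => v s - w s) s = reflect A r v s - reflect A r w s := by
  simp only [reflect, smul_sub]
  abel

theorem point_refl (r : Fin n) (i : Orbit A i₀) :
    point k (i.refl r).1 = reflect A r (point k i.1) :=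
  (reflect_map A (ZMod.castHom (dvd_refl e) k).toAddMonoidHom r i.1).symm

theorem yv_refl (r : Fin n) (q : Pt A i₀) : yv A k i₀ (q.refl r) = reflect A r (yv A k i₀ q) := by
  funext s
  unfold yv
  rw [reflect_sub, xv_refl]
  congr 1
  have := reflect_map A (algebraMap k (RatF k n)).toAddMonoidHom r (point k q.1.1)
  rw [← point_refl A k i₀] at this
  exact (congrFun this s).symm

theorem yv_ne_algebraMap (q : Pt A i₀) (r : Fin n) (c : k) :
    yv A k i₀ q r ≠ algebraMap k (RatF k n) c := fun h =>
  xv_ne_algebraMap A k i₀ q r (c + point k q.1.1 r) (by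
    rw [map_add, ← h, yv, sub_add_cancel])

theorem yv_ne_zero (q : Pt A i₀) (r : Fin n) : yv A k i₀ q r ≠ 0 := fun h =>
  yv_ne_algebraMap A k i₀ q r 0 (by rw [h, map_zero])

/-- The operators `y_r`. -/
def yOp (r : Fin n) : Model A k i₀ := diag fun q => yv A k i₀ q r

/-- The operators `ψ_r`. -/
def psiOp (r : Fin n) : Model A k i₀ := rootOp psiP psiQ (yv A k i₀) r

instance : CharP (RatF k n) e :=
  charP_of_injective_algebraMap (algebraMap k (RatF k n)).injective e

variable {A k i₀}

theorem psiOp_mul_yOp (r s : Fin n) (i : Orbit A i₀) :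
    psiOp A k i₀ r * yOp A k i₀ s * epsOp A k i₀ i =
      (reflect A r (yOp A k i₀) s * psiOp A k i₀ r +
        if i.1 r = 0 then ((-A.a s r : ℤ) : Model A k i₀) else 0) * epsOp A k i₀ i := by
  refine mul_epsOp_ext fun q hq => ?_
  have h : psiOp A k i₀ r * yOp A k i₀ s = _ := rootOp_mul_diag (yv_refl A k i₀) r s
  rw [h, LinearMap.add_apply, LinearMap.add_apply]
  congr 1
  rw [diag_dl]
  subst hq
  have hY := yv_ne_zero A k i₀ q r
  split_ifs with h0
  · rw [h0, psiQ_zero, ← diag_intCast, diag_dl]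
    congr 1
    rw [Int.cast_neg]
    field_simp
  · rw [psiQ_of_ne h0, zero_mul, zero_smul]
    rfl

theorem psiOp_sq (r : Fin n) (i : Orbit A i₀) :
    psiOp A k i₀ r ^ 2 * epsOp A k i₀ i = sqCoeff (yOp A k i₀) r i.1 * epsOp A k i₀ i := by
  refine mul_epsOp_ext fun q hq => ?_
  subst hq
  rw [psiOp, rootOp_sq_dl (yv_refl A k i₀)]
  have hY := yv_ne_zero A k i₀ q r
  have h1 := yv_ne_algebraMap A k i₀ q r 1
  have hd : IsDomain (ZMod e) := ZMod.isDomain_of_charP k e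
  have hy : yOp A k i₀ r (dl k q) = yv A k i₀ q r • dl k q := diag_dl _ _
  rw [map_one] at h1
  by_cases c0 : q.1.1 r = 0
  · rw [c0, neg_zero, psiP_zero, psiP_zero, psiQ_zero, psiQ_zero, sqCoeff, if_pos c0, inv_neg,
      neg_neg, add_neg_cancel, mul_zero, zero_smul, add_zero, LinearMap.zero_apply]
    convert zero_smul (RatF k n) (dl k q)
    ring
  rw [psiQ_of_ne c0, psiQ_of_ne (neg_ne_zero.2 c0), add_zero, mul_zero, zero_smul, add_zero,
    zero_pow two_ne_zero, add_zero, sqCoeff, if_neg c0]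
  have hv := oneSub_ne_zero (K := RatF k n)
  by_cases he : e = 2
  · subst he
    have c1 : q.1.1 r = 1 := (show ∀ c : ZMod 2, c ≠ 0 → c = 1 by decide) _ c0
    rw [c1, if_pos rfl, if_pos rfl]
    have h1 : ∀ Y : RatF k n, psiP (1 : ZMod 2) Y = Y := fun Y => by simp [psiP]
    rw [show (-1 : ZMod 2) = 1 by decide, h1, h1, LinearMap.neg_apply, pow_two,
      Module.End.mul_apply, hy, map_smul, hy, smul_smul, ← neg_smul]
    congr 1
    ring
  have h2 : (2 : ZMod e) ≠ 0 := by
    simpa using ZMod.natCast_ne_zero_of_prime_ne (p := e) k Nat.prime_two he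
  by_cases c1 : q.1.1 r = 1
  · rw [c1, if_pos rfl, if_neg he, psiP_one he, psiP_neg_one h2, LinearMap.neg_apply, hy,
      ← neg_smul]
    congr 1
    have := hv (-yv A k i₀ q r)
    field_simp
  rw [if_neg c1]
  by_cases c2 : q.1.1 r = -1
  · rw [c2, if_pos rfl, neg_neg, psiP_one he, psiP_neg_one h2, neg_neg, hy]
    congr 1
    have := hv (yv A k i₀ q r)
    field_simp
  rw [if_neg c2, psiP_of_ne c0 c1 c2, psiP_of_ne (neg_ne_zero.2 c0)
    (fun q => c2 (by rw [← q, neg_neg])) (fun q => c1 (neg_injective q)), one_mul, one_smul]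
  rfl

theorem psiOp_comm {r s : Fin n} (h : A.a r s = 0) :
    psiOp A k i₀ r * psiOp A k i₀ s = psiOp A k i₀ s * psiOp A k i₀ r :=
  rootOp_comm (yv_refl A k i₀) h

theorem psiOp_single {r s : Fin n} (h : A.Single r s) (i : Orbit A i₀) :
    (psiOp A k i₀ r * psiOp A k i₀ s * psiOp A k i₀ r -
      psiOp A k i₀ s * psiOp A k i₀ r * psiOp A k i₀ s) * epsOp A k i₀ i =
      singleRHS (yOp A k i₀) r s i.1 * epsOp A k i₀ i := by
  refine mul_epsOp_ext fun q hq => ?_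
  subst hq
  have key := (cycle3 psiP psiQ (yv_refl A k i₀) (yv_ne_zero A k i₀) h q).psi
  have hy : ∀ r, yOp A k i₀ r (dl k q) = yv A k i₀ q r • dl k q := fun _ => diag_dl _ _
  simp only [Matrix.cons_val_zero] at key
  unfold singleRHS
  simp only [psiOp, Module.End.mul_apply, LinearMap.sub_apply]
  rw [key]
  repeat' refine ite_eq_ite_apply ?_ ?_
  all_goals simp [hy, sub_smul]

theorem psiOp_double {r s : Fin n} (h : A.Double r s) (i : Orbit A i₀) :
    ((psiOp A k i₀ r * psiOp A k i₀ s) ^ 2 - (psiOp A k i₀ s * psiOp A k i₀ r) ^ 2) *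
      epsOp A k i₀ i = doubleRHS (yOp A k i₀) (psiOp A k i₀) r s i.1 * epsOp A k i₀ i := by
  refine mul_epsOp_ext fun q hq => ?_
  subst hq
  have key := (cycle4 psiP psiQ (yv_refl A k i₀) (yv_ne_zero A k i₀) h q).psi
  simp only [Matrix.cons_val_zero] at key
  unfold doubleRHS yOp
  simp only [psiOp, pow_two, Module.End.mul_apply, LinearMap.sub_apply]
  rw [key]
  have h2 : ∀ v : ModelSpace A k i₀, (2 : Model A k i₀) v = (2 : RatF k n) • v := fun v =>
    (Module.End.ofNat_apply 2 v).trans (ofNat_smul_eq_nsmul (RatF k n) 2 v).symm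
  clear key
  generalize rootOp psiP psiQ (yv A k i₀) r = T
  generalize rootOp psiP psiQ (yv A k i₀) s = S
  generalize dl k q = v at *
  repeat' refine ite_eq_ite_apply ?_ ?_
  all_goals simp [h2]

theorem psiOp_triple {r s : Fin n} (h : A.Triple r s) (i : Orbit A i₀) :
    ((psiOp A k i₀ r * psiOp A k i₀ s) ^ 3 - (psiOp A k i₀ s * psiOp A k i₀ r) ^ 3) *
      epsOp A k i₀ i = tripleRHS (yOp A k i₀) (psiOp A k i₀) r s i.1 * epsOp A k i₀ i := by
  refine mul_epsOp_ext fun q hq => ?_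
  subst hq
  have key := (cycle6 psiP psiQ (yv_refl A k i₀) (yv_ne_zero A k i₀) h q).psi
  simp only [Matrix.cons_val_zero] at key
  unfold tripleRHS yOp
  simp only [psiOp, pow_three, Module.End.mul_apply, LinearMap.sub_apply]
  rw [key]
  have hr : diag (fun q => yv A k i₀ q r) (dl k q) = yv A k i₀ q r • dl k q := diag_dl _ _
  have hs : diag (fun q => yv A k i₀ q s) (dl k q) = yv A k i₀ q s • dl k q := diag_dl _ _
  clear key
  generalize rootOp psiP psiQ (yv A k i₀) r = T
  generalize rootOp psiP psiQ (yv A k i₀) s = S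
  generalize diag (fun q => yv A k i₀ q r) = D at *
  generalize diag (fun q => yv A k i₀ q s) = D' at *
  have h2 : ∀ v : ModelSpace A k i₀, (2 : Model A k i₀) v = (2 : RatF k n) • v := fun v =>
    (Module.End.ofNat_apply 2 v).trans (ofNat_smul_eq_nsmul (RatF k n) 2 v).symm
  have h3 : ∀ v : ModelSpace A k i₀, (3 : Model A k i₀) v = (3 : RatF k n) • v := fun v =>
    (Module.End.ofNat_apply 3 v).trans (ofNat_smul_eq_nsmul (RatF k n) 3 v).symm
  generalize dl k q = v at *
  repeat' refine ite_eq_ite_apply ?_ ?_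
  all_goals simp [h2, h3, pow_two, smul_smul, hr, hs]

end Psi

end Operators

end DegBK

end

/-! ### Polynomial evaluation at commuting elements and the faithfulness criterion. -/

noncomputable section

namespace DegBK

open MvPolynomial

section Evaluation

variable {k R : Type*} [Field k] [Ring R] [Algebra k R] {n : ℕ}

/-- Evaluation of polynomials at commuting elements is an algebra homomorphism. -/
def evHom {z : Fin n → R} (hz : ∀ r s, z r * z s = z s * z r) : MvPolynomial (Fin n) k →ₐ[k] R :=
  letI : CommRing (Algebra.adjoin k (Set.range z)) :=
    { (Algebra.adjoin k (Set.range z)).toRing with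
      mul_comm := (Algebra.isMulCommutative_adjoin k (by
        rintro _ ⟨r, rfl⟩ _ ⟨s, rfl⟩
        exact hz r s)).is_comm.comm }
  (Algebra.adjoin k (Set.range z)).val.comp
    (aeval fun r => (⟨z r, Algebra.subset_adjoin ⟨r, rfl⟩⟩ : Algebra.adjoin k (Set.range z)))

theorem evHom_X {z : Fin n → R} (hz : ∀ r s, z r * z s = z s * z r) (r : Fin n) :
    evHom (k := k) hz (X r) = z r := by
  simp [evHom]

theorem map_ev {S F : Type*} [Ring S] [Algebra k S] [FunLike F R S] [AlgHomClass F k R S] (φ : F)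
    (z : Fin n → R) (f : MvPolynomial (Fin n) k) : φ (ev z f) = ev (fun r => φ (z r)) f := by
  simp only [ev, map_sum, map_smul, map_list_prod, List.map_ofFn]
  congr! with m hm r
  simp

theorem ev_eq_aeval {S : Type*} [CommRing S] [Algebra k S] (z : Fin n → S)
    (f : MvPolynomial (Fin n) k) : ev z f = aeval z f := by
  rw [aeval_def, eval₂_eq', ev]
  refine Finset.sum_congr rfl fun m _ => ?_
  rw [List.prod_ofFn, Algebra.smul_def]

theorem evHom_apply {z : Fin n → R} (hz : ∀ r s, z r * z s = z s * z r)
    (f : MvPolynomial (Fin n) k) : evHom hz f = ev z f := by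
  have h1 : f = ev X f := by rw [ev_eq_aeval, aeval_X_left_apply]
  conv_lhs => rw [h1]
  rw [map_ev]
  simp only [evHom_X]

section Commuting

variable {z : Fin n → R} (hz : ∀ r s, z r * z s = z s * z r)

include hz

theorem ev_X (r : Fin n) : ev z (X r : MvPolynomial (Fin n) k) = z r := by
  rw [← evHom_apply hz, evHom_X]

theorem ev_mul (f g : MvPolynomial (Fin n) k) : ev z (f * g) = ev z f * ev z g := by
  rw [← evHom_apply hz, map_mul, evHom_apply, evHom_apply]

theorem ev_add (f g : MvPolynomial (Fin n) k) : ev z (f + g) = ev z f + ev z g := by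
  rw [← evHom_apply hz, map_add, evHom_apply, evHom_apply]

theorem ev_C (c : k) : ev z (C c : MvPolynomial (Fin n) k) = algebraMap k R c := by
  rw [← evHom_apply hz, ← algebraMap_eq, AlgHom.commutes]

theorem ev_sub (f g : MvPolynomial (Fin n) k) : ev z (f - g) = ev z f - ev z g := by
  rw [← evHom_apply hz, map_sub, evHom_apply, evHom_apply]

theorem ev_one : ev z (1 : MvPolynomial (Fin n) k) = 1 := by
  rw [← evHom_apply hz, map_one]

theorem ev_comm (f g : MvPolynomial (Fin n) k) : ev z f * ev z g = ev z g * ev z f := by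
  rw [← ev_mul hz, mul_comm, ev_mul hz]

end Commuting

theorem commute_ev {z : Fin n → R} {a : R} (h : ∀ r, Commute a (z r))
    (f : MvPolynomial (Fin n) k) : Commute a (ev z f) := by
  refine Commute.sum_right _ _ _ fun m _ => Commute.smul_right ?_ _
  refine Commute.list_prod_right _ _ fun b hb => ?_
  obtain ⟨r, rfl⟩ := (List.mem_ofFn' _ _).1 hb
  exact (h r).pow_right _

end Evaluation

section Generation

open CoxeterSystem

variable {k R : Type*} [Field k] [Ring R] [Algebra k R]

/-- The condition is stable under sums and products of the elements being moved, so generators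
suffice. -/
theorem normalizes_adjoin {I : Type*} {τ : I → R} {S : Set R}
    (h : ∀ i, ∀ s ∈ S, ∃ b ∈ Algebra.adjoin k S, ∃ b' ∈ Algebra.adjoin k S,
      s * τ i = τ i * b + b') : Normalizes (Algebra.adjoin k S).toSubring τ := by
  intro i b hb
  induction (show b ∈ Algebra.adjoin k S from hb) using Algebra.adjoin_induction with
  | mem s hs => exact h i s hs
  | algebraMap c =>
    exact ⟨_, Subalgebra.algebraMap_mem _ c, 0, Subalgebra.zero_mem _, by
      rw [add_zero, Algebra.commutes]⟩
  | add x y hx hy ihx ihy =>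
    obtain ⟨b1, h1, b2, h2, e⟩ := ihx hx
    obtain ⟨c1, h1', c2, h2', e'⟩ := ihy hy
    exact ⟨_, add_mem h1 h1', _, add_mem h2 h2', by rw [add_mul, e, e', mul_add]; abel⟩
  | mul x y hx hy ihx ihy =>
    obtain ⟨b1, h1, b2, h2, e⟩ := ihx hx
    obtain ⟨c1, h1', c2, h2', e'⟩ := ihy hy
    refine ⟨_, mul_mem h1 h1', _, add_mem (mul_mem h2 h1') (mul_mem hx h2'), ?_⟩
    rw [mul_assoc, e', mul_add, ← mul_assoc, e, add_mul, mul_assoc, add_assoc]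

variable {n : ℕ} {A : FiniteCartan n}

/-- The presentations state the braid relation only in the direction of the arrow; the opposite
orientation is obtained by a change of sign. -/
theorem braidModLower_of_edges {B : Subring R} {τ : Fin n → R}
    (h0 : ∀ r s, A.a r s = 0 → τ r * τ s - τ s * τ r ∈ wordSpan B τ 2)
    (h1 : ∀ r s, A.Single r s → τ r * τ s * τ r - τ s * τ r * τ s ∈ wordSpan B τ 3)
    (h2 : ∀ r s, A.Double r s → (τ r * τ s) ^ 2 - (τ s * τ r) ^ 2 ∈ wordSpan B τ 4)
    (h3 : ∀ r s, A.Triple r s → (τ r * τ s) ^ 3 - (τ s * τ r) ^ 3 ∈ wordSpan B τ 6) :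
    BraidModLower (M := coxeterMatrixOf A.a) B τ := by
  intro r s hrs
  rw [coxeterMatrixOf_apply A hrs]
  rcases A.cases_of_ne hrs with h | h | h | h | h | h
  · have := h0 r s h.1
    rw [h.1, h.2]
    simpa [coxeterOrder, altWord] using this
  · have := h1 r s h
    rw [h.1, h.2]
    simpa [coxeterOrder, altWord, mul_assoc] using this
  · have := h2 r s h
    rw [h.1, h.2]
    simpa [coxeterOrder, altWord, pow_two, mul_assoc] using this
  · have := neg_mem (h2 s r h)
    rw [h.1, h.2]
    simpa [coxeterOrder, altWord, pow_two, mul_assoc] using this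
  · have := h3 r s h
    rw [h.1, h.2]
    simpa [coxeterOrder, altWord, pow_three, mul_assoc] using this
  · have := neg_mem (h3 s r h)
    rw [h.1, h.2]
    simpa [coxeterOrder, altWord, pow_three, mul_assoc] using this

theorem closure_adjoin_union_eq_top {I : Type*} {τ : I → R} {S : Set R}
    (h : Algebra.adjoin k (S ∪ Set.range τ) = ⊤) :
    Subring.closure (((Algebra.adjoin k S).toSubring : Set R) ∪ Set.range τ) = ⊤ := by
  rw [eq_top_iff]
  intro a _
  have ha : a ∈ Algebra.adjoin k (S ∪ Set.range τ) := h ▸ Algebra.mem_top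
  induction ha using Algebra.adjoin_induction with
  | mem s hs =>
    rcases hs with hs | hs
    · exact Subring.subset_closure (Or.inl (Algebra.subset_adjoin hs))
    · exact Subring.subset_closure (Or.inr hs)
  | algebraMap c => exact Subring.subset_closure (Or.inl (Subalgebra.algebraMap_mem _ c))
  | add x y _ _ ihx ihy => exact add_mem (ihx trivial) (ihy trivial)
  | mul x y _ _ ihx ihy => exact mul_mem (ihx trivial) (ihy trivial)

variable {k' : Type*} [Field k'] {e : ℕ} {i₀ : Fin n → ZMod e}

/-- A faithfulness criterion: a ring spanned by words in elements `τ_r` over a subring `B` acts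
faithfully on the model if `B` does so. -/
theorem eq_zero_of_map_mul_diag {B : Subring R} {τ : Fin n → R} (φ : R →+* Model A k' i₀)
    {P Q : Fin n → Pt A i₀ → RatF k' n} (hP : ∀ r q, P r q ≠ 0)
    (hφ : ∀ r, φ (τ r) = stepOp (P r) (Q r) r) (hB : Normalizes B τ)
    (hsq : ∀ r, ∃ b ∈ B, ∃ b' ∈ B, τ r * τ r = τ r * b + b')
    (hbraid : BraidModLower (M := coxeterMatrixOf A.a) B τ)
    (hgen : Subring.closure (B ∪ Set.range τ) = ⊤) (χ : Pt A i₀ → RatF k' n)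
    (hχ : ∀ b ∈ B, ∃ d, φ b = diag d ∧ (d * χ = 0 → b = 0)) {a : R}
    (ha : φ a * diag χ = 0) : a = 0 := by
  have : Fintype A.W := Fintype.ofFinite _
  choose red hlen hred using fun w => A.cs.exists_isReduced w
  have hred' : ∀ w, A.cs.IsReduced (red w) ∧ A.cs.wordProd (red w) = w := fun w =>
    ⟨hlen w, (hred w).symm⟩
  obtain ⟨c, hc, rfl⟩ := exists_eq_sum_word (hasExactOrders A) hB hsq hbraid hgen hred' a
  choose d hd hd' using fun w => hχ (c w) (hc w)
  -- The factor `χ` is absorbed into the diagonal coefficients. Taking for `χ` the indicator of a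
  -- tuple yields faithfulness over that tuple alone, and `χ = 1` gives ordinary faithfulness.
  have key : (fun w => d w * χ) = 0 := by
    refine eq_zero_of_sum_word (P := P) (Q := Q) hP hred' ?_
    rw [map_sum, Finset.sum_mul] at ha
    rw [← ha]
    refine Finset.sum_congr rfl fun w _ => ?_
    rw [map_mul φ, hd, map_mul diag, map_list_prod, List.map_map, ← mul_assoc]
    congr! 4
    funext r
    exact (hφ r).symm
  refine Finset.sum_eq_zero fun w _ => ?_
  rw [hd' w (congrFun key w), mul_zero]

end Generation

end DegBK

end

/-! ### The action of H and of H_F on the model. -/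

noncomputable section

namespace DegBK

open MvPolynomial CoxeterSystem TensorProduct

section Instances

variable {n : ℕ} (A : FiniteCartan n) (k : Type*) [Field k]

scoped instance : Algebra (invariants A k) (InvField A k) := OreLocalization.instAlgebra
scoped instance : Module (invariants A k) (InvField A k) := Algebra.toModule
scoped instance : Semiring (HeckeF A k) := Algebra.TensorProduct.instSemiring
scoped instance : Ring (HeckeF A k) := Algebra.TensorProduct.instRing
scoped instance : Algebra k (HeckeF A k) := Algebra.TensorProduct.leftAlgebra

end Instances

section HeckeModel

variable {n : ℕ} {A : FiniteCartan n}

theorem map_reflect {R S F : Type*} [Ring R] [Ring S] [FunLike F R S] [RingHomClass F R S] (φ : F)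
    (r : Fin n) (v : Fin n → R) (s : Fin n) :
    φ (reflect A r v s) = reflect A r (fun s => φ (v s)) s := by
  simp [reflect]

theorem HeckeRel.map {R S : Type*} [Ring R] [Ring S] (φ : R →+* S) {x t : Fin n → R} {a b : R}
    (h : HeckeRel A x t a b) :
    HeckeRel A (fun r => φ (x r)) (fun r => φ (t r)) (φ a) (φ b) := by
  cases h with
  | x_comm r s => simpa using HeckeRel.x_comm r s
  | t_x r s =>
    simpa [map_reflect] using HeckeRel.t_x (A := A) (x := fun r => φ (x r)) (t := fun r => φ (t r))
      r s
  | t_sq r => simpa using HeckeRel.t_sq r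
  | t_comm r s h => simpa using HeckeRel.t_comm r s h
  | t_single r s h => simpa using HeckeRel.t_single r s h
  | t_double r s h => simpa using HeckeRel.t_double r s h
  | t_triple r s h => simpa using HeckeRel.t_triple r s h

/-- Meant for a quotient map `φ` from a free algebra: relations between the images of the generators
are the images of the defining relations. -/
theorem HeckeRel.eq_of_map {R S : Type*} [Ring R] [Ring S] {x t : Fin n → R} (φ : R →+* S)
    (key : ∀ a b, HeckeRel A x t a b → φ a = φ b) {a b : S}
    (hab : HeckeRel A (fun r => φ (x r)) (fun r => φ (t r)) a b) : a = b := by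
  cases hab with
  | x_comm r s => simpa using key _ _ (HeckeRel.x_comm r s)
  | t_x r s => simpa [map_reflect] using key _ _ (HeckeRel.t_x r s)
  | t_sq r => simpa using key _ _ (HeckeRel.t_sq r)
  | t_comm r s h => simpa using key _ _ (HeckeRel.t_comm r s h)
  | t_single r s h => simpa using key _ _ (HeckeRel.t_single r s h)
  | t_double r s h => simpa using key _ _ (HeckeRel.t_double r s h)
  | t_triple r s h => simpa using key _ _ (HeckeRel.t_triple r s h)

theorem Hecke.rel {k : Type*} [Field k] {a b : Hecke A k}
    (h : HeckeRel A (Hecke.x A k) (Hecke.t A k) a b) : a = b :=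
  HeckeRel.eq_of_map (Hecke.mk A k).toRingHom (fun _ _ h => RingQuot.mkAlgHom_rel k h) h

theorem Hecke.adjoin_eq_top (k : Type*) [Field k] :
    Algebra.adjoin k (Set.range (Hecke.x A k) ∪ Set.range (Hecke.t A k)) = ⊤ := by
  rw [eq_top_iff]
  intro a _
  obtain ⟨a, rfl⟩ := RingQuot.mkAlgHom_surjective k _ a
  clear * -
  change Hecke.mk A k a ∈ _
  induction a using FreeAlgebra.induction with
  | grade0 c => rw [AlgHom.commutes]; exact Subalgebra.algebraMap_mem _ c
  | grade1 g =>
    cases g with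
    | x r => exact Algebra.subset_adjoin (Or.inl ⟨r, rfl⟩)
    | t r => exact Algebra.subset_adjoin (Or.inr ⟨r, rfl⟩)
  | mul a b ha hb => rw [map_mul]; exact mul_mem ha hb
  | add a b ha hb => rw [map_add]; exact add_mem ha hb

variable (A) (k : Type*) [Field k] {e : ℕ} (i₀ : Fin n → ZMod e)

/-- The action of the degenerate affine Hecke algebra on the model. -/
def heckeModel : Hecke A k →ₐ[k] Model A k i₀ :=
  RingQuot.liftAlgHom k ⟨FreeAlgebra.lift k fun g : HeckeGen n => match g with
    | .x r => xOp A k i₀ r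
    | .t r => tOp A k i₀ r, fun a b h => heckeRel_model <| by
      simpa using h.map (FreeAlgebra.lift k fun g : HeckeGen n => match g with
        | .x r => xOp A k i₀ r
        | .t r => tOp A k i₀ r).toRingHom⟩

theorem heckeModel_x (r : Fin n) : heckeModel A k i₀ (Hecke.x A k r) = xOp A k i₀ r :=
  (RingQuot.liftAlgHom_mkAlgHom_apply k _ _ _).trans (FreeAlgebra.lift_ι_apply _ _)

theorem heckeModel_t (r : Fin n) : heckeModel A k i₀ (Hecke.t A k r) = tOp A k i₀ r :=
  (RingQuot.liftAlgHom_mkAlgHom_apply k _ _ _).trans (FreeAlgebra.lift_ι_apply _ _)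

variable {A k i₀}

theorem ev_diag (d : Fin n → Pt A i₀ → RatF k n) (f : MvPolynomial (Fin n) k) :
    ev (fun r => diag (A := A) (i₀ := i₀) (d r)) f = diag fun q => aeval (fun r => d r q) f := by
  have h := map_ev ((diag (A := A) (k := k) (i₀ := i₀)).restrictScalars k) d f
  refine h.symm.trans (congrArg diag (funext fun q => ?_))
  have h' := map_ev (Pi.evalAlgHom k (fun _ : Pt A i₀ => RatF k n) q) d f
  exact h'.trans (ev_eq_aeval _ _)

theorem ev_xOp (f : MvPolynomial (Fin n) k) :
    ev (xOp A k i₀) f = diag fun q => aeval (xv A k i₀ q) f :=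
  ev_diag (fun r q => xv A k i₀ q r) f

theorem poly_eq_ev (f : MvPolynomial (Fin n) k) : Hecke.poly A k f = ev (Hecke.x A k) f := by
  conv_lhs => rw [← aeval_X_left_apply f, ← ev_eq_aeval, map_ev]
  simp only [Hecke.poly_X]

theorem diag_const (c : RatF k n) : diag (fun _ => c) = algebraMap (RatF k n) (Model A k i₀) c :=
  model_ext fun q => by simp

theorem heckeModel_poly (f : MvPolynomial (Fin n) k) :
    heckeModel A k i₀ (Hecke.poly A k f) = diag fun q => aeval (xv A k i₀ q) f := by
  rw [poly_eq_ev, map_ev]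
  simp only [heckeModel_x]
  exact ev_xOp f

/-- All points of the model are Weyl group conjugates of one point, so an invariant polynomial takes
the same value at each of them. This makes the action of H linear over Z and lets it extend to H_F,
with F acting by scalars. -/
theorem algebraMap_invariants_model (z : invariants A k) :
    algebraMap (invariants A k) (Model A k i₀) z = diag fun q => aeval (xv A k i₀ q) z.1 := by
  rw [IsScalarTower.algebraMap_apply (invariants A k) (RatF k n) (Model A k i₀), ← diag_const]
  congr 1
  funext q
  rw [xv, aeval_weylAct_of_mem_invariants A k _ _ z.2]
  have : (aeval fun r => algebraMap (MvPolynomial (Fin n) k) (RatF k n) (X r)) =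
      IsScalarTower.toAlgHom k (MvPolynomial (Fin n) k) (RatF k n) := by
    ext r; simp
  rw [this]
  rfl

variable (A k i₀)

/-- The inclusion of the field `F` of invariant rational functions in `K`. -/
def invFieldHom : InvField A k →ₐ[invariants A k] RatF k n :=
  IsFractionRing.liftAlgHom (g := Algebra.ofId (invariants A k) (RatF k n)) (by
    have := FaithfulSMul.algebraMap_injective (MvPolynomial (Fin n) k) (RatF k n)
    exact this.comp Subtype.val_injective)

/-- The action of `H` on the model is linear over the invariants. -/
def heckeModelZ : Hecke A k →ₐ[invariants A k] Model A k i₀ :=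
  { heckeModel A k i₀ with
    commutes' := fun z => (heckeModel_poly z.1).trans (algebraMap_invariants_model z).symm }

/-- The action of `F` on the model by scalars. -/
def invFieldModel : InvField A k →ₐ[invariants A k] Model A k i₀ :=
  ((Algebra.ofId (RatF k n) (Model A k i₀)).restrictScalars (invariants A k)).comp
    (invFieldHom A k)

theorem invFieldModel_apply (c : InvField A k) :
    invFieldModel A k i₀ c = diag fun _ => invFieldHom A k c :=
  (diag_const _).symm

theorem commute_invFieldModel (h : Hecke A k) (c : InvField A k) :
    Commute (heckeModelZ A k i₀ h) (invFieldModel A k i₀ c) :=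
  (Algebra.commutes (invFieldHom A k c) (heckeModelZ A k i₀ h)).symm

/-- The action of `H_F` on the model, linear over the invariants. -/
def hfModelZ : HeckeF A k →ₐ[invariants A k] Model A k i₀ :=
  Algebra.TensorProduct.lift (heckeModelZ A k i₀) (invFieldModel A k i₀)
    (commute_invFieldModel A k i₀)

theorem hfModelZ_tmul (h : Hecke A k) (c : InvField A k) :
    hfModelZ A k i₀ (h ⊗ₜ c) = heckeModelZ A k i₀ h * invFieldModel A k i₀ c :=
  Algebra.TensorProduct.lift_tmul _ _ (commute_invFieldModel A k i₀) h c

/-- The action of `H_F` on the model. -/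
def hfModel : HeckeF A k →ₐ[k] Model A k i₀ :=
  { hfModelZ A k i₀ with
    commutes' := fun c => by
      refine (hfModelZ_tmul A k i₀ (algebraMap k (Hecke A k) c) 1).trans ?_
      rw [map_one, mul_one]
      exact (heckeModel A k i₀).commutes c }

theorem hfModel_tmul (h : Hecke A k) (c : InvField A k) :
    hfModel A k i₀ (h ⊗ₜ c) = heckeModel A k i₀ h * diag fun _ => invFieldHom A k c := by
  rw [← invFieldModel_apply]
  exact hfModelZ_tmul A k i₀ h c

end HeckeModel

end DegBK

end

/-! ### Faithfulness of the rationalized Hecke algebra. -/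

noncomputable section

namespace DegBK

open MvPolynomial CoxeterSystem TensorProduct

section DiagonalImage

variable {n : ℕ} {A : FiniteCartan n} {k : Type*} [Field k] {e : ℕ} {i₀ : Fin n → ZMod e}

theorem exists_map_eq_diag {R : Type*} [Ring R] [Algebra k R] (φ : R →ₐ[k] Model A k i₀)
    {S : Set R} (h : ∀ s ∈ S, ∃ d, φ s = diag d) {b : R} (hb : b ∈ Algebra.adjoin k S) :
    ∃ d, φ b = diag d := by
  induction hb using Algebra.adjoin_induction with
  | mem s hs => exact h s hs
  | algebraMap c =>
    refine ⟨fun _ => algebraMap k (RatF k n) c, ?_⟩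
    rw [diag_const, AlgHom.commutes, ← IsScalarTower.algebraMap_apply]
  | add x y _ _ ihx ihy =>
    obtain ⟨d, hd⟩ := ihx
    obtain ⟨d', hd'⟩ := ihy
    exact ⟨d + d', by rw [map_add, hd, hd', map_add]⟩
  | mul x y _ _ ihx ihy =>
    obtain ⟨d, hd⟩ := ihx
    obtain ⟨d', hd'⟩ := ihy
    exact ⟨d * d', by rw [map_mul, hd, hd', map_mul]⟩

/-- Solves the commutation relation for `x s * t r` by using it for `x s` and for `x r`; the
diagonal entry `a_rr = 2` makes the constants combine. -/
theorem x_mul_t_of_t_mul_x {R : Type*} [Ring R] {x t : Fin n → R}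
    (h : ∀ r s, t r * x s = reflect A r x s * t r + ((-A.a s r : ℤ) : R)) (r s : Fin n) :
    x s * t r = t r * reflect A r x s + ((-A.a s r : ℤ) : R) := by
  have h1 := h r s
  have h2 := h r r
  simp only [reflect, A.diag] at h1 h2 ⊢
  rw [mul_sub, mul_smul_comm, h1, h2]
  simp only [sub_mul, smul_add, smul_sub, zsmul_eq_mul]
  push_cast
  noncomm_ring

end DiagonalImage

section Rationalized

variable {n : ℕ} {A : FiniteCartan n} {k R : Type*} [Field k] [Ring R] [Algebra k R]

/-- A ring generated by elements `x_r`, `t_r` with the relations of the degenerate affine Hecke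
algebra and by the central field `F` of invariant rational functions. -/
structure IsRationalized (x t : Fin n → R) (F : InvField A k →+* R) : Prop where
  rel : ∀ a b, HeckeRel A x t a b → a = b
  commute : ∀ c a, Commute (F c) a
  invariant : ∀ z : invariants A k, F (algebraMap _ _ z) = ev x z.1
  gen : Algebra.adjoin k ((Set.range x ∪ Set.range F) ∪ Set.range t) = ⊤

namespace IsRationalized

variable {x t : Fin n → R} {F : InvField A k →+* R} (H : IsRationalized x t F)
include H

theorem x_comm (r s : Fin n) : x r * x s = x s * x r := H.rel _ _ (.x_comm r s)

/-- A nonzero polynomial divides a nonzero invariant, which is invertible because it comes from the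
field F. -/
theorem isUnit_ev_x {f : MvPolynomial (Fin n) k} (hf : f ≠ 0) : IsUnit (ev x f) := by
  obtain ⟨g, hg, h0⟩ := exists_mul_mem_invariants A k hf
  have h1 : IsUnit (ev x (f * g)) := by
    rw [← H.invariant ⟨f * g, hg⟩]
    refine IsUnit.map F (IsUnit.mk0 _ ?_)
    rw [Ne, IsFractionRing.to_map_eq_zero_iff]
    exact fun h => h0 (congrArg Subtype.val h)
  rw [ev_mul H.x_comm] at h1
  exact ((show Commute _ _ from ev_comm H.x_comm f g).isUnit_mul_iff.1 h1).1

/-- Elements of the commutative part are fractions of polynomials with invariant, hence central,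
denominator. -/
theorem exists_mul_eq_ev {b : R} (hb : b ∈ Algebra.adjoin k (Set.range x ∪ Set.range F)) :
    ∃ z : invariants A k, z ≠ 0 ∧ ∃ g : MvPolynomial (Fin n) k, ev x z.1 * b = ev x g := by
  have hx := H.x_comm
  induction hb using Algebra.adjoin_induction with
  | mem s hs =>
    rcases hs with ⟨r, rfl⟩ | ⟨c, rfl⟩
    · exact ⟨1, one_ne_zero, X r, by rw [OneMemClass.coe_one, ev_one hx, one_mul, ev_X hx]⟩
    · obtain ⟨a, z, hz, rfl⟩ := IsFractionRing.div_surjective (A := invariants A k) c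
      have h0 := nonZeroDivisors.ne_zero hz
      refine ⟨z, h0, a.1, ?_⟩
      rw [← H.invariant, ← H.invariant, ← map_mul, mul_div_cancel₀]
      rwa [Ne, IsFractionRing.to_map_eq_zero_iff]
  | algebraMap c =>
    exact ⟨1, one_ne_zero, C c, by rw [OneMemClass.coe_one, ev_one hx, one_mul, ev_C hx]⟩
  | add a b _ _ iha ihb =>
    obtain ⟨z, hz, g, hg⟩ := iha
    obtain ⟨z', hz', g', hg'⟩ := ihb
    refine ⟨z * z', mul_ne_zero hz hz', z'.1 * g + z.1 * g', ?_⟩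
    rw [MulMemClass.coe_mul, ev_add hx, ev_mul hx, ev_mul hx, ev_mul hx, ← hg, ← hg', mul_add,
      ← mul_assoc, ← mul_assoc, ev_comm hx z'.1]
  | mul a b _ _ iha ihb =>
    obtain ⟨z, hz, g, hg⟩ := iha
    obtain ⟨z', hz', g', hg'⟩ := ihb
    refine ⟨z * z', mul_ne_zero hz hz', g * g', ?_⟩
    have hc : Commute (ev x z'.1) a := by
      rw [← H.invariant]
      exact H.commute _ _
    rw [MulMemClass.coe_mul, ev_mul hx, ev_mul hx, ← hg, ← hg', mul_assoc, ← mul_assoc _ a b,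
      hc.eq, mul_assoc, mul_assoc]

theorem normalizes :
    Normalizes (Algebra.adjoin k (Set.range x ∪ Set.range F)).toSubring t := by
  refine normalizes_adjoin fun r s hs => ?_
  have hxmem : ∀ s, x s ∈ Algebra.adjoin k (Set.range x ∪ Set.range F) :=
    fun s => Algebra.subset_adjoin (Or.inl ⟨s, rfl⟩)
  rcases hs with ⟨s, rfl⟩ | ⟨c, rfl⟩
  · exact ⟨_, sub_mem (hxmem s) (zsmul_mem (hxmem r) _), _, intCast_mem _ _,
      x_mul_t_of_t_mul_x (fun r s => H.rel _ _ (.t_x r s)) r s⟩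
  · exact ⟨_, Algebra.subset_adjoin (Or.inr ⟨c, rfl⟩), 0, Subalgebra.zero_mem _, by
      rw [add_zero, (H.commute c (t r)).eq]⟩

omit H in
theorem tOp_ne_zero {e : ℕ} {i₀ : Fin n → ZMod e} (r : Fin n) (q : Pt A i₀) :
    1 - (xv A k i₀ q r)⁻¹ ≠ 0 := by
  rw [sub_ne_zero]
  intro h
  refine xv_ne_algebraMap A k i₀ q r 1 ?_
  rw [map_one, ← inv_inv (xv A k i₀ q r), ← h, inv_one]

/-- Such a ring acts faithfully on the part of the model belonging to a tuple. -/
theorem eq_zero_of_map_mul_epsOp {e : ℕ} {i₀ : Fin n → ZMod e} (φ : R →ₐ[k] Model A k i₀)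
    (hφx : ∀ r, φ (x r) = xOp A k i₀ r) (hφt : ∀ r, φ (t r) = tOp A k i₀ r)
    (hφF : ∀ c, ∃ d, φ (F c) = diag d) {a : R} {i : Orbit A i₀}
    (ha : φ a * epsOp A k i₀ i = 0) : a = 0 := by
  classical
  refine eq_zero_of_map_mul_diag φ.toRingHom
    (P := fun r q => 1 - (xv A k i₀ q r)⁻¹) (Q := fun r q => -(xv A k i₀ q r)⁻¹)
    (fun r q => tOp_ne_zero r q) (τ := t) (fun r => hφt r)
    H.normalizes (fun r => ⟨0, zero_mem _, 1, one_mem _, ?_⟩) ?_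
    (closure_adjoin_union_eq_top H.gen) (fun q => if q.1 = i then 1 else 0)
    ?_ (by simpa [epsOp] using ha)
  · rw [mul_zero, zero_add, ← pow_two]
    exact H.rel _ _ (.t_sq r)
  · refine braidModLower_of_edges ?_ ?_ ?_ ?_ <;> intro r s hrs
    · rw [H.rel _ _ (.t_comm r s hrs), sub_self]; exact zero_mem _
    · rw [H.rel _ _ (.t_single r s hrs), sub_self]; exact zero_mem _
    · rw [H.rel _ _ (.t_double r s hrs), sub_self]; exact zero_mem _
    · rw [H.rel _ _ (.t_triple r s hrs), sub_self]; exact zero_mem _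
  · intro b hb
    obtain ⟨d, hd⟩ := exists_map_eq_diag φ (by
      rintro _ (⟨r, rfl⟩ | ⟨c, rfl⟩)
      · exact ⟨_, hφx r⟩
      · exact hφF c) hb
    refine ⟨d, hd, fun h0 => ?_⟩
    obtain ⟨z, hz, g, hg⟩ := H.exists_mul_eq_ev hb
    have hev : ∀ f, φ (ev x f) = diag fun q => aeval (xv A k i₀ q) f := fun f => by
      rw [map_ev]
      simp only [hφx]
      exact ev_xOp f
    -- A single point over `i` is enough: its coordinates are algebraically independent, so
    -- vanishing there forces the numerator `g` to be zero.
    have h1 : d (i, 1) = 0 := by simpa using congrFun h0 (i, 1)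
    have h2 := congrArg φ hg
    rw [map_mul, hev, hev, hd, ← map_mul] at h2
    have h3 := congrFun (diag_injective h2) (i, 1)
    rw [Pi.mul_apply, h1, mul_zero] at h3
    have h4 : g = 0 := by
      by_contra h
      exact aeval_xv_ne_zero A k i₀ (i, 1) h h3.symm
    rw [h4, ← C_0, ev_C H.x_comm, map_zero] at hg
    exact (H.isUnit_ev_x fun h => hz (Subtype.ext h)).mul_right_eq_zero.1 hg

end IsRationalized

end Rationalized

section HeckeF

variable {n : ℕ} (A : FiniteCartan n) (k : Type*) [Field k]

namespace HeckeF

/-- The map `H → H_F`. -/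
def ofHecke : Hecke A k →ₐ[k] HeckeF A k := Algebra.TensorProduct.includeLeft

/-- The map `F → H_F`. -/
def ofField : InvField A k →+* HeckeF A k :=
  (Algebra.TensorProduct.includeRight :
    InvField A k →ₐ[invariants A k] HeckeF A k).toRingHom

variable {A k}

theorem ofHecke_apply (h : Hecke A k) : ofHecke A k h = h ⊗ₜ 1 := rfl

theorem ofField_apply (c : InvField A k) : ofField A k c = 1 ⊗ₜ c := rfl

theorem ofHecke_mul_ofField (h : Hecke A k) (c : InvField A k) :
    ofHecke A k h * ofField A k c = h ⊗ₜ c := by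
  rw [ofHecke_apply, ofField_apply, Algebra.TensorProduct.tmul_mul_tmul, one_mul, mul_one]

theorem commute_ofField (c : InvField A k) (h : HeckeF A k) : Commute (ofField A k c) h := by
  induction h using TensorProduct.induction_on with
  | zero => exact Commute.zero_right _
  | tmul h c' =>
    rw [commute_iff_eq, ofField_apply, Algebra.TensorProduct.tmul_mul_tmul,
      Algebra.TensorProduct.tmul_mul_tmul, one_mul, mul_one, mul_comm]
  | add a b ha hb => exact ha.add_right hb

theorem rel {a b : HeckeF A k} (h : HeckeRel A (x A k) (t A k) a b) : a = b :=
  HeckeRel.eq_of_map (ofHecke A k).toRingHom (fun _ _ h => congrArg (ofHecke A k) (Hecke.rel h)) h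

theorem ofHecke_poly (f : MvPolynomial (Fin n) k) :
    ofHecke A k (Hecke.poly A k f) = ev (x A k) f := by
  rw [poly_eq_ev, map_ev]
  rfl

theorem ofField_algebraMap (z : invariants A k) :
    ofField A k (algebraMap _ _ z) = ev (x A k) z.1 := by
  rw [← ofHecke_poly]
  exact (Algebra.TensorProduct.tmul_one_eq_one_tmul z).symm

variable (A k)

theorem adjoin_eq_top :
    Algebra.adjoin k ((Set.range (x A k) ∪ Set.range (ofField A k)) ∪ Set.range (t A k)) = ⊤ := by
  rw [eq_top_iff]
  intro a _
  induction a using TensorProduct.induction_on with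
  | zero => exact Subalgebra.zero_mem _
  | add a b ha hb => exact Subalgebra.add_mem _ (ha trivial) (hb trivial)
  | tmul h c =>
    rw [← ofHecke_mul_ofField]
    refine Subalgebra.mul_mem _ ?_ (Algebra.subset_adjoin (Or.inl (Or.inr ⟨c, rfl⟩)))
    have h1 : ofHecke A k h ∈ (⊤ : Subalgebra k (Hecke A k)).map (ofHecke A k) :=
      ⟨h, Algebra.mem_top, rfl⟩
    rw [← Hecke.adjoin_eq_top, AlgHom.map_adjoin] at h1
    refine Algebra.adjoin_mono ?_ h1
    rintro _ ⟨_, ⟨r, rfl⟩ | ⟨r, rfl⟩, rfl⟩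
    · exact Or.inl (Or.inl ⟨r, rfl⟩)
    · exact Or.inr ⟨r, rfl⟩

theorem isRationalized : IsRationalized (x A k) (t A k) (ofField A k) where
  rel _ _ := rel
  commute := commute_ofField
  invariant := ofField_algebraMap
  gen := adjoin_eq_top A k

end HeckeF

variable {A k} {e : ℕ} {i₀ : Fin n → ZMod e}

theorem hfModel_x (r : Fin n) : hfModel A k i₀ (HeckeF.x A k r) = xOp A k i₀ r := by
  rw [HeckeF.x, hfModel_tmul, map_one, diag_const, map_one, mul_one, heckeModel_x]

theorem hfModel_t (r : Fin n) : hfModel A k i₀ (HeckeF.t A k r) = tOp A k i₀ r := by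
  rw [HeckeF.t, hfModel_tmul, map_one, diag_const, map_one, mul_one, heckeModel_t]

theorem hfModel_ofField (c : InvField A k) :
    hfModel A k i₀ (HeckeF.ofField A k c) = diag fun _ => invFieldHom A k c := by
  rw [HeckeF.ofField_apply, hfModel_tmul, map_one, one_mul]

/-- `H_F` acts faithfully on the part of the model belonging to a tuple. -/
theorem eq_zero_of_hfModel_mul_epsOp {h : HeckeF A k} {i : Orbit A i₀}
    (hh : hfModel A k i₀ h * epsOp A k i₀ i = 0) : h = 0 :=
  (HeckeF.isRationalized A k).eq_zero_of_map_mul_epsOp (hfModel A k i₀) hfModel_x hfModel_t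
    (fun c => ⟨_, hfModel_ofField c⟩) hh

end HeckeF

end DegBK

end

/-! ### The Lusztig extension: normal form and faithful action. -/

noncomputable section

namespace DegBK

open MvPolynomial



section LusztigModel

variable {n : ℕ} {A : FiniteCartan n} {k : Type*} [Field k] {e : ℕ} {i₀ : Fin n → ZMod e}

theorem map_inverse_eq_diag {R : Type*} [Ring R] (φ : R →+* Model A k i₀) {a : R}
    (ha : IsUnit a) {d : Pt A i₀ → RatF k n} (h : φ a = diag d) (hd : ∀ q, d q ≠ 0) :
    φ (Ring.inverse a) = diag d⁻¹ := by
  have h1 : φ (Ring.inverse a) * diag d = 1 := by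
    rw [← h, ← map_mul, Ring.inverse_mul_cancel _ ha, map_one]
  have h2 : diag d * diag d⁻¹ = (1 : Model A k i₀) := by
    rw [← map_mul, ← map_one diag]
    congr 1
    funext q
    exact mul_inv_cancel₀ (hd q)
  rw [← mul_one (φ _), ← h2, ← mul_assoc, h1, one_mul]

namespace HeckeF

theorem isUnit_x (r : Fin n) : IsUnit (x A k r) := by
  rw [← ev_X (k := k) (isRationalized A k).x_comm r]
  exact (isRationalized A k).isUnit_ev_x (X_ne_zero r)

end HeckeF

variable (A k i₀)

/-- The operators `φ_r`. -/
def phiOp (r : Fin n) : Model A k i₀ :=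
  rootOp (fun _ Y => 1 - Y⁻¹) (fun _ _ => 0) (xv A k i₀) r

variable {A k i₀}

/-- Adding `x_r⁻¹` removes precisely the diagonal part of `t_r`. Hence `φ_r` is a pure weighted
shift and carries the vectors over `i` to those over `σ_r(i)`. -/
theorem tOp_add_inv (r : Fin n) :
    tOp A k i₀ r + diag (fun q => xv A k i₀ q r)⁻¹ = phiOp A k i₀ r := by
  refine model_ext fun q => ?_
  rw [tOp, phiOp, LinearMap.add_apply, rootOp_dl (zv := xv A k i₀) rfl rfl rfl,
    rootOp_dl (zv := xv A k i₀) rfl rfl rfl, diag_dl, zero_smul, add_zero, neg_smul, Pi.inv_apply,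
    neg_add_cancel_right]

theorem hfModel_phi (r : Fin n) : hfModel A k i₀ (HeckeF.phi A k r) = phiOp A k i₀ r := by
  rw [HeckeF.phi, map_add, hfModel_t, ← tOp_add_inv]
  congr 1
  exact map_inverse_eq_diag (hfModel A k i₀).toRingHom (HeckeF.isUnit_x r) (hfModel_x r)
    fun q => xv_ne_zero A k i₀ q r

theorem phiOp_mul_epsOp (r : Fin n) (i : Orbit A i₀) :
    phiOp A k i₀ r * epsOp A k i₀ i = epsOp A k i₀ (i.refl r) * phiOp A k i₀ r :=
  rootOp_mul_epsOp r i (fun _ _ => rfl) fun _ _ => rfl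

namespace Lusztig

variable (A k i₀)

/-- The generators of the Lusztig extension as operators on the model. -/
def genOp : HeckeF A k ⊕ Orbit A i₀ → Model A k i₀ := Sum.elim (hfModel A k i₀) (epsOp A k i₀)

theorem lift_genOp_rel {a b : FreeAlgebra k (HeckeF A k ⊕ Orbit A i₀)}
    (h : LusztigRel A k i₀ a b) :
    FreeAlgebra.lift k (genOp A k i₀) a = FreeAlgebra.lift k (genOp A k i₀) b := by
  have hl : ∀ a, FreeAlgebra.lift k (genOp A k i₀) (FreeAlgebra.ι k (.inl a)) =
      hfModel A k i₀ a := fun a => FreeAlgebra.lift_ι_apply _ _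
  have hr : ∀ i, FreeAlgebra.lift k (genOp A k i₀) (FreeAlgebra.ι k (.inr i)) =
      epsOp A k i₀ i := fun a => FreeAlgebra.lift_ι_apply _ _
  cases h with
  | scalar c => rw [hl, AlgHom.commutes, AlgHom.commutes]
  | add a b => rw [hl, map_add, map_add, hl, hl]
  | mul a b => rw [hl, map_mul, map_mul, hl, hl]
  | eps_idem i => rw [map_mul, hr, epsOp_mul_self]
  | eps_orth i j h => rw [map_mul, hr, hr, epsOp_mul_of_ne h, map_zero]
  | eps_sum => simp only [map_sum, hr, sum_epsOp, map_one]
  | x_eps r i => rw [map_mul, map_mul, hl, hr, hfModel_x]; exact diag_comm _ _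
  | phi_eps r i => rw [map_mul, map_mul, hl, hr, hr, hfModel_phi, phiOp_mul_epsOp]

/-- The action of the Lusztig extension on the model. -/
def model : Lusztig A k i₀ →ₐ[k] Model A k i₀ :=
  RingQuot.liftAlgHom k ⟨FreeAlgebra.lift k (genOp A k i₀), fun _ _ => lift_genOp_rel A k i₀⟩

variable {A k i₀}

theorem model_ofHF (h : HeckeF A k) : model A k i₀ (ofHF A k i₀ h) = hfModel A k i₀ h :=
  (RingQuot.liftAlgHom_mkAlgHom_apply k _ _ _).trans (FreeAlgebra.lift_ι_apply _ _)

theorem model_eps (i : Orbit A i₀) : model A k i₀ (eps A k i₀ i) = epsOp A k i₀ i :=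
  (RingQuot.liftAlgHom_mkAlgHom_apply k _ _ _).trans (FreeAlgebra.lift_ι_apply _ _)

theorem mk_rel {a b : FreeAlgebra k (HeckeF A k ⊕ Orbit A i₀)} (h : LusztigRel A k i₀ a b) :
    mk A k i₀ a = mk A k i₀ b :=
  RingQuot.mkAlgHom_rel k h

variable (A k i₀)

/-- The homomorphism `H_F → L`. -/
def ofHFHom : HeckeF A k →ₐ[k] Lusztig A k i₀ where
  toFun := ofHF A k i₀
  map_one' := by
    have h := mk_rel (LusztigRel.scalar (A := A) (i₀ := i₀) (1 : k))
    rwa [map_one, map_one, map_one] at h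
  map_mul' a b := (mk_rel (.mul a b)).trans (map_mul _ _ _)
  map_zero' := by
    have h := mk_rel (LusztigRel.scalar (A := A) (i₀ := i₀) (0 : k))
    rwa [map_zero, map_zero, map_zero] at h
  map_add' a b := (mk_rel (.add a b)).trans (map_add _ _ _)
  commutes' c := (mk_rel (.scalar c)).trans (AlgHom.commutes _ _)

variable {A k i₀}

theorem eps_mul_self (i : Orbit A i₀) : eps A k i₀ i * eps A k i₀ i = eps A k i₀ i := by
  have h := mk_rel (LusztigRel.eps_idem (A := A) (k := k) i)
  rwa [map_mul] at h

theorem eps_mul_of_ne {i j : Orbit A i₀} (hij : i ≠ j) : eps A k i₀ i * eps A k i₀ j = 0 := by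
  have h := mk_rel (LusztigRel.eps_orth (A := A) (k := k) i j hij)
  rwa [map_mul, map_zero] at h

theorem sum_eps : ∑ i : Orbit A i₀, eps A k i₀ i = 1 := by
  have h := mk_rel (LusztigRel.eps_sum (A := A) (k := k) (i₀ := i₀))
  rwa [map_sum, map_one] at h

theorem x_mul_eps (r : Fin n) (i : Orbit A i₀) :
    x A k i₀ r * eps A k i₀ i = eps A k i₀ i * x A k i₀ r := by
  have h := mk_rel (LusztigRel.x_eps (A := A) (k := k) r i)
  rwa [map_mul, map_mul] at h

theorem phi_mul_eps (r : Fin n) (i : Orbit A i₀) :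
    phi A k i₀ r * eps A k i₀ i = eps A k i₀ (i.refl r) * phi A k i₀ r := by
  have h := mk_rel (LusztigRel.phi_eps (A := A) (k := k) r i)
  rwa [map_mul, map_mul] at h

variable (A k i₀)

/-- The elements `∑ h_i ε(i)`. -/
def sumEps : AddSubgroup (Lusztig A k i₀) where
  carrier := {a | ∃ h : Orbit A i₀ → HeckeF A k, ∑ i, ofHFHom A k i₀ (h i) * eps A k i₀ i = a}
  zero_mem' := ⟨0, by simp⟩
  add_mem' := by
    rintro _ _ ⟨h, rfl⟩ ⟨h', rfl⟩
    exact ⟨h + h', by simp only [Pi.add_apply, map_add, add_mul, Finset.sum_add_distrib]⟩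
  neg_mem' := by
    rintro _ ⟨h, rfl⟩
    exact ⟨-h, by simp only [Pi.neg_apply, map_neg, neg_mul, Finset.sum_neg_distrib]⟩

variable {A k i₀}

theorem ofHFHom_mul_mem_sumEps (h : HeckeF A k) {a : Lusztig A k i₀} (ha : a ∈ sumEps A k i₀) :
    ofHFHom A k i₀ h * a ∈ sumEps A k i₀ := by
  obtain ⟨h', rfl⟩ := ha
  exact ⟨fun i => h * h' i, by simp only [map_mul, Finset.mul_sum, mul_assoc]⟩

theorem mul_eps_mem_sumEps {a : Lusztig A k i₀} (ha : a ∈ sumEps A k i₀) (i : Orbit A i₀) :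
    a * eps A k i₀ i ∈ sumEps A k i₀ := by
  classical
  obtain ⟨h, rfl⟩ := ha
  refine ⟨Pi.single i (h i), ?_⟩
  rw [Finset.sum_mul, Finset.sum_eq_single i, Finset.sum_eq_single i]
  · rw [Pi.single_eq_same, mul_assoc, eps_mul_self]
  · intro j _ hj
    rw [mul_assoc, eps_mul_of_ne hj, mul_zero]
  · simp
  · intro j _ hj
    rw [Pi.single_eq_of_ne hj, map_zero, zero_mul]
  · simp

theorem eps_mem_sumEps (i : Orbit A i₀) : eps A k i₀ i ∈ sumEps A k i₀ := by
  classical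
  refine ⟨Pi.single i 1, ?_⟩
  rw [Finset.sum_eq_single i]
  · rw [Pi.single_eq_same, map_one, one_mul]
  · intro j _ hj
    rw [Pi.single_eq_of_ne hj, map_zero, zero_mul]
  · simp

theorem commute_ofHFHom_ev_eps (f : MvPolynomial (Fin n) k) (i : Orbit A i₀) :
    Commute (eps A k i₀ i) (ofHFHom A k i₀ (ev (HeckeF.x A k) f)) := by
  rw [map_ev]
  exact commute_ev (fun r => (x_mul_eps r i).symm) f

theorem commute_inverse {R : Type*} [Ring R] {a b : R} (h : Commute a b) :
    Commute a (Ring.inverse b) := by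
  by_cases hb : IsUnit b
  · obtain ⟨u, rfl⟩ := hb
    rw [Ring.inverse_unit]
    exact h.units_inv_right
  · rw [Ring.inverse_non_unit _ hb]
    exact Commute.zero_right _

theorem map_inverse {R S : Type*} [Ring R] [Ring S] (φ : R →+* S) {a : R} (ha : IsUnit a) :
    φ (Ring.inverse a) = Ring.inverse (φ a) := by
  obtain ⟨u, rfl⟩ := ha
  rw [Ring.inverse_unit]
  exact (Ring.inverse_unit (Units.map φ.toMonoidHom u)).symm

/-- The relations only let ε(i) commute with the `x_r`. An element of F is a quotient of polynomials
in these, and commuting passes to inverses. -/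
theorem commute_ofHFHom_ofField_eps (c : InvField A k) (i : Orbit A i₀) :
    Commute (eps A k i₀ i) (ofHFHom A k i₀ (HeckeF.ofField A k c)) := by
  obtain ⟨a, z, hz, rfl⟩ := IsFractionRing.div_surjective (A := invariants A k) c
  have h0 := nonZeroDivisors.ne_zero hz
  have h1 : algebraMap _ (InvField A k) z ≠ 0 := by
    rwa [Ne, IsFractionRing.to_map_eq_zero_iff]
  have h2 : ofHFHom A k i₀ (HeckeF.ofField A k (algebraMap _ (InvField A k) a / algebraMap _ _ z)) =
      ofHFHom A k i₀ (ev (HeckeF.x A k) a.1) *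
        Ring.inverse (ofHFHom A k i₀ (ev (HeckeF.x A k) z.1)) := by
    rw [← HeckeF.ofField_algebraMap, ← HeckeF.ofField_algebraMap]
    have hu : IsUnit (ofHFHom A k i₀ (HeckeF.ofField A k (algebraMap _ (InvField A k) z))) :=
      ((IsUnit.mk0 _ h1).map _).map _
    rw [← hu.mul_left_inj, mul_assoc, Ring.inverse_mul_cancel _ hu, mul_one, ← map_mul,
      ← map_mul, div_mul_cancel₀ _ h1]
  rw [h2]
  exact (commute_ofHFHom_ev_eps _ _).mul_right (commute_inverse (commute_ofHFHom_ev_eps _ _))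

/-- An idempotent passes `x_r` and F unchanged, and passes `t_r = φ_r - x_r⁻¹` at the cost of
reflecting its tuple in the first term. Carrying a right factor `h'` along makes the claim
multiplicative in `h`. -/
theorem eps_mul_ofHFHom_mem_sumEps (h : HeckeF A k) (i : Orbit A i₀) :
    eps A k i₀ i * ofHFHom A k i₀ h ∈ sumEps A k i₀ := by
  suffices H : ∀ h' : HeckeF A k, (∀ i, eps A k i₀ i * ofHFHom A k i₀ h' ∈ sumEps A k i₀) →
      ∀ i, eps A k i₀ i * ofHFHom A k i₀ (h * h') ∈ sumEps A k i₀ by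
    simpa using H 1 (fun i => by simpa using eps_mem_sumEps i) i
  have hcomm : ∀ h : HeckeF A k, (∀ i, Commute (eps A k i₀ i) (ofHFHom A k i₀ h)) →
      ∀ h' : HeckeF A k, (∀ i, eps A k i₀ i * ofHFHom A k i₀ h' ∈ sumEps A k i₀) →
      ∀ i, eps A k i₀ i * ofHFHom A k i₀ (h * h') ∈ sumEps A k i₀ := by
    intro h hc h' hh' i
    rw [map_mul, ← mul_assoc, (hc i).eq, mul_assoc]
    exact ofHFHom_mul_mem_sumEps _ (hh' i)
  have hx : ∀ r i, Commute (eps A k i₀ i) (ofHFHom A k i₀ (HeckeF.x A k r)) :=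
    fun r i => (x_mul_eps r i).symm
  have hh : h ∈ Algebra.adjoin k
      ((Set.range (HeckeF.x A k) ∪ Set.range (HeckeF.ofField A k)) ∪ Set.range (HeckeF.t A k)) :=
    (HeckeF.adjoin_eq_top A k).symm ▸ Algebra.mem_top
  induction hh using Algebra.adjoin_induction with
  | mem s hs =>
    rcases hs with (⟨r, rfl⟩ | ⟨c, rfl⟩) | ⟨r, rfl⟩
    · exact hcomm _ (hx r)
    · exact hcomm _ (commute_ofHFHom_ofField_eps c)
    · intro h' hh' i
      have h1 : HeckeF.t A k r = HeckeF.phi A k r - Ring.inverse (HeckeF.x A k r) := by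
        rw [HeckeF.phi, add_sub_cancel_right]
      have h2 := phi_mul_eps (k := k) r (i.refl r)
      rw [Orbit.refl_refl] at h2
      rw [h1, sub_mul, map_sub, mul_sub]
      refine sub_mem ?_ (hcomm _ (fun i => ?_) h' hh' i)
      · rw [map_mul, ← mul_assoc]
        refine (congrArg (· * ofHFHom A k i₀ h' ∈ sumEps A k i₀) h2).mp ?_
        rw [mul_assoc]
        exact ofHFHom_mul_mem_sumEps _ (hh' _)
      · have h3 := map_inverse (ofHFHom A k i₀).toRingHom (HeckeF.isUnit_x (A := A) (k := k) r)
        exact h3 ▸ commute_inverse (hx r i)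
  | algebraMap c =>
    refine hcomm _ fun i => ?_
    rw [AlgHom.commutes]
    exact (Algebra.commutes _ _).symm
  | add a b _ _ iha ihb =>
    intro h' hh' i
    rw [add_mul, map_add, mul_add]
    exact add_mem (iha h' hh' i) (ihb h' hh' i)
  | mul a b _ _ iha ihb =>
    intro h' hh' i
    rw [mul_assoc]
    exact iha _ (ihb h' hh') i

/-- The sums `∑ h_i ε(i)` are stable under left multiplication by the generators and contain 1. -/
theorem mem_sumEps (a : Lusztig A k i₀) : a ∈ sumEps A k i₀ := by
  suffices H : ∀ b ∈ sumEps A k i₀, a * b ∈ sumEps A k i₀ by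
    rw [← mul_one a, ← sum_eps]
    exact H _ (sum_mem fun i _ => eps_mem_sumEps i)
  obtain ⟨a, rfl⟩ := RingQuot.mkAlgHom_surjective k _ a
  change ∀ b ∈ sumEps A k i₀, mk A k i₀ a * b ∈ sumEps A k i₀
  induction a using FreeAlgebra.induction with
  | grade0 c =>
    intro b hb
    rw [AlgHom.commutes, ← (ofHFHom A k i₀).commutes]
    exact ofHFHom_mul_mem_sumEps _ hb
  | grade1 g =>
    cases g with
    | inl h => exact fun b hb => ofHFHom_mul_mem_sumEps h hb
    | inr i =>
      rintro _ ⟨h, rfl⟩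
      rw [Finset.mul_sum]
      refine sum_mem fun j _ => ?_
      rw [← mul_assoc]
      exact mul_eps_mem_sumEps (eps_mul_ofHFHom_mem_sumEps (h j) i) j
  | mul a b ha hb =>
    intro c hc
    rw [map_mul, mul_assoc]
    exact ha _ (hb _ hc)
  | add a b ha hb =>
    intro c hc
    rw [map_add, add_mul]
    exact add_mem (ha _ hc) (hb _ hc)

/-- Right multiplication by ε(i) isolates `h i`, and H_F acts faithfully over each single tuple.
This one fact gives both the injectivity of `model` and the uniqueness of the coefficients. -/
theorem eq_zero_of_model_sum_eq_zero {h : Orbit A i₀ → HeckeF A k}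
    (hh : model A k i₀ (∑ i, ofHF A k i₀ (h i) * eps A k i₀ i) = 0) : h = 0 := by
  funext i
  refine eq_zero_of_hfModel_mul_epsOp (i := i) ?_
  have h1 := congrArg (· * epsOp A k i₀ i) hh
  simp only [map_sum, map_mul, model_ofHF, model_eps, zero_mul, Finset.sum_mul] at h1
  rw [Finset.sum_eq_single i] at h1
  · rwa [mul_assoc, epsOp_mul_self] at h1
  · intro j _ hj
    rw [mul_assoc, epsOp_mul_of_ne hj, mul_zero]
  · simp

theorem model_injective : Function.Injective (model A k i₀) := by
  rw [injective_iff_map_eq_zero]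
  intro a ha
  obtain ⟨h, rfl⟩ := mem_sumEps a
  rw [eq_zero_of_model_sum_eq_zero ha]
  simp

theorem bijective_sum : Function.Bijective fun h : Orbit A i₀ → HeckeF A k =>
    ∑ i, ofHF A k i₀ (h i) * eps A k i₀ i := by
  refine ⟨fun h h' hh => ?_, fun a => mem_sumEps a⟩
  rw [← sub_eq_zero]
  refine eq_zero_of_model_sum_eq_zero (i₀ := i₀) ?_
  have h1 : ∑ i, ofHF A k i₀ ((h - h') i) * eps A k i₀ i =
      ∑ i, ofHF A k i₀ (h i) * eps A k i₀ i - ∑ i, ofHF A k i₀ (h' i) * eps A k i₀ i := by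
    rw [← Finset.sum_sub_distrib]
    refine Finset.sum_congr rfl fun i _ => ?_
    rw [← sub_mul]
    exact congrArg (· * eps A k i₀ i) (map_sub (ofHFHom A k i₀) (h i) (h' i))
  rw [h1, sub_eq_zero.2 hh, map_zero]

end Lusztig

end LusztigModel

end DegBK

end

/-! ### Comparison of t_r and ψ_r through the elements q_r(i). -/

noncomputable section

namespace DegBK

open MvPolynomial

section Correction

variable (k : Type*) [Field k] {n e : ℕ} [CharP k e]

/-- The numerator of `q_r(i)`, for `i_r = c`, as a polynomial in the `y_r`. -/
def qNum (c : ZMod e) (r : Fin n) : MvPolynomial (Fin n) k :=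
  if c = 0 then 1 - X r
  else if c = 1 then 1
  else if c = -1 then X r - 2
  else X r + C (ZMod.castHom (dvd_refl e) k c - 1)

/-- The denominator of `q_r(i)`. -/
def qDen (c : ZMod e) (r : Fin n) : MvPolynomial (Fin n) k :=
  if c = 0 then 1
  else if c = 1 then (if e = 2 then 1 - X r else 1)
  else if c = -1 then (1 - X r) ^ 2
  else X r + C (ZMod.castHom (dvd_refl e) k c)

variable {k}

theorem castHom_ne_zero {c : ZMod e} (hc : c ≠ 0) : ZMod.castHom (dvd_refl e) k c ≠ 0 := fun h =>
  hc (ZMod.castHom_injective k (by rw [h, map_zero]))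

/-- Since numerator and denominator do not vanish at 0, both `q_r(i)` and its inverse are regular at
`y = 0`. This puts them in the BK algebra. -/
theorem eval_zero_qNum_ne_zero (c : ZMod e) (r : Fin n) : eval 0 (qNum k c r) ≠ 0 := by
  unfold qNum
  split_ifs with h0 h1 h2
  · simp
  · simp
  · simp only [map_sub, eval_X, Pi.zero_apply, map_ofNat, zero_sub, neg_ne_zero]
    have h3 : (2 : ZMod e) ≠ 0 := fun h => h1 (by rw [h2]; linear_combination -h)
    have h4 := castHom_ne_zero (k := k) h3
    rwa [map_ofNat] at h4
  · have h3 := castHom_ne_zero (k := k) (sub_ne_zero.2 h1)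
    simpa using h3

theorem eval_zero_qDen_ne_zero (c : ZMod e) (r : Fin n) : eval 0 (qDen k c r) ≠ 0 := by
  unfold qDen
  split_ifs with h0 h1 h2 h3
  · simp
  · simp
  · simp
  · simp
  · simpa using castHom_ne_zero (k := k) h0

/-- The coefficient `psiP` is the leading coefficient `1 - x_r⁻¹` of φ_r divided by `q_r(i)`, where
`x_r = y_r + i_r`. As `v r` is not a constant, `oneSub` takes its generic value. -/
theorem one_sub_inv_eq_psiP_mul {K : Type*} [Field K] [Algebra k K] (v : Fin n → K) (r : Fin n)
    (hv : ∀ c : k, v r ≠ algebraMap k K c) (c : ZMod e) :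
    1 - (v r + algebraMap k K (ZMod.castHom (dvd_refl e) k c))⁻¹ =
      psiP c (v r) * (aeval v (qNum k c r) / aeval v (qDen k c r)) := by
  have hd : IsDomain (ZMod e) := ZMod.isDomain_of_charP k e
  have h0 : v r ≠ 0 := by simpa using hv 0
  have h1 : 1 - v r ≠ 0 := sub_ne_zero.2 (Ne.symm (by simpa using hv 1))
  have h1' : v r - 1 ≠ 0 := sub_ne_zero.2 (by simpa using hv 1)
  have h2 : v r + 1 ≠ 0 := fun h => hv (-1) (by
    rw [map_neg, map_one]; exact eq_neg_of_add_eq_zero_left h)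
  by_cases c0 : c = 0
  · subst c0
    rw [psiP_zero, qNum, qDen, if_pos rfl, if_pos rfl]
    simp only [map_zero, add_zero, map_sub, map_one, aeval_X, div_one]
    field_simp
    ring
  by_cases c1 : c = 1
  · subst c1
    by_cases he : e = 2
    · subst he
      have h3 : (2 : K) = 0 := by
        have h := CharP.cast_eq_zero k 2
        rw [Nat.cast_ofNat] at h
        rw [← map_ofNat (algebraMap k K) 2, h, map_zero]
      rw [show psiP (1 : ZMod 2) (v r) = v r by simp [psiP], qNum, qDen, if_neg c0, if_pos rfl,
        if_neg c0, if_pos rfl, if_pos rfl]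
      simp only [map_one, map_sub, aeval_X]
      field_simp
      linear_combination (-v r ^ 2) * h3
    · rw [psiP_one he, qNum, qDen, if_neg c0, if_pos rfl, if_neg c0, if_pos rfl, if_neg he,
        oneSub_of_ne (fun h => h2 (by rw [← h]; ring))]
      simp only [map_one, div_one, sub_neg_eq_add, mul_one]
      have : 1 + v r ≠ 0 := by rwa [add_comm]
      field_simp
      ring
  by_cases c2 : c = -1
  · subst c2
    have h3 : (2 : ZMod e) ≠ 0 := fun h => c1 (by linear_combination -h)
    rw [psiP_neg_one h3, qNum, qDen, if_neg c0, if_neg c1, if_pos rfl, if_neg c0, if_neg c1,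
      if_pos rfl, oneSub_of_ne (by simpa using hv 1)]
    simp only [map_neg, map_one, map_sub, aeval_X, map_ofNat, map_pow, ← sub_eq_add_neg]
    field_simp
    ring
  · have h3 : v r + algebraMap k K (ZMod.castHom (dvd_refl e) k c) ≠ 0 := fun h =>
      hv (-ZMod.castHom (dvd_refl e) k c) (by
        rw [map_neg]; exact eq_neg_of_add_eq_zero_left h)
    rw [psiP_of_ne c0 c1 c2, qNum, qDen, if_neg c0, if_neg c1, if_neg c2, if_neg c0, if_neg c1,
      if_neg c2]
    simp only [map_add, aeval_X, aeval_C, map_sub, map_one]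
    field_simp
    ring

end Correction

section Comparison

variable {n : ℕ} (A : FiniteCartan n) (k : Type*) [Field k] {e : ℕ} [CharP k e]
variable (i₀ : Fin n → ZMod e)

theorem ev_yOp (f : MvPolynomial (Fin n) k) :
    ev (yOp A k i₀) f = diag fun p => aeval (yv A k i₀ p) f :=
  ev_diag (fun r p => yv A k i₀ p r) f

/-- The automorphism `X_r ↦ X_r + c_r` of a polynomial ring. -/
def translate {k : Type*} [Field k] (c : Fin n → k) :
    MvPolynomial (Fin n) k →ₐ[k] MvPolynomial (Fin n) k :=
  aeval fun r => X r + C (c r)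

theorem aeval_translate {k S : Type*} [Field k] [CommRing S] [Algebra k S] (c : Fin n → k)
    (v : Fin n → S) (f : MvPolynomial (Fin n) k) :
    aeval v (translate c f) = aeval (fun r => v r + algebraMap k S (c r)) f := by
  rw [translate, ← AlgHom.comp_apply, comp_aeval]
  simp

theorem aeval_yv_translate (p : Pt A i₀) (f : MvPolynomial (Fin n) k) :
    aeval (yv A k i₀ p) (translate (point k p.1.1) f) = aeval (xv A k i₀ p) f := by
  rw [aeval_translate]
  simp [yv]

theorem aeval_xv_translate (p : Pt A i₀) (f : MvPolynomial (Fin n) k) :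
    aeval (xv A k i₀ p) (translate (-point k p.1.1) f) = aeval (yv A k i₀ p) f := by
  rw [aeval_translate]
  simp only [Pi.neg_apply, map_neg, ← sub_eq_add_neg]
  rfl

/-- Translation of the variables is invertible, so the genericity of the `x`-values carries over to
the `y`-values. -/
theorem aeval_yv_ne_zero (p : Pt A i₀) {f : MvPolynomial (Fin n) k} (hf : f ≠ 0) :
    aeval (yv A k i₀ p) f ≠ 0 := by
  rw [← aeval_xv_translate]
  refine aeval_xv_ne_zero A k i₀ p fun h => hf ?_
  rw [← aeval_X_left_apply f]
  have := aeval_translate (fun r => -point k p.1.1 r)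
    (fun r => X r + C (point k p.1.1 r) : Fin n → MvPolynomial (Fin n) k) f
  simp only [← algebraMap_eq, map_neg, add_neg_cancel_right] at this
  rw [← this]
  exact (congrArg _ h).trans (map_zero _)

/-- The values of the `q_r(i)`. -/
def qv (r : Fin n) (p : Pt A i₀) : RatF k n :=
  aeval (yv A k i₀ p) (qNum k (p.1.1 r) r) / aeval (yv A k i₀ p) (qDen k (p.1.1 r) r)

/-- The correction terms in the comparison of the operators `t_r` and `ψ_r`. -/
def sv (r : Fin n) (p : Pt A i₀) : RatF k n := if p.1.1 r = 0 then -1 else -(xv A k i₀ p r)⁻¹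

variable {A k i₀}

theorem qNum_ne_zero (c : ZMod e) (r : Fin n) : qNum k c r ≠ 0 := fun h =>
  eval_zero_qNum_ne_zero (k := k) c r (by rw [h, map_zero])

theorem qDen_ne_zero (c : ZMod e) (r : Fin n) : qDen k c r ≠ 0 := fun h =>
  eval_zero_qDen_ne_zero (k := k) c r (by rw [h, map_zero])

theorem qv_ne_zero (r : Fin n) (p : Pt A i₀) : qv A k i₀ r p ≠ 0 :=
  div_ne_zero (aeval_yv_ne_zero A k i₀ p (qNum_ne_zero _ r))
    (aeval_yv_ne_zero A k i₀ p (qDen_ne_zero _ r))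

theorem xv_eq (p : Pt A i₀) (r : Fin n) :
    xv A k i₀ p r = yv A k i₀ p r + algebraMap k _ (point k p.1.1 r) := by
  rw [yv, sub_add_cancel]

theorem xv_eq_yv {p : Pt A i₀} {r : Fin n} (h : p.1.1 r = 0) :
    xv A k i₀ p r = yv A k i₀ p r := by
  rw [xv_eq, point, h, map_zero, map_zero, add_zero]

theorem qv_of_eq_zero {p : Pt A i₀} {r : Fin n} (h : p.1.1 r = 0) :
    qv A k i₀ r p = 1 - yv A k i₀ p r := by
  simp [qv, qNum, qDen, h]

/-- Leading coefficients agree by `one_sub_inv_eq_psiP_mul`. For the diagonal parts, ψ_r has none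
when `i_r ≠ 0`, and when `i_r = 0` one has `-Y⁻¹ = -Y⁻¹ (1 - Y) - 1`. -/
theorem tOp_eq (r : Fin n) :
    tOp A k i₀ r = psiOp A k i₀ r * diag (qv A k i₀ r) + diag (sv A k i₀ r) := by
  refine model_ext fun p => ?_
  rw [tOp, rootOp_dl (zv := xv A k i₀) rfl rfl rfl, LinearMap.add_apply, Module.End.mul_apply,
    diag_dl, map_smul, psiOp, rootOp_dl (zv := yv A k i₀) rfl rfl rfl, diag_dl, smul_add,
    smul_smul, smul_smul, add_assoc, ← add_smul]
  congr 2
  · rw [mul_comm]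
    conv_lhs => rw [xv_eq]
    exact one_sub_inv_eq_psiP_mul (yv A k i₀ p) r (yv_ne_algebraMap A k i₀ p r) (p.1.1 r)
  · rw [sv]
    split_ifs with h
    · have := yv_ne_zero A k i₀ p r
      rw [qv_of_eq_zero h, h, psiQ_zero, xv_eq_yv h]
      field_simp
      ring
    · rw [psiQ_of_ne h, mul_zero, zero_add]

theorem psiOp_eq (r : Fin n) :
    psiOp A k i₀ r =
      tOp A k i₀ r * diag (qv A k i₀ r)⁻¹ - diag (sv A k i₀ r * (qv A k i₀ r)⁻¹) := by
  have h : diag (qv A k i₀ r) * diag (qv A k i₀ r)⁻¹ = 1 := by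
    rw [← map_mul, ← map_one diag]
    congr 1
    funext p
    exact mul_inv_cancel₀ (qv_ne_zero r p)
  rw [tOp_eq, add_mul, mul_assoc, h, mul_one, ← map_mul]
  exact (add_sub_cancel_right (psiOp A k i₀ r) _).symm

namespace Lusztig

variable (A k i₀) in
theorem model_y (r : Fin n) : model A k i₀ (y A k i₀ r) = yOp A k i₀ r := by
  rw [y, map_sum, ← mul_one (yOp A k i₀ r), ← sum_epsOp, Finset.mul_sum]
  refine Finset.sum_congr rfl fun i _ => ?_
  rw [map_mul, map_sub, model_eps, AlgHom.commutes]
  refine mul_epsOp_ext fun p hp => ?_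
  have hx : model A k i₀ (x A k i₀ r) = xOp A k i₀ r := (model_ofHF _).trans (hfModel_x r)
  rw [hx, xOp, yOp, LinearMap.sub_apply, diag_dl, diag_dl, yv, sub_smul, hp,
    Module.algebraMap_end_apply, algebraMap_smul]

theorem model_ev_y (f : MvPolynomial (Fin n) k) :
    model A k i₀ (ev (y A k i₀) f) = diag fun p => aeval (yv A k i₀ p) f := by
  rw [map_ev]
  simp only [model_y]
  exact ev_yOp A k i₀ f

theorem model_ev_x {k : Type*} [Field k] (f : MvPolynomial (Fin n) k) :
    model A k i₀ (ev (x A k i₀) f) = diag fun p => aeval (xv A k i₀ p) f := by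
  rw [map_ev]
  have hx : ∀ r, model A k i₀ (x A k i₀ r) = xOp A k i₀ r :=
    fun r => (model_ofHF _).trans (hfModel_x r)
  simp only [hx]
  exact ev_xOp f

theorem isUnit_ev_x {k : Type*} [Field k] {f : MvPolynomial (Fin n) k} (hf : f ≠ 0) :
    IsUnit (ev (x A k i₀) f) := by
  have h := ((HeckeF.isRationalized A k).isUnit_ev_x hf).map (ofHFHom A k i₀)
  rwa [map_ev] at h

theorem model_inverse_ev_x {k : Type*} [Field k] {f : MvPolynomial (Fin n) k} (hf : f ≠ 0) :
    model A k i₀ (Ring.inverse (ev (x A k i₀) f)) = diag fun p => (aeval (xv A k i₀ p) f)⁻¹ :=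
  map_inverse_eq_diag (model A k i₀).toRingHom (isUnit_ev_x hf) (model_ev_x f)
    fun p => aeval_xv_ne_zero A k i₀ p hf

/-- Over ε(i) the element `f(y)` is the translated polynomial `f(x - i)`, which is invertible in
H_F. The inverse is assembled from these pieces and checked on the model. -/
theorem isUnit_ev_y {f : MvPolynomial (Fin n) k} (hf : f ≠ 0) : IsUnit (ev (y A k i₀) f) := by
  have hne : ∀ i : Orbit A i₀, translate (-point k i.1) f ≠ 0 := fun i h => by
    refine aeval_yv_ne_zero A k i₀ (i, 1) hf ?_
    rw [← aeval_xv_translate, h, map_zero]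
  have hu : model A k i₀ (∑ i, Ring.inverse (ev (x A k i₀) (translate (-point k i.1) f)) *
      eps A k i₀ i) = diag fun p => (aeval (yv A k i₀ p) f)⁻¹ := by
    rw [map_sum, ← mul_one (diag _), ← sum_epsOp, Finset.mul_sum]
    refine Finset.sum_congr rfl fun i _ => ?_
    rw [map_mul, model_inverse_ev_x (hne i), model_eps]
    refine mul_epsOp_ext fun p hp => ?_
    subst hp
    rw [diag_dl, diag_dl, aeval_xv_translate]
  have hd : (diag fun p => aeval (yv A k i₀ p) f) * (diag fun p => (aeval (yv A k i₀ p) f)⁻¹) =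
      1 := by
    rw [← map_mul, ← map_one diag]
    congr 1
    funext p
    exact mul_inv_cancel₀ (aeval_yv_ne_zero A k i₀ p hf)
  refine isUnit_iff_exists.2 ⟨∑ i, Ring.inverse (ev (x A k i₀)
    (translate (-point k i.1) f)) * eps A k i₀ i, model_injective ?_, model_injective ?_⟩
  · rw [map_mul, hu, model_ev_y, map_one, hd]
  · rw [map_mul, hu, model_ev_y, map_one, diag_comm, hd]

theorem model_inverse_ev_y {f : MvPolynomial (Fin n) k} (hf : f ≠ 0) :
    model A k i₀ (Ring.inverse (ev (y A k i₀) f)) = diag fun p => (aeval (yv A k i₀ p) f)⁻¹ :=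
  map_inverse_eq_diag (model A k i₀).toRingHom (isUnit_ev_y hf) (model_ev_y f)
    fun p => aeval_yv_ne_zero A k i₀ p hf

theorem y_comm (r s : Fin n) : y A k i₀ r * y A k i₀ s = y A k i₀ s * y A k i₀ r :=
  model_injective (by rw [map_mul, map_mul, model_y, model_y]; exact diag_comm _ _)

theorem q_eq (r : Fin n) (i : Orbit A i₀) :
    q A k i₀ r i = ev (y A k i₀) (qNum k (i.1 r) r) *
      Ring.inverse (ev (y A k i₀) (qDen k (i.1 r) r)) := by
  have hy := y_comm (A := A) (k := k) (i₀ := i₀)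
  have h2 : ev (y A k i₀) (2 : MvPolynomial (Fin n) k) = 2 := by
    rw [show (2 : MvPolynomial (Fin n) k) = 1 + 1 by norm_num, ev_add hy, ev_one hy]
    norm_num
  have h1 : ev (y A k i₀) (1 - X r : MvPolynomial (Fin n) k) = 1 - y A k i₀ r := by
    rw [ev_sub hy, ev_one hy, ev_X hy]
  unfold q
  split_ifs with c0 c1 he c2
  · rw [qNum, qDen, if_pos c0, if_pos c0, ev_one hy, Ring.inverse_one, mul_one, h1]
  · rw [qNum, qDen, if_neg c0, if_neg c0, if_pos c1, if_pos c1, if_pos he, ev_one hy, one_mul, h1]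
  · rw [qNum, qDen, if_neg c0, if_neg c0, if_pos c1, if_pos c1, if_neg he, ev_one hy, one_mul,
      Ring.inverse_one]
  · rw [qNum, qDen, if_neg c0, if_neg c0, if_neg c1, if_neg c1, if_pos c2, if_pos c2, ev_sub hy,
      ev_X hy, h2, pow_two (1 - X r), ev_mul hy, h1, ← pow_two, Ring.inverse_pow]
  · have hu : IsUnit (ev (y A k i₀) (X r + C (point k i.1 r))) := by
      have := isUnit_ev_y (A := A) (i₀ := i₀) (qDen_ne_zero (k := k) (i.1 r) r)
      rwa [qDen, if_neg c0, if_neg c1, if_neg c2] at this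
    have hd : ev (y A k i₀) (X r + C (point k i.1 r)) =
        y A k i₀ r + algebraMap k _ (point k i.1 r) := by
      rw [ev_add hy, ev_X hy, ev_C hy]
    rw [qNum, qDen, if_neg c0, if_neg c0, if_neg c1, if_neg c1, if_neg c2, if_neg c2]
    change _ = ev _ (X r + C (point k i.1 r - 1)) * Ring.inverse (ev _ (X r + C (point k i.1 r)))
    rw [C_sub, ← add_sub_assoc, ev_sub hy, sub_mul, Ring.mul_inverse_cancel _ hu, map_one,
      ev_one hy, one_mul, hd]

theorem isUnit_q (r : Fin n) (i : Orbit A i₀) : IsUnit (q A k i₀ r i) := by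
  rw [q_eq]
  exact (isUnit_ev_y (qNum_ne_zero _ r)).mul (isUnit_ev_y (qDen_ne_zero _ r)).ringInverse

theorem model_inverse_q (r : Fin n) (i : Orbit A i₀) :
    model A k i₀ (Ring.inverse (q A k i₀ r i)) = diag fun p =>
      (aeval (yv A k i₀ p) (qNum k (i.1 r) r) / aeval (yv A k i₀ p) (qDen k (i.1 r) r))⁻¹ := by
  refine map_inverse_eq_diag (model A k i₀).toRingHom (isUnit_q r i) ?_ fun p =>
    div_ne_zero (aeval_yv_ne_zero A k i₀ p (qNum_ne_zero _ r))
      (aeval_yv_ne_zero A k i₀ p (qDen_ne_zero _ r))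
  rw [q_eq]
  refine (map_mul (model A k i₀) _ _).trans ?_
  rw [model_ev_y, model_inverse_ev_y (qDen_ne_zero _ r), ← map_mul]
  rfl

theorem model_theta (r : Fin n) :
    model A k i₀ (theta A k i₀ r) = phiOp A k i₀ r * diag (qv A k i₀ r)⁻¹ := by
  rw [theta, map_mul]
  congr 1
  · exact (model_ofHF _).trans (hfModel_phi r)
  · rw [map_sum, ← mul_one (diag _), ← sum_epsOp, Finset.mul_sum]
    refine Finset.sum_congr rfl fun i _ => ?_
    rw [map_mul, model_inverse_q, model_eps]
    refine mul_epsOp_ext fun p hp => ?_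
    subst hp
    rw [diag_dl, diag_dl]
    rfl

variable (A k i₀) in
theorem model_psi (r : Fin n) : model A k i₀ (psi A k i₀ r) = psiOp A k i₀ r := by
  have hy : model A k i₀ (Ring.inverse (y A k i₀ r)) = diag fun p => (yv A k i₀ p r)⁻¹ := by
    have h := model_inverse_ev_y (A := A) (k := k) (i₀ := i₀) (X_ne_zero r)
    rw [ev_X y_comm] at h
    simpa only [aeval_X] using h
  rw [psi, map_sum, ← mul_one (psiOp A k i₀ r), ← sum_epsOp, Finset.mul_sum]
  refine Finset.sum_congr rfl fun i _ => ?_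
  rw [map_mul, map_sub, model_theta, model_eps, apply_ite (model A k i₀), map_zero, hy]
  refine mul_epsOp_ext fun p hp => ?_
  subst hp
  rw [← tOp_add_inv, psiOp_eq, add_mul, ← map_mul, LinearMap.sub_apply, LinearMap.sub_apply,
    LinearMap.add_apply, diag_dl, diag_dl, add_sub_assoc, sub_eq_add_neg _ (_ • dl k p)]
  congr 1
  have h1 := yv_ne_zero A k i₀ p r
  have h2 : 1 - yv A k i₀ p r ≠ 0 := sub_ne_zero.2 fun h =>
    yv_ne_algebraMap A k i₀ p r 1 (by rw [map_one, h])
  simp only [Pi.mul_apply, Pi.inv_apply]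
  split_ifs with h
  · rw [diag_dl, ← neg_smul, ← sub_smul]
    congr 1
    rw [qv_of_eq_zero h, sv, if_pos h, xv_eq_yv h]
    field_simp
    ring
  · rw [LinearMap.zero_apply, sub_zero, ← neg_smul]
    congr 1
    rw [sv, if_neg h]
    ring

end Lusztig

end Comparison

end DegBK

end

/-! ### The action of the BK algebra on the model. -/

noncomputable section

namespace DegBK

open MvPolynomial CoxeterSystem

section BKRelations

variable {n : ℕ} {A : FiniteCartan n} {k : Type*} [Field k] {e : ℕ} {i₀ : Fin n → ZMod e}

theorem map_sqCoeff {R S F : Type*} [Ring R] [Ring S] [FunLike F R S] [RingHomClass F R S] (φ : F)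
    (y : Fin n → R) (r : Fin n) (i : Fin n → ZMod e) :
    φ (sqCoeff y r i) = sqCoeff (fun r => φ (y r)) r i := by
  unfold sqCoeff
  split_ifs <;> simp

theorem map_singleRHS {R S F : Type*} [Ring R] [Ring S] [FunLike F R S] [RingHomClass F R S]
    (φ : F) (y : Fin n → R) (r s : Fin n) (i : Fin n → ZMod e) :
    φ (singleRHS y r s i) = singleRHS (fun r => φ (y r)) r s i := by
  unfold singleRHS
  split_ifs <;> simp

theorem map_doubleRHS {R S F : Type*} [Ring R] [Ring S] [FunLike F R S] [RingHomClass F R S]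
    (φ : F) (y psi : Fin n → R) (r s : Fin n) (i : Fin n → ZMod e) :
    φ (doubleRHS y psi r s i) = doubleRHS (fun r => φ (y r)) (fun r => φ (psi r)) r s i := by
  simp only [doubleRHS, apply_ite φ, map_mul, map_add, map_neg, map_one, map_zero, map_ofNat φ 2]

theorem map_tripleRHS {R S F : Type*} [Ring R] [Ring S] [FunLike F R S] [RingHomClass F R S]
    (φ : F) (y psi : Fin n → R) (r s : Fin n) (i : Fin n → ZMod e) :
    φ (tripleRHS y psi r s i) = tripleRHS (fun r => φ (y r)) (fun r => φ (psi r)) r s i := by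
  simp only [tripleRHS, apply_ite φ, map_mul, map_add, map_sub, map_neg, map_pow, map_zero,
    map_ofNat φ 2, map_ofNat φ 3]

variable {R S : Type*} [Ring R] [Algebra k R] [Ring S] [Algebra k S] {y psi : Fin n → R}
  {eps : Orbit A i₀ → R} {inv : (f : MvPolynomial (Fin n) k) → MvPolynomial.eval 0 f ≠ 0 → R}

theorem BKRel.map (φ : R →ₐ[k] S) {a b : R} (h : BKRel A k i₀ y psi eps inv a b) :
    BKRel A k i₀ (fun r => φ (y r)) (fun r => φ (psi r)) (fun i => φ (eps i))
      (fun f hf => φ (inv f hf)) (φ a) (φ b) := by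
  cases h with
  | eps_idem i => rw [map_mul]; exact .eps_idem i
  | eps_orth i j h => rw [map_mul, map_zero]; exact .eps_orth i j h
  | eps_sum => rw [map_sum, map_one]; exact .eps_sum
  | y_eps r i => rw [map_mul, map_mul]; exact .y_eps r i
  | y_comm r s => rw [map_mul, map_mul]; exact .y_comm r s
  | mul_inv f hf => rw [map_mul, map_one, map_ev]; exact .mul_inv f hf
  | inv_mul f hf => rw [map_mul, map_one, map_ev]; exact .inv_mul f hf
  | psi_eps r i => rw [map_mul, map_mul]; exact .psi_eps r i
  | psi_y r s i =>
    rw [map_mul, map_mul, map_mul, map_add, map_mul, map_reflect, apply_ite φ, map_zero,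
      map_intCast]
    exact .psi_y r s i
  | psi_sq r i => rw [map_mul, map_mul, map_pow, map_sqCoeff]; exact .psi_sq r i
  | psi_comm r s h => rw [map_mul, map_mul]; exact .psi_comm r s h
  | psi_single r s h i =>
    rw [map_mul, map_mul, map_sub, map_singleRHS]
    simp only [map_mul]
    exact .psi_single r s h i
  | psi_double r s h i =>
    rw [map_mul, map_mul, map_sub, map_doubleRHS]
    simp only [map_mul, map_pow]
    exact .psi_double r s h i
  | psi_triple r s h i =>
    rw [map_mul, map_mul, map_sub, map_tripleRHS]
    simp only [map_mul, map_pow]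
    exact .psi_triple r s h i

theorem BKRel.eq_of_map (φ : R →ₐ[k] S) (key : ∀ a b, BKRel A k i₀ y psi eps inv a b → φ a = φ b)
    {a b : S} (h : BKRel A k i₀ (fun r => φ (y r)) (fun r => φ (psi r)) (fun i => φ (eps i))
      (fun f hf => φ (inv f hf)) a b) : a = b := by
  cases h with
  | eps_idem i => simpa using key _ _ (.eps_idem i)
  | eps_orth i j h => simpa using key _ _ (.eps_orth i j h)
  | eps_sum => simpa using key _ _ .eps_sum
  | y_eps r i => simpa using key _ _ (.y_eps r i)
  | y_comm r s => simpa using key _ _ (.y_comm r s)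
  | mul_inv f hf => simpa [map_ev] using key _ _ (.mul_inv f hf)
  | inv_mul f hf => simpa [map_ev] using key _ _ (.inv_mul f hf)
  | psi_eps r i => simpa using key _ _ (.psi_eps r i)
  | psi_y r s i => simpa [map_reflect, apply_ite φ] using key _ _ (.psi_y r s i)
  | psi_sq r i => simpa [map_sqCoeff] using key _ _ (.psi_sq r i)
  | psi_comm r s h => simpa using key _ _ (.psi_comm r s h)
  | psi_single r s h i => simpa [map_singleRHS] using key _ _ (.psi_single r s h i)
  | psi_double r s h i => simpa [map_doubleRHS] using key _ _ (.psi_double r s h i)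
  | psi_triple r s h i => simpa [map_tripleRHS] using key _ _ (.psi_triple r s h i)

end BKRelations

section BKModel

variable {n : ℕ} (A : FiniteCartan n) (k : Type*) [Field k] {e : ℕ}
variable (i₀ : Fin n → ZMod e)

namespace BK

variable {A k i₀} in
theorem rel {a b : BK A k i₀} (h : BKRel A k i₀ (y A k i₀) (psi A k i₀) (eps A k i₀)
    (inv A k i₀) a b) : a = b :=
  BKRel.eq_of_map (mk A k i₀) (fun _ _ h => RingQuot.mkAlgHom_rel k h) h

theorem adjoin_eq_top :
    Algebra.adjoin k (((Set.range (y A k i₀) ∪ Set.range (eps A k i₀)) ∪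
      {a | ∃ f hf, inv A k i₀ f hf = a}) ∪ Set.range (psi A k i₀)) = ⊤ := by
  rw [eq_top_iff]
  intro a _
  obtain ⟨a, rfl⟩ := RingQuot.mkAlgHom_surjective k _ a
  clear * -
  change mk A k i₀ a ∈ _
  induction a using FreeAlgebra.induction with
  | grade0 c => rw [AlgHom.commutes]; exact Subalgebra.algebraMap_mem _ c
  | grade1 g =>
    cases g with
    | y r => exact Algebra.subset_adjoin (Or.inl (Or.inl (Or.inl ⟨r, rfl⟩)))
    | eps i => exact Algebra.subset_adjoin (Or.inl (Or.inl (Or.inr ⟨i, rfl⟩)))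
    | inv f hf => exact Algebra.subset_adjoin (Or.inl (Or.inr ⟨f, hf, rfl⟩))
    | psi r => exact Algebra.subset_adjoin (Or.inr ⟨r, rfl⟩)
  | mul a b ha hb => rw [map_mul]; exact mul_mem ha hb
  | add a b ha hb => rw [map_add]; exact add_mem ha hb

end BK

variable [CharP k e]

/-- The operators `f(y)⁻¹`. -/
def invOp (f : MvPolynomial (Fin n) k) : Model A k i₀ := diag fun p => (aeval (yv A k i₀ p) f)⁻¹

variable {A k i₀}

theorem ne_zero_of_eval_ne_zero {f : MvPolynomial (Fin n) k} {v : Fin n → k}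
    (hf : MvPolynomial.eval v f ≠ 0) : f ≠ 0 := fun h => hf (by rw [h, map_zero])

theorem ev_yOp_mul_invOp {f : MvPolynomial (Fin n) k} (hf : f ≠ 0) :
    ev (yOp A k i₀) f * invOp A k i₀ f = 1 := by
  rw [ev_yOp, invOp, ← map_mul, ← map_one diag]
  congr 1
  funext p
  exact mul_inv_cancel₀ (aeval_yv_ne_zero A k i₀ p hf)

theorem psiOp_mul_epsOp (r : Fin n) (i : Orbit A i₀) :
    psiOp A k i₀ r * epsOp A k i₀ i = epsOp A k i₀ (i.refl r) * psiOp A k i₀ r := by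
  refine rootOp_mul_epsOp r i (fun h => psiQ_of_ne h) fun h => psiQ_of_ne ?_
  have h1 : (i.refl r).1 r = -i.1 r := by simp [Orbit.refl, reflect, A.diag]; ring
  rw [h1]
  exact neg_ne_zero.2 h

theorem bkRel_model {a b : Model A k i₀} (h : BKRel A k i₀ (yOp A k i₀) (psiOp A k i₀)
    (epsOp A k i₀) (fun f _ => invOp A k i₀ f) a b) : a = b := by
  cases h with
  | eps_idem i => exact epsOp_mul_self i
  | eps_orth i j h => exact epsOp_mul_of_ne h
  | eps_sum => exact sum_epsOp
  | y_eps r i => exact diag_comm _ _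
  | y_comm r s => exact diag_comm _ _
  | mul_inv f hf => exact ev_yOp_mul_invOp (ne_zero_of_eval_ne_zero hf)
  | inv_mul f hf =>
    rw [← ev_yOp_mul_invOp (ne_zero_of_eval_ne_zero hf), ev_yOp]
    exact diag_comm _ _
  | psi_eps r i => exact psiOp_mul_epsOp r i
  | psi_y r s i => exact psiOp_mul_yOp r s i
  | psi_sq r i => exact psiOp_sq r i
  | psi_comm r s h => exact psiOp_comm h
  | psi_single r s h i => exact psiOp_single h i
  | psi_double r s h i => exact psiOp_double h i
  | psi_triple r s h i => exact psiOp_triple h i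

namespace BK

variable (A k i₀)

/-- The generators of the BK algebra as operators on the model. -/
def genOp : BKGen k n (Orbit A i₀) → Model A k i₀
  | .y r => yOp A k i₀ r
  | .psi r => psiOp A k i₀ r
  | .eps i => epsOp A k i₀ i
  | .inv f _ => invOp A k i₀ f

/-- The action of the BK algebra on the model. -/
def model : BK A k i₀ →ₐ[k] Model A k i₀ :=
  RingQuot.liftAlgHom k ⟨FreeAlgebra.lift k (genOp A k i₀), fun a b h => bkRel_model <| by
    simpa [genOp] using h.map (FreeAlgebra.lift k (genOp A k i₀))⟩

theorem model_y (r : Fin n) : model A k i₀ (y A k i₀ r) = yOp A k i₀ r :=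
  (RingQuot.liftAlgHom_mkAlgHom_apply k _ _ _).trans (FreeAlgebra.lift_ι_apply _ _)

theorem model_psi (r : Fin n) : model A k i₀ (psi A k i₀ r) = psiOp A k i₀ r :=
  (RingQuot.liftAlgHom_mkAlgHom_apply k _ _ _).trans (FreeAlgebra.lift_ι_apply _ _)

theorem model_eps (i : Orbit A i₀) : model A k i₀ (eps A k i₀ i) = epsOp A k i₀ i :=
  (RingQuot.liftAlgHom_mkAlgHom_apply k _ _ _).trans (FreeAlgebra.lift_ι_apply _ _)

theorem model_inv (f : MvPolynomial (Fin n) k) (hf) :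
    model A k i₀ (inv A k i₀ f hf) = invOp A k i₀ f :=
  (RingQuot.liftAlgHom_mkAlgHom_apply k _ _ _).trans (FreeAlgebra.lift_ι_apply _ _)

end BK

end BKModel

end DegBK

end

/-! ### Local commutative parts and faithfulness of the BK algebra. -/

noncomputable section

namespace DegBK

open MvPolynomial CoxeterSystem

section Localized

variable {n : ℕ} {A : FiniteCartan n} {k : Type*} [Field k]

/-- Extends the commutation rule from the variables to all polynomials; only the fact that the
remainder stays in `B` is needed later. -/
theorem exists_ev_mul_eq {R : Type*} [Ring R] [Algebra k R] {z : Fin n → R}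
    (hz : ∀ r s, z r * z s = z s * z r) {B : Subalgebra k R} (hB : ∀ r, z r ∈ B) {τ : R} {r : Fin n}
    (h : ∀ s, ∃ b ∈ B, z s * τ = τ * reflect A r z s + b) (f : MvPolynomial (Fin n) k) :
    ∃ b ∈ B, ev z f * τ = τ * ev z (polyRefl A k r f) + b := by
  have hrefl : ∀ s, ev z (reflect A r X s : MvPolynomial (Fin n) k) = reflect A r z s := fun s => by
    have h1 := map_reflect (A := A) (evHom (k := k) hz) r X s
    simpa only [evHom_apply, ev_X hz] using h1
  induction f using MvPolynomial.induction_on with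
  | C c =>
    refine ⟨0, B.zero_mem, ?_⟩
    have h1 : polyRefl A k r (C c) = C c := AlgHom.commutes (polyRefl A k r) c
    rw [h1, ev_C hz, add_zero, Algebra.commutes]
  | add p q hp hq =>
    obtain ⟨b, hb, h1⟩ := hp
    obtain ⟨b', hb', h1'⟩ := hq
    refine ⟨b + b', B.add_mem hb hb', ?_⟩
    rw [ev_add hz, add_mul, h1, h1', map_add, ev_add hz, mul_add]
    abel
  | mul_X p s hp =>
    obtain ⟨b, hb, h1⟩ := hp
    obtain ⟨b', hb', h1'⟩ := h s
    refine ⟨b * reflect A r z s + ev z p * b', ?_, ?_⟩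
    · refine B.add_mem (B.mul_mem hb (B.sub_mem (hB s) (B.zsmul_mem (hB r) _))) (B.mul_mem ?_ hb')
      exact B.sum_mem fun m _ => B.smul_mem (list_prod_mem fun a ha => by
        obtain ⟨r, rfl⟩ := (List.mem_ofFn' _ _).1 ha
        exact pow_mem (hB r) _) _
    · rw [ev_mul hz, ev_X hz, mul_assoc, h1', mul_add, ← mul_assoc, h1, add_mul, map_mul,
        ev_mul hz, polyRefl_X, hrefl, mul_assoc, add_assoc]

/-- A denominator admissible at a tuple becomes, after moving past `τ_r`, a denominator admissible
at the reflected tuple. -/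
theorem eval_polyRefl_ne_zero {r : Fin n} {v w : Fin n → k} (hw : w = reflect A r v)
    {f : MvPolynomial (Fin n) k} (hf : eval v f ≠ 0) : eval w (polyRefl A k r f) ≠ 0 := by
  have h := aeval_reflect (A := A) k w r f
  rw [hw, reflect_reflect] at h
  rw [hw]
  rw [← coe_aeval_eq_eval] at hf ⊢
  exact fun h0 => hf (h.trans h0)

variable {R : Type*} [Ring R] [Algebra k R] {e : ℕ} {i₀ : Fin n → ZMod e}

/-- The commutative subalgebra generated by `S` consists of the families of fractions of
polynomials in the `z_r`, indexed by the orbit, with denominators not vanishing at given points. -/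
structure IsLocalized (v : Orbit A i₀ → Fin n → k) (z : Fin n → R) (ε : Orbit A i₀ → R)
    (S : Set R) : Prop where
  z_comm : ∀ r s, z r * z s = z s * z r
  sum_eps : ∑ i, ε i = 1
  eps_idem : ∀ i, ε i * ε i = ε i
  commute_z : ∀ s ∈ S, ∀ r, Commute s (z r)
  commute_eps : ∀ s ∈ S, ∀ i, Commute s (ε i)
  exists_den : ∀ s ∈ S, ∀ i, ∃ f g : MvPolynomial (Fin n) k, eval (v i) f ≠ 0 ∧
    ev z f * (s * ε i) = ev z g * ε i
  exists_inv : ∀ i, ∀ f : MvPolynomial (Fin n) k, eval (v i) f ≠ 0 → ∃ u, u * ev z f = ε i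

namespace IsLocalized

variable {v : Orbit A i₀ → Fin n → k} {z : Fin n → R} {ε : Orbit A i₀ → R} {S : Set R}

theorem commute_adjoin {a b : R} (h : ∀ s ∈ S, Commute s a) (hb : b ∈ Algebra.adjoin k S) :
    Commute b a := by
  induction hb using Algebra.adjoin_induction with
  | mem s hs => exact h s hs
  | algebraMap c => exact Algebra.commutes c a
  | add x y _ _ hx hy => exact hx.add_left hy
  | mul x y _ _ hx hy => exact hx.mul_left hy

theorem exists_den_adjoin (H : IsLocalized v z ε S) {b : R} (hb : b ∈ Algebra.adjoin k S)
    (i : Orbit A i₀) : ∃ f g : MvPolynomial (Fin n) k, eval (v i) f ≠ 0 ∧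
      ev z f * (b * ε i) = ev z g * ε i := by
  have hz := H.z_comm
  induction hb using Algebra.adjoin_induction with
  | mem s hs => exact H.exists_den s hs i
  | algebraMap c => exact ⟨1, C c, by simp, by rw [ev_one hz, one_mul, ev_C hz]⟩
  | add a b _ _ iha ihb =>
    obtain ⟨f, g, hf, h⟩ := iha
    obtain ⟨f', g', hf', h'⟩ := ihb
    refine ⟨f * f', f' * g + f * g', by rw [map_mul]; exact mul_ne_zero hf hf', ?_⟩
    rw [add_mul, mul_add, mul_comm f f', ev_mul hz, mul_assoc, h, ← ev_mul hz, mul_comm f' f,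
      ev_mul hz f f', mul_assoc, h', ev_add hz, ev_mul hz, ev_mul hz, add_mul, mul_assoc, mul_assoc]
  | mul a b ha _ iha ihb =>
    obtain ⟨f, g, hf, h⟩ := iha
    obtain ⟨f', g', hf', h'⟩ := ihb
    have hc : ∀ f : MvPolynomial (Fin n) k, Commute a (ev z f) := fun f =>
      commute_ev (fun r => commute_adjoin (fun s hs => H.commute_z s hs r) ha) f
    refine ⟨f * f', g' * g, by rw [map_mul]; exact mul_ne_zero hf hf', ?_⟩
    rw [ev_mul hz, mul_assoc, mul_assoc a, ← mul_assoc _ a, ← (hc f').eq, mul_assoc a, h',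
      ← mul_assoc a, (hc g').eq, mul_assoc, ← mul_assoc (ev z f), ev_comm hz, mul_assoc, h,
      ← mul_assoc, ev_mul hz]

/-- Over ε(i) an element of the commutative part equals a fraction `g / f`. If it acts as zero, `g`
vanishes at the generic point `(i, 1)`, so `g = 0`, and `f` is invertible over ε(i). -/
theorem exists_map_eq_diag (H : IsLocalized v z ε S) (φ : R →ₐ[k] Model A k i₀)
    {zv : Pt A i₀ → Fin n → RatF k n} (hzv : ∀ p (f : MvPolynomial (Fin n) k), f ≠ 0 →
      aeval (zv p) f ≠ 0) (hφz : ∀ r, φ (z r) = diag fun p => zv p r)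
    (hφε : ∀ i, φ (ε i) = epsOp A k i₀ i) (hφS : ∀ s ∈ S, ∃ d, φ s = diag d) {b : R}
    (hb : b ∈ Algebra.adjoin k S) : ∃ d, φ b = diag d ∧ (d * 1 = 0 → b = 0) := by
  obtain ⟨d, hd⟩ := DegBK.exists_map_eq_diag φ hφS hb
  refine ⟨d, hd, fun h0 => ?_⟩
  rw [mul_one] at h0
  subst h0
  rw [map_zero] at hd
  rw [← mul_one b, ← H.sum_eps, Finset.mul_sum]
  refine Finset.sum_eq_zero fun i _ => ?_
  obtain ⟨f, g, hf, h⟩ := H.exists_den_adjoin hb i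
  have hev : φ (ev z g) = diag fun p => aeval (zv p) g := by
    rw [map_ev]
    simp only [hφz]
    exact ev_diag (fun r p => zv p r) g
  have hg : g = 0 := by
    by_contra hg
    have h1 := congrArg φ h
    rw [map_mul, map_mul, hd, zero_mul, mul_zero, map_mul, hev, hφε] at h1
    have h2 := LinearMap.congr_fun h1 (dl k (i, 1))
    have h3 : epsOp A k i₀ i (dl k (i, 1)) = dl k (i, 1) := epsOp_dl_self (i, 1)
    rw [Module.End.mul_apply, h3, diag_dl, LinearMap.zero_apply, eq_comm] at h2
    refine hzv (i, 1) g hg ?_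
    simpa using h2
  obtain ⟨u, hu⟩ := H.exists_inv i f hf
  have hcomm : Commute b (ε i) := commute_adjoin (fun s hs => H.commute_eps s hs i) hb
  have h1 := congrArg (u * ·) h
  simp only [← mul_assoc, hu] at h1
  rw [hg, ← C_0, ev_C H.z_comm, map_zero, mul_zero, zero_mul, ← hcomm.eq, mul_assoc,
    H.eps_idem] at h1
  exact h1

end IsLocalized

end Localized

section BKInjective

variable {n : ℕ} {A : FiniteCartan n} {k : Type*} [Field k] {e : ℕ} {i₀ : Fin n → ZMod e}

theorem mem_wordSpan_of_mem {R I : Type*} [Ring R] {B : Subring R} {τ : I → R} {b : R} (hb : b ∈ B)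
    {l : ℕ} (hl : 0 < l) : b ∈ wordSpan B τ l := by
  simpa using word_mul_mem (τ := τ) (ω := []) (by simpa using hl) hb

theorem ite_mem_of_mem {R σ : Type*} [SetLike σ R] {S : σ} {c : Prop} [Decidable c] {a b : R}
    (ha : a ∈ S) (hb : b ∈ S) : (if c then a else b) ∈ S := by
  split_ifs <;> assumption

namespace BK

variable (A k i₀)

/-- The generators of the BK algebra other than the `ψ_r`. -/
def diagGens : Set (BK A k i₀) :=
  (Set.range (y A k i₀) ∪ Set.range (eps A k i₀)) ∪ {a | ∃ f hf, inv A k i₀ f hf = a}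

variable {A k i₀}

theorem y_mem (r : Fin n) : y A k i₀ r ∈ Algebra.adjoin k (diagGens A k i₀) :=
  Algebra.subset_adjoin (Or.inl (Or.inl ⟨r, rfl⟩))

theorem eps_mem (i : Orbit A i₀) : eps A k i₀ i ∈ Algebra.adjoin k (diagGens A k i₀) :=
  Algebra.subset_adjoin (Or.inl (Or.inr ⟨i, rfl⟩))

theorem inv_mem (f : MvPolynomial (Fin n) k) (hf) :
    inv A k i₀ f hf ∈ Algebra.adjoin k (diagGens A k i₀) :=
  Algebra.subset_adjoin (Or.inr ⟨f, hf, rfl⟩)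

theorem y_comm (r s : Fin n) : y A k i₀ r * y A k i₀ s = y A k i₀ s * y A k i₀ r :=
  rel (.y_comm r s)

theorem ev_mul_inv (f : MvPolynomial (Fin n) k) (hf) :
    ev (y A k i₀) f * inv A k i₀ f hf = 1 :=
  rel (.mul_inv f hf)

theorem inv_mul_ev (f : MvPolynomial (Fin n) k) (hf) :
    inv A k i₀ f hf * ev (y A k i₀) f = 1 :=
  rel (.inv_mul f hf)

theorem commute_inv_of_commute_y {a : BK A k i₀} (h : ∀ r, Commute a (y A k i₀ r))
    (f : MvPolynomial (Fin n) k) (hf) : Commute (inv A k i₀ f hf) a :=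
  ((commute_ev h f).units_inv_right (u := ⟨_, _, ev_mul_inv f hf, inv_mul_ev f hf⟩)).symm

theorem isLocalized : IsLocalized (A := A) (i₀ := i₀) (fun _ => (0 : Fin n → k)) (y A k i₀)
    (eps A k i₀) (diagGens A k i₀) := by
  have hye : ∀ r i, Commute (y A k i₀ r) (eps A k i₀ i) := fun r i => rel (.y_eps r i)
  have hsum : ∑ i, eps A k i₀ i = 1 := rel .eps_sum
  have hidem : ∀ i, eps A k i₀ i * eps A k i₀ i = eps A k i₀ i := fun i => rel (.eps_idem i)
  have horth : ∀ i j, i ≠ j → eps A k i₀ i * eps A k i₀ j = 0 := fun i j h => rel (.eps_orth i j h)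
  refine ⟨y_comm, hsum, hidem, ?_, ?_, ?_, ?_⟩
  · rintro _ ((⟨s, rfl⟩ | ⟨i, rfl⟩) | ⟨f, hf, rfl⟩) r
    · exact y_comm s r
    · exact (hye r i).symm
    · exact commute_inv_of_commute_y (fun s => y_comm r s) f hf
  · rintro _ ((⟨s, rfl⟩ | ⟨j, rfl⟩) | ⟨f, hf, rfl⟩) i
    · exact hye s i
    · by_cases h : j = i
      · rw [h]
      · exact (horth j i h).trans (horth i j (Ne.symm h)).symm
    · exact commute_inv_of_commute_y (fun s => (hye s i).symm) f hf
  · rintro _ ((⟨s, rfl⟩ | ⟨j, rfl⟩) | ⟨f, hf, rfl⟩) i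
    · exact ⟨1, X s, by simp, by rw [ev_one y_comm, one_mul, ev_X y_comm]⟩
    · by_cases h : j = i
      · exact ⟨1, 1, by simp, by rw [h, hidem]⟩
      · exact ⟨1, C 0, by simp, by rw [horth j i h, mul_zero, ev_C y_comm, map_zero, zero_mul]⟩
    · exact ⟨f, 1, hf, by rw [← mul_assoc, ev_mul_inv, ev_one y_comm]⟩
  · exact fun i f hf => ⟨eps A k i₀ i * inv A k i₀ f hf, by rw [mul_assoc, inv_mul_ev, mul_one]⟩

theorem psi_mul_y (r s : Fin n) : psi A k i₀ r * y A k i₀ s =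
    reflect A r (y A k i₀) s * psi A k i₀ r -
      A.a s r • ∑ i : Orbit A i₀, if i.1 r = 0 then eps A k i₀ i else 0 := by
  have hsum : ∑ i, eps A k i₀ i = 1 := rel .eps_sum
  rw [← mul_one (psi A k i₀ r * _), ← mul_one (reflect A r _ s * _), ← hsum, Finset.mul_sum,
    Finset.mul_sum, Finset.smul_sum, ← Finset.sum_sub_distrib]
  refine Finset.sum_congr rfl fun i _ => (rel (.psi_y r s i)).trans ?_
  rw [add_mul, sub_eq_add_neg]
  congr 1
  split_ifs
  · rw [Int.cast_neg, neg_mul, zsmul_eq_mul]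
  · rw [zero_mul, smul_zero, neg_zero]

/-- As for the Hecke generators, the relation is solved for the product with ψ_r on the right; the
constant is replaced by the sum of the ε(i) with `i_r = 0`. -/
theorem y_mul_psi (r s : Fin n) : y A k i₀ s * psi A k i₀ r =
    psi A k i₀ r * reflect A r (y A k i₀) s -
      A.a s r • ∑ i : Orbit A i₀, if i.1 r = 0 then eps A k i₀ i else 0 := by
  have h1 := psi_mul_y (A := A) (k := k) (i₀ := i₀) r s
  have h2 := psi_mul_y (A := A) (k := k) (i₀ := i₀) r r
  generalize ∑ i : Orbit A i₀, (if i.1 r = 0 then eps A k i₀ i else 0) = E at *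
  simp only [reflect, A.diag] at h1 h2 ⊢
  rw [mul_sub, mul_smul_comm, h1, h2]
  simp only [sub_mul, smul_mul_assoc]
  module

theorem normalizes :
    Normalizes (Algebra.adjoin k (diagGens A k i₀)).toSubring (psi A k i₀) := by
  have hy : ∀ r s, ∃ b ∈ Algebra.adjoin k (diagGens A k i₀), y A k i₀ s * psi A k i₀ r =
      psi A k i₀ r * reflect A r (y A k i₀) s + b := by
    refine fun r s => ⟨_, Subalgebra.neg_mem _ (Subalgebra.zsmul_mem _
      (Subalgebra.sum_mem _ fun i _ => ?_) _), (y_mul_psi r s).trans (sub_eq_add_neg _ _)⟩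
    split_ifs
    · exact eps_mem i
    · exact Subalgebra.zero_mem _
  refine normalizes_adjoin fun r a ha => ?_
  rcases ha with (⟨s, rfl⟩ | ⟨i, rfl⟩) | ⟨f, hf, rfl⟩
  · obtain ⟨b, hb, h⟩ := hy r s
    exact ⟨_, sub_mem (y_mem s) (zsmul_mem (y_mem r) _), b, hb, h⟩
  · refine ⟨_, eps_mem (i.refl r), 0, Subalgebra.zero_mem _, ?_⟩
    rw [add_zero, show psi A k i₀ r * eps A k i₀ (i.refl r) = _ from rel (.psi_eps r (i.refl r)),
      Orbit.refl_refl]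
  · obtain ⟨b, hb, h⟩ := exists_ev_mul_eq (A := A) y_comm y_mem (hy r) f
    have hg : eval 0 (polyRefl A k r f) ≠ 0 :=
      eval_polyRefl_ne_zero (by funext s; simp [reflect]) hf
    refine ⟨_, inv_mem _ hg, -(inv A k i₀ f hf * b * inv A k i₀ _ hg),
      Subalgebra.neg_mem _ (mul_mem (mul_mem (inv_mem f hf) hb) (inv_mem _ hg)), ?_⟩
    -- Multiplying `f ψ_r = ψ_r σ_r(f) + b` by `f⁻¹` on the left and `σ_r(f)⁻¹` on the right moves
    -- the inverse past ψ_r.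
    have h1 := congrArg (fun a => inv A k i₀ f hf * a * inv A k i₀ _ hg) h
    simp only [← mul_assoc, inv_mul_ev, one_mul, mul_add, add_mul] at h1
    rw [h1, mul_assoc _ (ev _ _), ev_mul_inv, mul_one, add_neg_cancel_right]

theorem eq_sum_mul_eps {a : BK A k i₀} {c : Orbit A i₀ → BK A k i₀}
    (h : ∀ i, a * eps A k i₀ i = c i * eps A k i₀ i) : a = ∑ i, c i * eps A k i₀ i := by
  have hsum : ∑ i, eps A k i₀ i = 1 := rel .eps_sum
  rw [← mul_one a, ← hsum, Finset.mul_sum]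
  exact Finset.sum_congr rfl fun i _ => h i

theorem ofNat_mem (m : ℕ) [m.AtLeastTwo] :
    (OfNat.ofNat m : BK A k i₀) ∈ Algebra.adjoin k (diagGens A k i₀) := by
  rw [← Nat.cast_ofNat]
  exact natCast_mem _ m

/-- The right-hand sides of the deformed relations are shorter words: no ψ against three, at most
one against four, at most three against six. -/
theorem braidModLower : BraidModLower (M := coxeterMatrixOf A.a)
    (Algebra.adjoin k (diagGens A k i₀)).toSubring (psi A k i₀) := by
  have hB : ∀ {b}, b ∈ Algebra.adjoin k (diagGens A k i₀) → ∀ {l}, 0 < l →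
      b ∈ wordSpan (Algebra.adjoin k (diagGens A k i₀)).toSubring (psi A k i₀) l :=
    fun hb _ hl => mem_wordSpan_of_mem hb hl
  have h1 : ∀ r {l}, 1 < l →
      psi A k i₀ r ∈ wordSpan (Algebra.adjoin k (diagGens A k i₀)).toSubring (psi A k i₀) l :=
    fun r l hl => by
      simpa using word_mem (B := (Algebra.adjoin k (diagGens A k i₀)).toSubring)
        (τ := psi A k i₀) (ω := [r]) (l := l) (by simpa using hl)
  have h3 : ∀ r s, psi A k i₀ r * psi A k i₀ s * psi A k i₀ r ∈
      wordSpan (Algebra.adjoin k (diagGens A k i₀)).toSubring (psi A k i₀) 6 :=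
    fun r s => by
      simpa [mul_assoc] using word_mem (B := (Algebra.adjoin k (diagGens A k i₀)).toSubring)
        (τ := psi A k i₀) (ω := [r, s, r]) (l := 6) (by simp)
  have hm : ∀ {b}, b ∈ Algebra.adjoin k (diagGens A k i₀) → ∀ {l x},
      x ∈ wordSpan (Algebra.adjoin k (diagGens A k i₀)).toSubring (psi A k i₀) l →
      b * x ∈ wordSpan (Algebra.adjoin k (diagGens A k i₀)).toSubring (psi A k i₀) l :=
    fun hb _ _ hx => normalizes.mul_wordSpan hb hx
  have h2 : (2 : BK A k i₀) ∈ Algebra.adjoin k (diagGens A k i₀) := ofNat_mem 2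
  have h2' : (3 : BK A k i₀) ∈ Algebra.adjoin k (diagGens A k i₀) := ofNat_mem 3
  refine braidModLower_of_edges (fun r s h => ?_) (fun r s h => ?_) (fun r s h => ?_)
    fun r s h => ?_
  · rw [show psi A k i₀ r * psi A k i₀ s = _ from rel (.psi_comm r s h), sub_self]
    exact zero_mem _
  · rw [eq_sum_mul_eps fun i => rel (.psi_single r s h i)]
    refine sum_mem fun i _ => wordSpan_mul_right (hB ?_ (by norm_num)) (eps_mem i)
    unfold singleRHS
    have := y_mem (A := A) (k := k) (i₀ := i₀)
    split_ifs
    exacts [sub_mem (this r) (this s), zero_mem _, one_mem _, neg_mem (one_mem _), zero_mem _]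
  · rw [eq_sum_mul_eps fun i => rel (.psi_double r s h i)]
    refine sum_mem fun i _ => wordSpan_mul_right ?_ (eps_mem i)
    unfold doubleRHS
    split_ifs
    · exact add_mem (hm (y_mem r) (h1 r (by norm_num))) (hB (one_mem _) (by norm_num))
    · exact zero_mem _
    · exact h1 r (by norm_num)
    · exact neg_mem (h1 r (by norm_num))
    · exact hm (neg_mem h2) (h1 s (by norm_num))
    · exact hm h2 (h1 s (by norm_num))
    · exact zero_mem _
  · rw [eq_sum_mul_eps fun i => rel (.psi_triple r s h i)]
    refine sum_mem fun i _ => wordSpan_mul_right ?_ (eps_mem i)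
    have hy := y_mem (A := A) (k := k) (i₀ := i₀)
    have h3' := fun r s => neg_mem (h3 r s)
    have h4 : ∀ {l}, 1 < l → -2 * y A k i₀ r * psi A k i₀ r ∈
        wordSpan (Algebra.adjoin k (diagGens A k i₀)).toSubring (psi A k i₀) l :=
      fun hl => hm (mul_mem (neg_mem h2) (hy r)) (h1 r hl)
    unfold tripleRHS
    refine ite_mem_of_mem (ite_mem_of_mem ?_ (zero_mem _)) (ite_mem_of_mem
      (ite_mem_of_mem (h3 r s) (ite_mem_of_mem (h3' r s)
        (ite_mem_of_mem (h4 (by norm_num)) (zero_mem _))))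
      (ite_mem_of_mem (h3 r s) (ite_mem_of_mem (h3' r s)
        (ite_mem_of_mem (hm (neg_mem h2') (h3 s r)) (ite_mem_of_mem (hm h2' (h3 s r))
          (ite_mem_of_mem (h4 (by norm_num)) (ite_mem_of_mem (neg_mem (h1 s (by norm_num)))
            (ite_mem_of_mem (h1 s (by norm_num)) (zero_mem _)))))))))
    refine add_mem (sub_mem (sub_mem (hm (add_mem (hy r) (hy s)) (h3 r s)) (hm ?_ (h3 s r)))
      (hB (pow_mem (hy r) 2) (by norm_num))) (hB (mul_mem h2' (pow_mem (hy s) 2)) (by norm_num))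
    exact mul_mem h2' (add_mem (hy r) (mul_mem h2' (hy s)))

variable [CharP k e]

/-- By the factorization, a zero would make the leading coefficient `1 - x_r⁻¹` of `t_r` vanish. -/
theorem psiP_yv_ne_zero (r : Fin n) (p : Pt A i₀) : psiP (p.1.1 r) (yv A k i₀ p r) ≠ 0 := by
  have h := one_sub_inv_eq_psiP_mul (yv A k i₀ p) r (yv_ne_algebraMap A k i₀ p r) (p.1.1 r)
  change 1 - (yv A k i₀ p r + algebraMap k _ (point k p.1.1 r))⁻¹ = _ at h
  rw [← xv_eq] at h
  intro h0
  rw [h0, zero_mul] at h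
  exact IsRationalized.tOp_ne_zero r p h

theorem model_injective : Function.Injective (model A k i₀) := by
  rw [injective_iff_map_eq_zero]
  intro a ha
  refine eq_zero_of_map_mul_diag (model A k i₀).toRingHom
    (P := fun r p => psiP (p.1.1 r) (yv A k i₀ p r)) (Q := fun r p => psiQ (p.1.1 r) (yv A k i₀ p r))
    psiP_yv_ne_zero (τ := psi A k i₀) (model_psi A k i₀) normalizes
    (fun r => ⟨0, zero_mem _, _, ?_, by rw [mul_zero, zero_add]⟩) braidModLower
    (closure_adjoin_union_eq_top (adjoin_eq_top A k i₀)) 1 ?_ ?_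
  · have hy := y_mem (A := A) (k := k) (i₀ := i₀)
    rw [← pow_two, eq_sum_mul_eps fun i => rel (.psi_sq r i)]
    refine sum_mem fun i _ => mul_mem ?_ (eps_mem i)
    unfold sqCoeff
    split_ifs
    exacts [zero_mem _, neg_mem (pow_mem (hy r) 2), neg_mem (hy r), hy r, one_mem _]
  · intro b hb
    refine isLocalized.exists_map_eq_diag (model A k i₀)
      (fun p f hf => aeval_yv_ne_zero A k i₀ p hf) (model_y A k i₀) (model_eps A k i₀) ?_ hb
    rintro _ ((⟨s, rfl⟩ | ⟨i, rfl⟩) | ⟨f, hf, rfl⟩)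
    · exact ⟨_, model_y A k i₀ s⟩
    · exact ⟨_, model_eps A k i₀ i⟩
    · exact ⟨_, model_inv A k i₀ f hf⟩
  · rw [map_one, mul_one]
    exact ha

end BK

end BKInjective

end DegBK

end

/-! ### The algebra with the Hecke-type presentation and its faithful action. -/

noncomputable section

namespace DegBK

open MvPolynomial CoxeterSystem

section HTRelations

variable {n : ℕ} {A : FiniteCartan n} {k : Type*} [Field k] {e : ℕ} {i₀ : Fin n → ZMod e}
variable [CharP k e]
variable {R S : Type*} [Ring R] [Algebra k R] [Ring S] [Algebra k S] {x t : Fin n → R}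
  {inv : (i : Orbit A i₀) → (f : MvPolynomial (Fin n) k) → eval (point k i.1) f ≠ 0 → R}

theorem map_epsOf (φ : R →ₐ[k] S) (i : Orbit A i₀) :
    φ (epsOf inv i) = epsOf (fun i f hf => φ (inv i f hf)) i := rfl

theorem HTRel.map (φ : R →ₐ[k] S) {a b : R} (h : HTRel A k i₀ x t inv a b) :
    HTRel A k i₀ (fun r => φ (x r)) (fun r => φ (t r)) (fun i f hf => φ (inv i f hf))
      (φ a) (φ b) := by
  cases h with
  | hecke a b h => exact .hecke _ _ (h.map φ.toRingHom)
  | eps_idem i => rw [map_mul]; exact .eps_idem i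
  | eps_orth i j h => rw [map_mul, map_zero]; exact .eps_orth i j h
  | eps_sum => rw [map_sum, map_one]; exact .eps_sum
  | x_eps r i => rw [map_mul, map_mul]; exact .x_eps r i
  | t_eps_zero r i h => rw [map_mul, map_mul]; exact .t_eps_zero r i h
  | t_eps r i h hi hj => rw [map_mul, map_sub, map_add, map_mul]; exact .t_eps r i h hi hj
  | eps_inv_self i f hf => rw [map_mul]; exact .eps_inv_self i f hf
  | eps_inv_ne i j f hf h => rw [map_mul, map_zero]; exact .eps_inv_ne i j f hf h
  | inv_eps_self i f hf => rw [map_mul]; exact .inv_eps_self i f hf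
  | inv_eps_ne i j f hf h => rw [map_mul, map_zero]; exact .inv_eps_ne i j f hf h
  | mul_inv i f hf => rw [map_mul, map_ev]; exact .mul_inv i f hf
  | inv_mul i f hf => rw [map_mul, map_ev]; exact .inv_mul i f hf

theorem HTRel.eq_of_map (φ : R →ₐ[k] S) (key : ∀ a b, HTRel A k i₀ x t inv a b → φ a = φ b)
    {a b : S} (h : HTRel A k i₀ (fun r => φ (x r)) (fun r => φ (t r))
      (fun i f hf => φ (inv i f hf)) a b) : a = b := by
  cases h with
  | hecke a b h =>
    exact HeckeRel.eq_of_map φ.toRingHom (fun a b h => key a b (.hecke _ _ h)) h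
  | eps_idem i => simpa [map_epsOf] using key _ _ (.eps_idem i)
  | eps_orth i j h => simpa [map_epsOf] using key _ _ (.eps_orth i j h)
  | eps_sum => simpa [map_epsOf] using key _ _ .eps_sum
  | x_eps r i => simpa [map_epsOf] using key _ _ (.x_eps r i)
  | t_eps_zero r i h => simpa [map_epsOf] using key _ _ (.t_eps_zero r i h)
  | t_eps r i h hi hj => simpa [map_epsOf] using key _ _ (.t_eps r i h hi hj)
  | eps_inv_self i f hf => simpa [map_epsOf] using key _ _ (.eps_inv_self i f hf)
  | eps_inv_ne i j f hf h => simpa [map_epsOf] using key _ _ (.eps_inv_ne i j f hf h)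
  | inv_eps_self i f hf => simpa [map_epsOf] using key _ _ (.inv_eps_self i f hf)
  | inv_eps_ne i j f hf h => simpa [map_epsOf] using key _ _ (.inv_eps_ne i j f hf h)
  | mul_inv i f hf => simpa [map_epsOf, map_ev] using key _ _ (.mul_inv i f hf)
  | inv_mul i f hf => simpa [map_epsOf, map_ev] using key _ _ (.inv_mul i f hf)

end HTRelations

section HTModel

variable {n : ℕ} (A : FiniteCartan n) (k : Type*) [Field k] {e : ℕ} (i₀ : Fin n → ZMod e)

/-- The operators `f(x)⁻¹ε(i)`. -/
def invEpsOp (i : Orbit A i₀) (f : MvPolynomial (Fin n) k) : Model A k i₀ :=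
  diag (fun p => (aeval (xv A k i₀ p) f)⁻¹) * epsOp A k i₀ i

variable {A k i₀}

theorem epsOp_mul_diag (i : Orbit A i₀) (d : Pt A i₀ → RatF k n) :
    epsOp A k i₀ i * diag d = diag d * epsOp A k i₀ i := diag_comm _ _

/-- This is the relation `φ_r ε(i) = ε(σ_r(i)) φ_r` with `φ_r = t_r + x_r⁻¹` expanded. -/
theorem tOp_mul_epsOp (r : Fin n) (i : Orbit A i₀) :
    tOp A k i₀ r * epsOp A k i₀ i = epsOp A k i₀ (i.refl r) * tOp A k i₀ r +
      invEpsOp A k i₀ (i.refl r) (X r) - invEpsOp A k i₀ i (X r) := by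
  have h := phiOp_mul_epsOp (k := k) r i
  rw [← tOp_add_inv, add_mul, mul_add, epsOp_mul_diag] at h
  simp only [invEpsOp, aeval_X]
  exact eq_sub_of_add_eq (a := tOp A k i₀ r * epsOp A k i₀ i) h

theorem diag_mul_invEpsOp (i : Orbit A i₀) {f : MvPolynomial (Fin n) k} (hf : f ≠ 0) :
    ev (xOp A k i₀) f * invEpsOp A k i₀ i f = epsOp A k i₀ i := by
  rw [ev_xOp, invEpsOp, ← mul_assoc, ← map_mul]
  refine (congrArg (diag · * epsOp A k i₀ i) ?_).trans (by rw [map_one diag, one_mul])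
  funext p
  exact mul_inv_cancel₀ (aeval_xv_ne_zero A k i₀ p hf)

theorem refl_eq_self {r : Fin n} {i : Orbit A i₀} (h : i.1 r = 0) : i.refl r = i :=
  Subtype.ext (funext fun s => by simp [Orbit.refl, reflect, h])

variable [CharP k e]

theorem epsOf_invEpsOp (i : Orbit A i₀) :
    epsOf (fun (i : Orbit A i₀) (f : MvPolynomial (Fin n) k)
      (_ : eval (point k i.1) f ≠ 0) => invEpsOp A k i₀ i f) i = epsOp A k i₀ i := by
  have h : (diag fun p => (aeval (xv A k i₀ p) (1 : MvPolynomial (Fin n) k))⁻¹) =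
      (1 : Model A k i₀) := by
    rw [← map_one diag]
    congr 1
    funext p
    rw [map_one, inv_one]
    rfl
  rw [epsOf, invEpsOp, h, one_mul]

theorem htRel_model {a b : Model A k i₀} (h : HTRel A k i₀ (xOp A k i₀) (tOp A k i₀)
    (fun i f _ => invEpsOp A k i₀ i f) a b) : a = b := by
  cases h with
  | hecke a b h => exact heckeRel_model h
  | eps_idem i => rw [epsOf_invEpsOp, epsOp_mul_self]
  | eps_orth i j h => rw [epsOf_invEpsOp, epsOf_invEpsOp, epsOp_mul_of_ne h]
  | eps_sum => simp only [epsOf_invEpsOp, sum_epsOp]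
  | x_eps r i => rw [epsOf_invEpsOp]; exact diag_comm _ _
  | t_eps_zero r i h =>
    rw [epsOf_invEpsOp, epsOf_invEpsOp, tOp_mul_epsOp, refl_eq_self h]
    exact add_sub_cancel_right (epsOp A k i₀ i * tOp A k i₀ r) _
  | t_eps r i h hi hj => rw [epsOf_invEpsOp, epsOf_invEpsOp, tOp_mul_epsOp]
  | eps_inv_self i f hf =>
    rw [epsOf_invEpsOp, invEpsOp, ← mul_assoc, epsOp_mul_diag, mul_assoc, epsOp_mul_self]
  | eps_inv_ne i j f hf h =>
    rw [epsOf_invEpsOp, invEpsOp, ← mul_assoc, epsOp_mul_diag, mul_assoc, epsOp_mul_of_ne h,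
      mul_zero]
  | inv_eps_self i f hf => rw [epsOf_invEpsOp, invEpsOp, mul_assoc, epsOp_mul_self]
  | inv_eps_ne i j f hf h =>
    rw [epsOf_invEpsOp, invEpsOp, mul_assoc, epsOp_mul_of_ne (Ne.symm h), mul_zero]
  | mul_inv i f hf =>
    rw [epsOf_invEpsOp, diag_mul_invEpsOp i (ne_zero_of_eval_ne_zero hf)]
  | inv_mul i f hf =>
    rw [epsOf_invEpsOp, ← diag_mul_invEpsOp i (ne_zero_of_eval_ne_zero hf), ev_xOp, invEpsOp,
      mul_assoc, epsOp_mul_diag, ← mul_assoc, ← mul_assoc, diag_comm]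

namespace HT

variable (A k i₀)

/-- The idempotents `ε(i)`. -/
abbrev eps (i : Orbit A i₀) : HT A k i₀ := epsOf (inv A k i₀) i

variable {A k i₀} in
theorem rel {a b : HT A k i₀} (h : HTRel A k i₀ (x A k i₀) (t A k i₀) (inv A k i₀) a b) : a = b :=
  HTRel.eq_of_map (mk A k i₀) (fun _ _ h => RingQuot.mkAlgHom_rel k h) h

/-- The generators other than the `t_r`. -/
def diagGens : Set (HT A k i₀) := Set.range (x A k i₀) ∪ {a | ∃ i f hf, inv A k i₀ i f hf = a}

theorem adjoin_eq_top :
    Algebra.adjoin k (diagGens A k i₀ ∪ Set.range (t A k i₀)) = ⊤ := by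
  rw [eq_top_iff]
  intro a _
  obtain ⟨a, rfl⟩ := RingQuot.mkAlgHom_surjective k _ a
  clear * -
  change mk A k i₀ a ∈ _
  induction a using FreeAlgebra.induction with
  | grade0 c => rw [AlgHom.commutes]; exact Subalgebra.algebraMap_mem _ c
  | grade1 g =>
    cases g with
    | x r => exact Algebra.subset_adjoin (Or.inl (Or.inl ⟨r, rfl⟩))
    | inv i f hf => exact Algebra.subset_adjoin (Or.inl (Or.inr ⟨i, f, hf, rfl⟩))
    | t r => exact Algebra.subset_adjoin (Or.inr ⟨r, rfl⟩)
  | mul a b ha hb => rw [map_mul]; exact mul_mem ha hb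
  | add a b ha hb => rw [map_add]; exact add_mem ha hb

/-- The generators as operators on the model. -/
def genOp : HTGen A k i₀ → Model A k i₀
  | .x r => xOp A k i₀ r
  | .t r => tOp A k i₀ r
  | .inv i f _ => invEpsOp A k i₀ i f

/-- The action on the model. -/
def model : HT A k i₀ →ₐ[k] Model A k i₀ :=
  RingQuot.liftAlgHom k ⟨FreeAlgebra.lift k (genOp A k i₀), fun a b h => htRel_model <| by
    simpa [genOp] using h.map (FreeAlgebra.lift k (genOp A k i₀))⟩

theorem model_x (r : Fin n) : model A k i₀ (x A k i₀ r) = xOp A k i₀ r :=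
  (RingQuot.liftAlgHom_mkAlgHom_apply k _ _ _).trans (FreeAlgebra.lift_ι_apply _ _)

theorem model_t (r : Fin n) : model A k i₀ (t A k i₀ r) = tOp A k i₀ r :=
  (RingQuot.liftAlgHom_mkAlgHom_apply k _ _ _).trans (FreeAlgebra.lift_ι_apply _ _)

theorem model_inv (i : Orbit A i₀) (f : MvPolynomial (Fin n) k) (hf) :
    model A k i₀ (inv A k i₀ i f hf) = invEpsOp A k i₀ i f :=
  (RingQuot.liftAlgHom_mkAlgHom_apply k _ _ _).trans (FreeAlgebra.lift_ι_apply _ _)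

theorem model_eps (i : Orbit A i₀) : model A k i₀ (eps A k i₀ i) = epsOp A k i₀ i :=
  (model_inv A k i₀ i 1 (by simp)).trans (epsOf_invEpsOp i)

variable {A k i₀}

theorem x_mem (r : Fin n) : x A k i₀ r ∈ Algebra.adjoin k (diagGens A k i₀) :=
  Algebra.subset_adjoin (Or.inl ⟨r, rfl⟩)

theorem inv_mem (i : Orbit A i₀) (f : MvPolynomial (Fin n) k) (hf) :
    inv A k i₀ i f hf ∈ Algebra.adjoin k (diagGens A k i₀) :=
  Algebra.subset_adjoin (Or.inr ⟨i, f, hf, rfl⟩)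

theorem x_comm (r s : Fin n) : x A k i₀ r * x A k i₀ s = x A k i₀ s * x A k i₀ r :=
  rel (.hecke _ _ (.x_comm r s))

theorem ev_mul_inv (i : Orbit A i₀) (f : MvPolynomial (Fin n) k) (hf) :
    ev (x A k i₀) f * inv A k i₀ i f hf = eps A k i₀ i :=
  rel (.mul_inv i f hf)

theorem inv_mul_ev (i : Orbit A i₀) (f : MvPolynomial (Fin n) k) (hf) :
    inv A k i₀ i f hf * ev (x A k i₀) f = eps A k i₀ i :=
  rel (.inv_mul i f hf)

theorem eps_mul_inv (i : Orbit A i₀) (f : MvPolynomial (Fin n) k) (hf) :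
    eps A k i₀ i * inv A k i₀ i f hf = inv A k i₀ i f hf :=
  rel (.eps_inv_self i f hf)

theorem inv_mul_eps (i : Orbit A i₀) (f : MvPolynomial (Fin n) k) (hf) :
    inv A k i₀ i f hf * eps A k i₀ i = inv A k i₀ i f hf :=
  rel (.inv_eps_self i f hf)

/-- Commutation of `x_r` with `f⁻¹ε(i)` is not among the relations. It follows by placing `x_r f = f
x_r` between two copies of the inverse. -/
theorem commute_inv_x (i : Orbit A i₀) (f : MvPolynomial (Fin n) k) (hf) (r : Fin n) :
    Commute (inv A k i₀ i f hf) (x A k i₀ r) := by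
  have h1 : x A k i₀ r * eps A k i₀ i = eps A k i₀ i * x A k i₀ r := rel (.x_eps r i)
  have h2 : x A k i₀ r * ev (x A k i₀) f = ev (x A k i₀) f * x A k i₀ r :=
    commute_ev (fun s => x_comm r s) f
  calc inv A k i₀ i f hf * x A k i₀ r
      = inv A k i₀ i f hf * (x A k i₀ r * ev (x A k i₀) f) * inv A k i₀ i f hf := by
        rw [mul_assoc, mul_assoc, ev_mul_inv, h1, ← mul_assoc, inv_mul_eps]
    _ = x A k i₀ r * inv A k i₀ i f hf := by
        rw [h2, ← mul_assoc, inv_mul_ev, ← h1, mul_assoc, eps_mul_inv]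

theorem isLocalized : IsLocalized (A := A) (fun i : Orbit A i₀ => point k i.1) (x A k i₀)
    (eps A k i₀) (diagGens A k i₀) := by
  have hne : ∀ i j f hf, i ≠ j → inv A k i₀ i f hf * eps A k i₀ j = 0 :=
    fun i j f hf h => rel (.inv_eps_ne i j f hf (Ne.symm h))
  refine ⟨x_comm, rel .eps_sum, fun i => rel (.eps_idem i), ?_, ?_, ?_, ?_⟩
  · rintro _ (⟨s, rfl⟩ | ⟨i, f, hf, rfl⟩) r
    · exact x_comm s r
    · exact commute_inv_x i f hf r
  · rintro _ (⟨s, rfl⟩ | ⟨j, f, hf, rfl⟩) i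
    · exact rel (.x_eps s i)
    · by_cases h : j = i
      · subst h
        exact (inv_mul_eps j f hf).trans (eps_mul_inv j f hf).symm
      · exact (hne j i f hf h).trans (rel (.eps_inv_ne j i f hf (Ne.symm h))).symm
  · rintro _ (⟨s, rfl⟩ | ⟨j, f, hf, rfl⟩) i
    · exact ⟨1, X s, by simp, by rw [ev_one x_comm, one_mul, ev_X x_comm]⟩
    · by_cases h : j = i
      · subst h
        exact ⟨f, 1, hf, by rw [inv_mul_eps, ev_mul_inv, ev_one x_comm, one_mul]⟩
      · exact ⟨1, C 0, by simp, by
          rw [hne j i f hf h, mul_zero, ev_C x_comm, map_zero, zero_mul]⟩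
  · exact fun i f hf => ⟨inv A k i₀ i f hf, inv_mul_ev i f hf⟩

/-- The relation for `t_r ε(j)` with `j = σ_r(i)`, read backwards; the two fractions in `x_r⁻¹`,
present when `j_r ≠ 0`, belong to the commutative part. -/
theorem exists_eps_mul_t (r : Fin n) (i : Orbit A i₀) :
    ∃ b ∈ Algebra.adjoin k (diagGens A k i₀),
      eps A k i₀ i * t A k i₀ r = t A k i₀ r * eps A k i₀ (i.refl r) + b := by
  have hX : ∀ {i : Orbit A i₀}, i.1 r ≠ 0 →
      eval (point k i.1) (X r : MvPolynomial (Fin n) k) ≠ 0 := fun h => by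
    rw [eval_X]; exact castHom_ne_zero h
  by_cases h : (i.refl r).1 r = 0
  · have h1 := rel (k := k) (.t_eps_zero r _ h)
    rw [Orbit.refl_refl] at h1
    exact ⟨0, Subalgebra.zero_mem _, by rw [add_zero]; exact h1.symm⟩
  · have h0 : ((i.refl r).refl r).1 r ≠ 0 := fun h0 => h (by
      rw [Orbit.refl_refl] at h0
      rwa [refl_eq_self h0])
    have h1 := rel (k := k) (.t_eps r _ h (hX h) (hX h0))
    refine ⟨inv A k i₀ (i.refl r) (X r) (hX h) - inv A k i₀ ((i.refl r).refl r) (X r) (hX h0),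
      sub_mem (inv_mem _ _ _) (inv_mem _ _ _), ?_⟩
    have h2 : epsOf (inv A k i₀) ((i.refl r).refl r) = epsOf (inv A k i₀) i := by
      rw [Orbit.refl_refl]
    rw [h1, h2]
    abel

theorem normalizes :
    Normalizes (Algebra.adjoin k (diagGens A k i₀)).toSubring (t A k i₀) := by
  have hx : ∀ r s, x A k i₀ s * t A k i₀ r = _ :=
    x_mul_t_of_t_mul_x fun r s => rel (.hecke _ _ (.t_x r s))
  refine normalizes_adjoin fun r a ha => ?_
  rcases ha with ⟨s, rfl⟩ | ⟨i, f, hf, rfl⟩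
  · exact ⟨_, sub_mem (x_mem s) (zsmul_mem (x_mem r) _), _, intCast_mem _ _, hx r s⟩
  · obtain ⟨b, hb, h⟩ := exists_ev_mul_eq (A := A) x_comm x_mem
      (fun s => ⟨_, intCast_mem _ _, hx r s⟩) f
    obtain ⟨b', hb', h'⟩ := exists_eps_mul_t (k := k) r i
    have hg : eval (point k (i.refl r).1) (polyRefl A k r f) ≠ 0 :=
      eval_polyRefl_ne_zero (point_refl A k i₀ r i) hf
    have hu := inv_mem i f hf
    have hv := inv_mem (i.refl r) _ hg
    have hv1 := eps_mul_inv (i.refl r) _ hg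
    have hv2 := ev_mul_inv (i.refl r) _ hg
    have hu1 := inv_mul_eps i f hf
    have hu2 := inv_mul_ev i f hf
    generalize inv A k i₀ i f hf = u at *
    generalize inv A k i₀ (i.refl r) _ hg = v at *
    refine ⟨v, hv, b' * v - u * b * v + u * b',
      add_mem (sub_mem (mul_mem hb' hv) (mul_mem (mul_mem hu hb) hv)) (mul_mem hu hb'), ?_⟩
    have e1 : u * t A k i₀ r = u * t A k i₀ r * eps A k i₀ (i.refl r) + u * b' := by
      rw [mul_assoc, ← mul_add, ← h', ← mul_assoc, hu1]
    -- Here `u` and `v` are inverses of `f` and `σ_r(f)` only over ε(i) and ε(σ_r(i)). Sandwiching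
    -- the commutation rule therefore produces these idempotents, and moving ε(i) past `t_r` adds
    -- the terms with `b'`.
    have e2 : u * t A k i₀ r * eps A k i₀ (i.refl r) = t A k i₀ r * v + b' * v - u * b * v := by
      have h1 := congrArg (fun a => u * a * v) h
      simp only [← mul_assoc, hu2, h', mul_add, add_mul] at h1
      rw [mul_assoc _ (ev _ _) v, hv2, mul_assoc _ _ v, hv1] at h1
      exact eq_sub_of_add_eq h1.symm
    rw [e1, e2]
    abel

theorem model_injective : Function.Injective (model A k i₀) := by
  rw [injective_iff_map_eq_zero]
  intro a ha
  have hrel : ∀ {a b}, HeckeRel A (x A k i₀) (t A k i₀) a b → a = b :=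
    fun h => rel (.hecke _ _ h)
  refine eq_zero_of_map_mul_diag (model A k i₀).toRingHom
    (P := fun r p => 1 - (xv A k i₀ p r)⁻¹) (Q := fun r p => -(xv A k i₀ p r)⁻¹)
    (fun r p => IsRationalized.tOp_ne_zero r p) (τ := t A k i₀) (model_t A k i₀) normalizes
    (fun r => ⟨0, zero_mem _, 1, one_mem _, ?_⟩) ?_
    (closure_adjoin_union_eq_top (adjoin_eq_top A k i₀)) 1 ?_ ?_
  · rw [mul_zero, zero_add, ← pow_two]
    exact hrel (.t_sq r)
  · refine braidModLower_of_edges ?_ ?_ ?_ ?_ <;> intro r s hrs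
    · rw [hrel (.t_comm r s hrs), sub_self]; exact zero_mem _
    · rw [hrel (.t_single r s hrs), sub_self]; exact zero_mem _
    · rw [hrel (.t_double r s hrs), sub_self]; exact zero_mem _
    · rw [hrel (.t_triple r s hrs), sub_self]; exact zero_mem _
  · intro b hb
    refine isLocalized.exists_map_eq_diag (model A k i₀)
      (fun p f hf => aeval_xv_ne_zero A k i₀ p hf) (model_x A k i₀) (model_eps A k i₀) ?_ hb
    rintro _ (⟨s, rfl⟩ | ⟨i, f, hf, rfl⟩)
    · exact ⟨_, model_x A k i₀ s⟩
    · exact ⟨_, (model_inv A k i₀ i f hf).trans (map_mul diag _ _).symm⟩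
  · rw [map_one, mul_one]
    exact ha

end HT

end HTModel

end DegBK

end

/-! ### Comparison of the images in the model. -/

noncomputable section

namespace DegBK

open MvPolynomial

section Ranges

theorem range_le_of_adjoin_eq_top {k R S : Type*} [CommSemiring k] [Semiring R] [Semiring S]
    [Algebra k R] [Algebra k S] (φ : R →ₐ[k] S) {s : Set R} (h : Algebra.adjoin k s = ⊤)
    {M : Subalgebra k S} (hs : ∀ a ∈ s, φ a ∈ M) : φ.range ≤ M := by
  rw [← Algebra.map_top, ← h, AlgHom.map_adjoin]
  refine Algebra.adjoin_le ?_
  rintro _ ⟨a, ha, rfl⟩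
  exact hs a ha

/-- The way homomorphisms are produced here: no relations are checked in the target algebra, since a
faithful action reduces the question to an inclusion of images. -/
theorem exists_algHom_lift {k R S T : Type*} [CommSemiring k] [Semiring R] [Semiring S]
    [Semiring T] [Algebra k R] [Algebra k S] [Algebra k T] {φ : R →ₐ[k] T} {ψ : S →ₐ[k] T}
    (hψ : Function.Injective ψ) (h : φ.range ≤ ψ.range) :
    ∃ α : R →ₐ[k] S, ∀ a, ψ (α a) = φ a := by
  refine ⟨(AlgEquiv.ofInjective ψ hψ).symm.toAlgHom.comp
    ((Subalgebra.inclusion h).comp φ.rangeRestrict), fun a => ?_⟩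
  exact congrArg Subtype.val ((AlgEquiv.ofInjective ψ hψ).apply_symm_apply
    (Subalgebra.inclusion h (φ.rangeRestrict a)))

theorem exists_algEquiv_lift {k R S T : Type*} [CommSemiring k] [Semiring R] [Semiring S]
    [Semiring T] [Algebra k R] [Algebra k S] [Algebra k T] {φ : R →ₐ[k] T} {ψ : S →ₐ[k] T}
    (hφ : Function.Injective φ) (hψ : Function.Injective ψ) (h : φ.range = ψ.range) :
    ∃ β : R ≃ₐ[k] S, ∀ a, ψ (β a) = φ a := by
  obtain ⟨α, hα⟩ := exists_algHom_lift hψ h.le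
  refine ⟨AlgEquiv.ofBijective α ⟨fun a b hab => hφ ?_, fun b => ?_⟩, hα⟩
  · rw [← hα, ← hα, hab]
  · obtain ⟨a, ha⟩ := h.ge ⟨b, rfl⟩
    exact ⟨a, hψ ((hα a).trans ha)⟩

variable {n : ℕ} {A : FiniteCartan n} {k : Type*} [Field k] {e : ℕ} {i₀ : Fin n → ZMod e}

theorem mem_of_mul_epsOp_mem {M : Subalgebra k (Model A k i₀)} {a : Model A k i₀}
    (h : ∀ i, a * epsOp A k i₀ i ∈ M) : a ∈ M := by
  rw [← mul_one a, ← sum_epsOp, Finset.mul_sum]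
  exact sum_mem fun i _ => h i

variable [CharP k e]

theorem eval_translate_neg (c : Fin n → k) (f : MvPolynomial (Fin n) k) :
    eval c (translate (-c) f) = eval 0 f := by
  have h := aeval_translate (-c) c f
  simpa [← Pi.zero_def, aeval_eq_eval] using h

theorem eval_zero_translate (c : Fin n → k) (f : MvPolynomial (Fin n) k) :
    eval 0 (translate c f) = eval c f := by
  have h := aeval_translate c (0 : Fin n → k) f
  simpa [aeval_eq_eval] using h

theorem BK.diag_mul_epsOp_mem_range (i : Orbit A i₀) (g : MvPolynomial (Fin n) k)
    {f : MvPolynomial (Fin n) k} (hf : eval 0 f ≠ 0) :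
    (diag fun p => aeval (yv A k i₀ p) g / aeval (yv A k i₀ p) f) * epsOp A k i₀ i ∈
      (BK.model A k i₀).range := by
  refine ⟨ev (y A k i₀) g * inv A k i₀ f hf * eps A k i₀ i, ?_⟩
  change BK.model A k i₀ _ = _
  rw [map_mul, map_mul, map_ev, model_inv, model_eps]
  simp only [model_y]
  rw [ev_yOp, invOp, ← map_mul]
  rfl

theorem HT.diag_mul_epsOp_mem_range (i : Orbit A i₀) (g : MvPolynomial (Fin n) k)
    {f : MvPolynomial (Fin n) k} (hf : eval (point k i.1) f ≠ 0) :
    (diag fun p => aeval (xv A k i₀ p) g / aeval (xv A k i₀ p) f) * epsOp A k i₀ i ∈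
      (HT.model A k i₀).range := by
  refine ⟨ev (x A k i₀) g * inv A k i₀ i f hf, ?_⟩
  change HT.model A k i₀ _ = _
  rw [map_mul, map_ev, model_inv]
  simp only [model_x]
  rw [ev_xOp, invEpsOp, ← mul_assoc, ← map_mul]
  rfl

theorem BK.diag_xv_mul_epsOp_mem_range (i : Orbit A i₀) (g : MvPolynomial (Fin n) k)
    {f : MvPolynomial (Fin n) k} (hf : eval (point k i.1) f ≠ 0) :
    (diag fun p => aeval (xv A k i₀ p) g / aeval (xv A k i₀ p) f) * epsOp A k i₀ i ∈
      (BK.model A k i₀).range := by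
  rw [← eval_zero_translate] at hf
  convert BK.diag_mul_epsOp_mem_range i (translate (point k i.1) g) hf using 1
  refine mul_epsOp_ext fun p hp => ?_
  subst hp
  rw [diag_dl, diag_dl, aeval_yv_translate, aeval_yv_translate]

theorem HT.diag_yv_mul_epsOp_mem_range (i : Orbit A i₀) (g : MvPolynomial (Fin n) k)
    {f : MvPolynomial (Fin n) k} (hf : eval 0 f ≠ 0) :
    (diag fun p => aeval (yv A k i₀ p) g / aeval (yv A k i₀ p) f) * epsOp A k i₀ i ∈
      (HT.model A k i₀).range := by
  rw [← eval_translate_neg (point k i.1)] at hf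
  convert HT.diag_mul_epsOp_mem_range i (translate (-point k i.1) g) hf using 1
  refine mul_epsOp_ext fun p hp => ?_
  subst hp
  rw [diag_dl, diag_dl, aeval_xv_translate, aeval_xv_translate]

variable (k) in
/-- The denominator of the correction term comparing `t_r` and `ψ_r`. -/
def sDen (c : ZMod e) (r : Fin n) : MvPolynomial (Fin n) k :=
  if c = 0 then 1 else X r + C (ZMod.castHom (dvd_refl e) k c)

theorem eval_zero_sDen_ne_zero (c : ZMod e) (r : Fin n) : eval 0 (sDen k c r) ≠ 0 := by
  unfold sDen
  split_ifs with h
  · simp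
  · simpa using castHom_ne_zero (k := k) h

theorem sv_eq (r : Fin n) (p : Pt A i₀) :
    sv A k i₀ r p = -(aeval (yv A k i₀ p) (sDen k (p.1.1 r) r))⁻¹ := by
  unfold sv sDen
  split_ifs with h
  · simp
  · rw [map_add, aeval_X, aeval_C, xv_eq]
    rfl

variable (A k i₀)

/-- It suffices to treat generators multiplied by ε(i). Translation by `i` turns fractions in `x`
regular at `i` into fractions in `y` regular at 0, and back. The passage between `t_r` and ψ_r
involves only `q_r(i)`, its inverse and the correction `s_r`, all regular at `y = 0`. -/
theorem range_model_eq : (HT.model A k i₀).range = (BK.model A k i₀).range := by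
  refine le_antisymm (range_le_of_adjoin_eq_top _ (HT.adjoin_eq_top A k i₀) ?_)
    (range_le_of_adjoin_eq_top _ (BK.adjoin_eq_top A k i₀) ?_)
  · rintro _ ((⟨r, rfl⟩ | ⟨i, f, hf, rfl⟩) | ⟨r, rfl⟩)
    · rw [HT.model_x]
      refine mem_of_mul_epsOp_mem fun i => ?_
      convert BK.diag_xv_mul_epsOp_mem_range i (X r) (f := (1 : MvPolynomial (Fin n) k)) (by simp)
        using 2
      simp [xOp]
    · rw [HT.model_inv]
      convert BK.diag_xv_mul_epsOp_mem_range i 1 hf using 2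
      simp [invEpsOp]
    · rw [HT.model_t]
      refine mem_of_mul_epsOp_mem fun i => ?_
      rw [tOp_eq, add_mul, mul_assoc]
      refine add_mem (mul_mem ⟨_, BK.model_psi A k i₀ r⟩ ?_) ?_
      · convert BK.diag_mul_epsOp_mem_range i (qNum k (i.1 r) r)
          (eval_zero_qDen_ne_zero (i.1 r) r) using 1
        refine mul_epsOp_ext fun p hp => ?_
        subst hp
        rw [diag_dl, diag_dl, qv]
      · convert BK.diag_mul_epsOp_mem_range i (-1) (eval_zero_sDen_ne_zero (i.1 r) r) using 1
        refine mul_epsOp_ext fun p hp => ?_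
        subst hp
        rw [diag_dl, diag_dl, sv_eq, map_neg, map_one, neg_div, one_div]
  · rintro _ (((⟨r, rfl⟩ | ⟨i, rfl⟩) | ⟨f, hf, rfl⟩) | ⟨r, rfl⟩)
    · rw [BK.model_y]
      refine mem_of_mul_epsOp_mem fun i => ?_
      convert HT.diag_yv_mul_epsOp_mem_range i (X r) (f := (1 : MvPolynomial (Fin n) k)) (by simp)
        using 2
      simp [yOp]
    · rw [BK.model_eps]
      exact ⟨_, HT.model_eps A k i₀ i⟩
    · rw [BK.model_inv]
      refine mem_of_mul_epsOp_mem fun i => ?_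
      convert HT.diag_yv_mul_epsOp_mem_range i 1 hf using 2
      simp [invOp]
    · rw [BK.model_psi]
      refine mem_of_mul_epsOp_mem fun i => ?_
      have h : psiOp A k i₀ r * epsOp A k i₀ i =
          tOp A k i₀ r * (diag (qv A k i₀ r)⁻¹ * epsOp A k i₀ i) +
            diag (-(sv A k i₀ r * (qv A k i₀ r)⁻¹)) * epsOp A k i₀ i := by
        rw [← mul_assoc, ← add_mul, map_neg, psiOp_eq]
        exact congrArg (· * _) (sub_eq_add_neg (tOp A k i₀ r * diag (qv A k i₀ r)⁻¹) _)
      rw [h]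
      refine add_mem (mul_mem ⟨_, HT.model_t A k i₀ r⟩ ?_) ?_
      · convert HT.diag_yv_mul_epsOp_mem_range i (qDen k (i.1 r) r)
          (eval_zero_qNum_ne_zero (i.1 r) r) using 1
        refine mul_epsOp_ext fun p hp => ?_
        subst hp
        rw [diag_dl, diag_dl, Pi.inv_apply, qv, inv_div]
      · have hne : eval 0 (sDen k (i.1 r) r * qNum k (i.1 r) r) ≠ 0 := by
          rw [map_mul]
          exact mul_ne_zero (eval_zero_sDen_ne_zero _ _) (eval_zero_qNum_ne_zero _ _)
        convert HT.diag_yv_mul_epsOp_mem_range i (qDen k (i.1 r) r) hne using 1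
        refine mul_epsOp_ext fun p hp => ?_
        subst hp
        rw [diag_dl, diag_dl, Pi.neg_apply, Pi.mul_apply, Pi.inv_apply, sv_eq, qv, inv_div, map_mul]
        congr 1
        field_simp

theorem range_bkModel_le : (BK.model A k i₀).range ≤ (Lusztig.model A k i₀).range := by
  refine range_le_of_adjoin_eq_top _ (BK.adjoin_eq_top A k i₀) ?_
  rintro _ (((⟨r, rfl⟩ | ⟨i, rfl⟩) | ⟨f, hf, rfl⟩) | ⟨r, rfl⟩)
  · exact ⟨_, (Lusztig.model_y A k i₀ r).trans (BK.model_y A k i₀ r).symm⟩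
  · exact ⟨_, (Lusztig.model_eps i).trans (BK.model_eps A k i₀ i).symm⟩
  · exact ⟨_, (Lusztig.model_inverse_ev_y (ne_zero_of_eval_ne_zero hf)).trans
      (BK.model_inv A k i₀ f hf).symm⟩
  · exact ⟨_, (Lusztig.model_psi A k i₀ r).trans (BK.model_psi A k i₀ r).symm⟩

end Ranges

end DegBK

end

theorem corollary3 {k : Type*} [Field k] (e : ℕ) [CharP k e] {n : ℕ}
    (A : DegBK.FiniteCartan n) (i₀ : Fin n → ZMod e) :
    -- the Lusztig extension is `H_F ⊗ E` as a space, and the inverses used in it exist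
    (Function.Bijective fun h : DegBK.Orbit A i₀ → DegBK.HeckeF A k =>
      ∑ i, DegBK.Lusztig.ofHF A k i₀ (h i) * DegBK.Lusztig.eps A k i₀ i) ∧
    (∀ f : MvPolynomial (Fin n) k, f ≠ 0 → IsUnit (DegBK.ev (DegBK.HeckeF.x A k) f)) ∧
    (∀ f : MvPolynomial (Fin n) k, f ≠ 0 → IsUnit (DegBK.ev (DegBK.Lusztig.y A k i₀) f)) ∧
    -- the BK algebra embeds in the Lusztig extension, generators going to the same named elements
    ∃ α : DegBK.BK A k i₀ →ₐ[k] DegBK.Lusztig A k i₀,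
      Function.Injective α ∧
      (∀ r, α (DegBK.BK.y A k i₀ r) = DegBK.Lusztig.y A k i₀ r) ∧
      (∀ r, α (DegBK.BK.psi A k i₀ r) = DegBK.Lusztig.psi A k i₀ r) ∧
      (∀ i, α (DegBK.BK.eps A k i₀ i) = DegBK.Lusztig.eps A k i₀ i) ∧
      (∀ f hf, α (DegBK.BK.inv A k i₀ f hf) =
        Ring.inverse (DegBK.ev (DegBK.Lusztig.y A k i₀) f)) ∧
      -- and it has the Hecke-type presentation
      ∃ β : DegBK.HT A k i₀ ≃ₐ[k] DegBK.BK A k i₀,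
        (∀ r, α (β (DegBK.HT.x A k i₀ r)) = DegBK.Lusztig.x A k i₀ r) ∧
        (∀ r, α (β (DegBK.HT.t A k i₀ r)) = DegBK.Lusztig.t A k i₀ r) ∧
        (∀ i f hf, α (β (DegBK.HT.inv A k i₀ i f hf)) =
          Ring.inverse (DegBK.ev (DegBK.Lusztig.x A k i₀) f) * DegBK.Lusztig.eps A k i₀ i) := by
  obtain ⟨α, hα⟩ := DegBK.exists_algHom_lift DegBK.Lusztig.model_injective
    (DegBK.range_bkModel_le A k i₀)
  obtain ⟨β, hβ⟩ := DegBK.exists_algEquiv_lift DegBK.HT.model_injective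
    DegBK.BK.model_injective (DegBK.range_model_eq A k i₀)
  refine ⟨DegBK.Lusztig.bijective_sum, fun f hf => (DegBK.HeckeF.isRationalized A k).isUnit_ev_x hf,
    fun f hf => DegBK.Lusztig.isUnit_ev_y hf, α, fun a b hab => DegBK.BK.model_injective ?_,
    fun r => DegBK.Lusztig.model_injective ?_, fun r => DegBK.Lusztig.model_injective ?_,
    fun i => DegBK.Lusztig.model_injective ?_, fun f hf => DegBK.Lusztig.model_injective ?_,
    β, fun r => DegBK.Lusztig.model_injective ?_, fun r => DegBK.Lusztig.model_injective ?_,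
    fun i f hf => DegBK.Lusztig.model_injective ?_⟩
  · rw [← hα, ← hα, hab]
  · rw [hα, DegBK.BK.model_y, DegBK.Lusztig.model_y]
  · rw [hα, DegBK.BK.model_psi, DegBK.Lusztig.model_psi]
  · rw [hα, DegBK.BK.model_eps, DegBK.Lusztig.model_eps]
  · rw [hα, DegBK.BK.model_inv,
      DegBK.Lusztig.model_inverse_ev_y (DegBK.ne_zero_of_eval_ne_zero hf)]
    rfl
  · rw [hα, hβ, DegBK.HT.model_x]
    exact ((DegBK.Lusztig.model_ofHF _).trans (DegBK.hfModel_x r)).symm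
  · rw [hα, hβ, DegBK.HT.model_t]
    exact ((DegBK.Lusztig.model_ofHF _).trans (DegBK.hfModel_t r)).symm
  · rw [hα, hβ, DegBK.HT.model_inv, map_mul,
      DegBK.Lusztig.model_inverse_ev_x (DegBK.ne_zero_of_eval_ne_zero hf), DegBK.Lusztig.model_eps]
    rfl
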